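/- Let $p$ be an odd prime, let $l\neq p$ be a prime with $l\equiv 11 \pmod{12}$, and put $N=l^2$, $\Gamma=\Gamma_0(pN)$, $C=\mathbb{P}^1(\mathbb{Q})\smallsetminus\Gamma_0(N)\cdot\{\infty\}$. Let $\Delta_C^0$ be the group of degree-zero divisors supported on $C$; it is free over $\mathbb{Z}[\bar\Gamma]$, where $\bar\Gamma$ is the image of $\Gamma$ in $\mathrm{PSL}_2(\mathbb{Z})$, and we let $e_0,\dots,e_{d-1}$ be any basis, where $d=(p+1)t$ ($t$ is the rank of $\Delta_C^0$ over the group ring of the image of $\Gamma_0(N)$). Let $\Lambda=\mathbb{Z}_p[[\mathbb{Z}_p^\times]]$, with its $(p,T)$-adic (equivalently profinite) topology, $\chi_\Lambda(x)=[x]$, $T=[\exp(p)]-1$ and $\Lambda^{>1/p}=\Lambda[[pT^{-1}]]=\Lambda[[Y]]/(TY-p)$. The monoid $\Sigma_0(p)$ of matrices $\gamma=\begin{pmatrix}a&b\\c&d\end{pmatrix}$ with $p\nmid a$, $p\mid c$, $\det\gamma\neq0$ acts in weight $\chi$ on functions $f$ on $\mathbb{Z}_p$ by $(\gamma\cdot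 f)(z)=\chi(a+cz)\,f\big(\tfrac{b+dz}{a+cz}\big)$ and on functionals by $(\mu\|\gamma)(f)=\mu(\gamma\cdot f)$. Let $\mathcal{D}^{\mathrm{int}}$ be the module of functionals $\sum_{i\ge0}c_i\delta^{[i]}$ ($c_i\in\Lambda$) on the continuous functions $\mathcal{C}(\mathbb{Z}_p;\Lambda)$ in weight $\chi_\Lambda$, where $\delta^{[i]}$ sends $f$ to its $i$-th Mahler coefficient (its coefficient on $\binom{z}{i}$). For a module $D$ of such functionals, $\mathrm{Symb}_{\Gamma,C}(D)$ is the module of homomorphisms $\varphi:\Delta_C^0\to D$ with $\varphi(\gamma x)\|\gamma=\varphi(x)$ for all $\gamma\in\Gamma$, and $(U_p\varphi)(x)=\sum_{a=0}^{p-1}\varphi(\gamma_a x)\|\gamma_a$ with $\gamma_a=\begin{pmatrix}1&a\\0&p\end{pmatrix}$. The map $\rho(\varphi)=(\varphi(e_i))_i$ is an isomorphism of $\mathrm{Symb}_{\Gamma,C}(\mathcal{D}^{\mathrm{int}})$ onto the submodule of $(\mathcal{D}^{\mathrm{int}})^{\oplus d}$ on which $[-1]\in\Lambda$ acts trivially (note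 that $-1\in\Gamma$ acts on $\mathcal{D}^{\mathrm{int}}$ by $[-1]$), and $U_p$ acts on $\mathrm{Symb}_{\Gamma,C}(\mathcal{D}^{\mathrm{int}})$. Via $\rho$, and extended by zero to the part where $[-1]=-1$, $U_p$ has a unique matrix $P=(P_{m,n})_{m,n\ge0}$ over $\Lambda$ with respect to the basis $\delta^{[0]}_0,\dots,\delta^{[0]}_{d-1},\delta^{[1]}_0,\dots,\delta^{[1]}_{d-1},\dots$ (the index denoting the copy of $\mathcal{D}^{\mathrm{int}}$). Moreover: 1. The characteristic power series $F(X)=\lim_{n\to\infty}\det\big(1-(P_{i,j})_{i,j\le n}X\big)\in\Lambda[[X]]$ is well defined: the limit exists, coefficient by coefficient. 2. Let $\Lambda\to A$ be a continuous ring homomorphism to a commutative nonarchimedean $\mathbb{Q}_p$-Banach algebra $A$; for example, $\mathrm{Sp}\,A$ an affinoid subdomain of the weight space $\mathcal{W}$ and $\Lambda\to A$ the structure map. Let $\chi:\mathbb{Z}_p^\times\to A^\times$ be the resulting character and let $0<r<1$ be such that $\chi$ is locally analytic of some radius $r_0>r$. Let $A_s(A)$ be the module of functions $\mathbb{Z}_p\to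 A$ which are locally analytic of radius $s$, let $D_s(\mathbb{Q}_p)$ be the Banach dual of $A_s(\mathbb{Q}_p)$, $D_s(A)=D_s(\mathbb{Q}_p)\widehat\otimes_{\mathbb{Q}_p}A$ and $\mathcal{D}_r^\dagger(A)=\varprojlim_{s>r}D_s(A)$, in weight $\chi$. Then the image of $F(X)$ in $A[[X]]$ is the characteristic power series of $U_p$ acting on the Fréchet module $\mathrm{Symb}_{\Gamma,C}(\mathcal{D}_r^\dagger(A))$; that is, for every $s\in(r,1)$ such that $\chi$ is locally analytic of radius $s$, $U_p$ is compact for the norm induced by $D_s(A)$ (a limit in operator norm of operators of finite rank) and its Fredholm determinant $\det(1-XU_p)$ is the image of $F(X)$. 3. Write $F(X)=\sum_{n\ge0}c_nX^n$. Then $c_n\in T^{\lambda(n)}\Lambda^{>1/p}$ for all $n\ge0$, where $\lambda(0)=0$ and $$\lambda(n)-\lambda(n-1)=\Big\lfloor\frac{n-1}{(p+1)t}\Big\rfloor-\Big\lfloor\frac{n-1}{p(p+1)t}\Big\rfloor .$$ -/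

import Mathlib

open Filter Topology
open scoped PowerSeries

noncomputable section

namespace Halo

section Iwasawa

variable (p : ℕ) [Fact p.Prime]

/-- The transition map `ℤ_p[(ℤ/p^(n+1))ˣ] → ℤ_p[(ℤ/p^n)ˣ]` induced by reduction. -/
def groupRingRed (n : ℕ) :
    MonoidAlgebra ℤ_[p] (ZMod (p ^ (n + 1)))ˣ →ₐ[ℤ_[p]] MonoidAlgebra ℤ_[p] (ZMod (p ^ n))ˣ :=
  MonoidAlgebra.mapDomainAlgHom ℤ_[p] ℤ_[p]
    (Units.map (ZMod.castHom (pow_dvd_pow p n.le_succ) (ZMod (p ^ n))).toMonoidHom)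

/-- The Iwasawa algebra `Λ = ℤ_p[[ℤ_pˣ]] = lim_n ℤ_p[(ℤ/p^n)ˣ]`, as the subalgebra of compatible
sequences in the product. -/
def iwasawaSubalgebra :
    Subalgebra ℤ_[p] (∀ n : ℕ, MonoidAlgebra ℤ_[p] (ZMod (p ^ n))ˣ) where
  carrier := {x | ∀ n, groupRingRed p n (x (n + 1)) = x n}
  mul_mem' hx hy n := by simp [hx n, hy n]
  add_mem' hx hy n := by simp [hx n, hy n]
  algebraMap_mem' r n := (groupRingRed p n).commutes r

/-- The Iwasawa algebra `Λ`. -/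
def Iwasawa : Type := iwasawaSubalgebra p

instance : CommRing (Iwasawa p) := inferInstanceAs (CommRing (iwasawaSubalgebra p))

instance : Algebra ℤ_[p] (Iwasawa p) := inferInstanceAs (Algebra ℤ_[p] (iwasawaSubalgebra p))

/-- The profinite topology of `Λ`: coordinatewise `p`-adic convergence in all the group rings
`ℤ_p[(ℤ/p^n)ˣ]`.  It coincides with the `(p, T)`-adic topology. -/
instance : TopologicalSpace (Iwasawa p) :=
  TopologicalSpace.induced
    (fun x (q : Σ n : ℕ, (ZMod (p ^ n))ˣ) => (x.1 q.1).coeff q.2) inferInstance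

variable {p}

lemma continuous_iwasawa_iff {X : Type*} [TopologicalSpace X] {f : X → Iwasawa p} :
    Continuous f ↔ ∀ (n : ℕ) (g : (ZMod (p ^ n))ˣ), Continuous fun x => ((f x).1 n).coeff g := by
  rw [continuous_induced_rng, continuous_pi_iff]
  exact ⟨fun h n g => h ⟨n, g⟩, fun h q => h q.1 q.2⟩

instance : ContinuousAdd (Iwasawa p) where
  continuous_add := by
    rw [continuous_iwasawa_iff]
    intro n g
    have h := fun q => continuous_iwasawa_iff.1 (continuous_id (X := Iwasawa p)) n q
    exact ((h g).comp continuous_fst).add ((h g).comp continuous_snd)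

instance : ContinuousMul (Iwasawa p) where
  continuous_mul := by
    classical
    rw [continuous_iwasawa_iff]
    intro n g
    have h := fun q => continuous_iwasawa_iff.1 (continuous_id (X := Iwasawa p)) n q
    have e : ∀ x : Iwasawa p × Iwasawa p, ((x.1 * x.2).1 n).coeff g =
        ∑ a, ∑ b, if a * b = g then (x.1.1 n).coeff a * (x.2.1 n).coeff b else 0 := by
      intro x
      have : (x.1 * x.2).1 n = x.1.1 n * x.2.1 n := rfl
      rw [this, MonoidAlgebra.coeff_mul, Finsupp.sum_fintype _ _ (by simp)]
      refine Finset.sum_congr rfl fun a _ => ?_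
      rw [Finsupp.sum_fintype _ _ (by simp)]
    simp_rw [e]
    refine continuous_finsetSum _ fun a _ => continuous_finsetSum _ fun b _ => ?_
    split_ifs
    · exact ((h a).comp continuous_fst).mul ((h b).comp continuous_snd)
    · exact continuous_const

instance : IsTopologicalSemiring (Iwasawa p) where

/-- The universal character `χ_Λ : ℤ_pˣ → Λ`, `x ↦ [x]`. -/
def univChar : ℤ_[p]ˣ →* Iwasawa p where
  toFun x := ⟨fun n => MonoidAlgebra.single (Units.map (PadicInt.toZModPow n).toMonoidHom x) 1, by
    intro n
    simp only [groupRingRed, MonoidAlgebra.mapDomainAlgHom_apply, MonoidAlgebra.mapDomain_single]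
    congr 1
    ext
    exact congr($(PadicInt.zmod_cast_comp_toZModPow n (n + 1) n.le_succ) (x : ℤ_[p]))⟩
  map_one' := Subtype.ext (funext fun n => by
    change _ = (1 : MonoidAlgebra ℤ_[p] (ZMod (p ^ n))ˣ)
    simp [MonoidAlgebra.one_def])
  map_mul' x y := Subtype.ext (funext fun n => by
    change _ = (MonoidAlgebra.single _ 1 : MonoidAlgebra ℤ_[p] (ZMod (p ^ n))ˣ) *
      (MonoidAlgebra.single _ 1 : MonoidAlgebra ℤ_[p] (ZMod (p ^ n))ˣ)
    simp [MonoidAlgebra.single_mul_single])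

lemma univChar_apply (x : ℤ_[p]ˣ) (n : ℕ) : (univChar x).1 n =
    MonoidAlgebra.single (Units.map (PadicInt.toZModPow n).toMonoidHom x) 1 := rfl

lemma continuous_toZModPow (n : ℕ) :
    Continuous fun x : ℤ_[p] => (PadicInt.toZModPow (p := p) n x : ZMod (p ^ n)) := by
  refine IsLocallyConstant.continuous ?_
  rw [IsLocallyConstant.iff_eventually_eq]
  intro x
  have hp : (0 : ℝ) < (p : ℝ) ^ (-n : ℤ) := by
    have : (0 : ℝ) < p := mod_cast (Fact.out : p.Prime).pos
    positivity
  filter_upwards [Metric.ball_mem_nhds x hp] with y hy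
  rw [← sub_eq_zero, ← map_sub, ← RingHom.mem_ker, PadicInt.ker_toZModPow,
    ← PadicInt.norm_le_pow_iff_mem_span_pow, ← dist_eq_norm]
  exact (Metric.mem_ball.1 hy).le

lemma continuous_univChar : Continuous (univChar (p := p)) := by
  classical
  rw [continuous_iwasawa_iff]
  intro n g
  have h : ∀ x : ℤ_[p]ˣ, ((univChar x).1 n).coeff g =
      (fun y : ZMod (p ^ n) => if y = g then (1 : ℤ_[p]) else 0)
        (PadicInt.toZModPow (p := p) n (x : ℤ_[p])) := by
    intro x
    rw [univChar_apply, MonoidAlgebra.coeff_single, Finsupp.single_apply]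
    congr 1
    simp only [Units.ext_iff, eq_iff_iff]
    rfl
  simp_rw [h]
  have h2 : Continuous fun y : ZMod (p ^ n) => if y = g then (1 : ℤ_[p]) else 0 :=
    continuous_of_discreteTopology
  exact h2.comp ((continuous_toZModPow n).comp Units.continuous_val)

variable (p) in
/-- The unit `exp(p) = ∑ pⁿ/n!` of `ℤ_p` (for `p` odd, see `coe_expUnit`). -/
def expUnit : ℤ_[p]ˣ :=
  open Classical in
  if h : ‖NormedSpace.exp (p : ℚ_[p])‖ = 1 then PadicInt.mkUnits h else 1

lemma norm_pow_div_factorial_le (n : ℕ) (hp2 : p ≠ 2) (hn : n ≠ 0) :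
    ‖((n.factorial : ℚ_[p])⁻¹ * (p : ℚ_[p]) ^ n)‖ ≤ (p : ℝ) ^ (-(((n + 1) / 2 : ℕ) : ℤ)) := by
  have hp := (Fact.out : p.Prime)
  have h1 : (1 : ℝ) ≤ p := mod_cast hp.one_le
  have hf : (n.factorial : ℚ_[p]) ≠ 0 := mod_cast n.factorial_ne_zero
  have hpp : (p : ℚ_[p]) ≠ 0 := mod_cast hp.ne_zero
  rw [Padic.norm_eq_zpow_neg_valuation (by positivity)]
  have hlt := sub_one_mul_padicValNat_factorial_lt_of_ne_zero p hn
  have h3 : 2 ≤ p - 1 := by have := hp.two_le; omega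
  have h4 : 2 * padicValNat p n.factorial < n := lt_of_le_of_lt (Nat.mul_le_mul_right _ h3) hlt
  have hv : ((n.factorial : ℚ_[p])⁻¹ * (p : ℚ_[p]) ^ n).valuation =
      (n : ℤ) - padicValNat p n.factorial := by
    rw [Padic.valuation_mul (by positivity) (by positivity), Padic.valuation_inv,
      Padic.valuation_natCast, Padic.valuation_pow, Padic.valuation_p]
    ring
  rw [hv]
  apply zpow_le_zpow_right₀ h1
  omega

lemma norm_exp_prime (hp2 : p ≠ 2) : ‖NormedSpace.exp (p : ℚ_[p])‖ = 1 := by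
  have hp := (Fact.out : p.Prime)
  have h1 : (1 : ℝ) < p := mod_cast hp.one_lt
  set f : ℕ → ℚ_[p] := fun n => (n.factorial : ℚ_[p])⁻¹ * (p : ℚ_[p]) ^ n with hf
  have hs : Summable f := by
    apply NonarchimedeanAddGroup.summable_of_tendsto_cofinite_zero
    rw [Nat.cofinite_eq_atTop]
    apply squeeze_zero_norm' (a := fun n : ℕ => ((p : ℝ)⁻¹) ^ ((n + 1) / 2))
    · filter_upwards [eventually_ne_atTop 0] with n hn
      refine (norm_pow_div_factorial_le n hp2 hn).trans_eq ?_
      rw [zpow_neg, zpow_natCast, inv_pow]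
    · refine (tendsto_pow_atTop_nhds_zero_of_lt_one (by positivity) (inv_lt_one_of_one_lt₀ h1)).comp
        (tendsto_atTop_atTop.2 fun b => ⟨2 * b, fun n hn => by omega⟩)
  have he : NormedSpace.exp (p : ℚ_[p]) = 1 + ∑' n, f (n + 1) := by
    rw [NormedSpace.exp_eq_tsum ℚ_[p]]
    simp only [smul_eq_mul]
    rw [hs.tsum_eq_zero_add]
    simp [hf]
  have hle : ‖∑' n, f (n + 1)‖ ≤ (p : ℝ)⁻¹ := by
    refine IsUltrametricDist.norm_tsum_le_of_forall_le_of_nonneg (by positivity) fun n => ?_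
    refine (norm_pow_div_factorial_le (n + 1) hp2 n.succ_ne_zero).trans ?_
    rw [← zpow_neg_one]
    apply zpow_le_zpow_right₀ h1.le
    omega
  have hlt : ‖∑' n, f (n + 1)‖ < ‖(1 : ℚ_[p])‖ := by
    rw [norm_one]; exact hle.trans_lt (inv_lt_one_of_one_lt₀ h1)
  rw [he, IsUltrametricDist.norm_add_eq_max_of_norm_ne_norm hlt.ne', max_eq_left hlt.le, norm_one]

lemma coe_expUnit (hp2 : p ≠ 2) :
    (((expUnit p : ℤ_[p]ˣ) : ℤ_[p]) : ℚ_[p]) = NormedSpace.exp (p : ℚ_[p]) := by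
  rw [expUnit, dif_pos (norm_exp_prime hp2)]
  rfl

variable (p) in
/-- The parameter `T = [exp(p)] - 1 ∈ Λ`. -/
def paramT : Iwasawa p := univChar (expUnit p) - 1

variable (p) in
/-- The ring `Λ^{>1/p} = Λ[[pT⁻¹]]`, i.e. `Λ[[Y]] / (T Y - p)`, with `Y` in the role of `p T⁻¹`. -/
abbrev IwasawaHalo : Type :=
  PowerSeries (Iwasawa p) ⧸
    Ideal.span {PowerSeries.C (paramT p) * PowerSeries.X - (p : PowerSeries (Iwasawa p))}

variable (p) in
/-- The natural map `Λ → Λ^{>1/p}`. -/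
def toHalo : Iwasawa p →+* IwasawaHalo p :=
  (Ideal.Quotient.mk _).comp PowerSeries.C

end Iwasawa

section Action

variable {p : ℕ} [Fact p.Prime] {R : Type*} [CommRing R]

variable (p) in
/-- The monoid `Σ₀(p)`: matrices `(a b; c d)` with `p ∤ a`, `p ∣ c`, `ad - bc ≠ 0`
(with entries in `ℤ_p`, so that it contains the monoid of such matrices over `ℤ_(p)`). -/
def Sigma0 : Submonoid (Matrix (Fin 2) (Fin 2) ℤ_[p]) where
  carrier := {g | IsUnit (g 0 0) ∧ (p : ℤ_[p]) ∣ g 1 0 ∧ g.det ≠ 0}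
  one_mem' := by simp
  mul_mem' {g h} hg hh := by
    refine ⟨?_, ?_, ?_⟩
    · rw [Matrix.mul_apply, Fin.sum_univ_two]
      have h1 : IsUnit (g 0 0 * h 0 0) := hg.1.mul hh.1
      have h2 : g 0 1 * h 1 0 ∈ nonunits ℤ_[p] := by
        rw [PadicInt.mem_nonunits, norm_mul]
        have : ‖h 1 0‖ < 1 := PadicInt.norm_lt_one_iff_dvd _ |>.2 hh.2.1
        exact mul_lt_one_of_nonneg_of_lt_one_right (PadicInt.norm_le_one _) (norm_nonneg _) this
      by_contra h3
      have h4 := IsLocalRing.nonunits_add (a := g 0 0 * h 0 0 + g 0 1 * h 1 0)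
        (b := -(g 0 1 * h 1 0)) h3 (by simpa [mem_nonunits_iff] using h2)
      rw [add_neg_cancel_right] at h4
      exact h4 h1
    · rw [Matrix.mul_apply, Fin.sum_univ_two]
      exact dvd_add (hg.2.1.mul_right _) (hh.2.1.mul_left _)
    · rw [Matrix.det_mul]
      exact mul_ne_zero hg.2.2 hh.2.2

/-- `a + cz` is a unit for `(a b; c d) ∈ Σ₀(p)` and `z ∈ ℤ_p`. -/
lemma isUnit_of_mem_Sigma0 {g : Matrix (Fin 2) (Fin 2) ℤ_[p]} (hg : g ∈ Sigma0 p) (z : ℤ_[p]) :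
    IsUnit (g 0 0 + g 1 0 * z) := by
  by_contra h3
  have h2 : g 1 0 * z ∈ nonunits ℤ_[p] := by
    rw [PadicInt.mem_nonunits, norm_mul]
    have : ‖g 1 0‖ < 1 := PadicInt.norm_lt_one_iff_dvd _ |>.2 hg.2.1
    exact mul_lt_one_of_nonneg_of_lt_one_left (norm_nonneg _) this (PadicInt.norm_le_one _)
  have h4 := IsLocalRing.nonunits_add (a := g 0 0 + g 1 0 * z)
    (b := -(g 1 0 * z)) h3 (by simpa [mem_nonunits_iff] using h2)
  rw [add_neg_cancel_right] at h4
  exact h4 hg.1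

/-- The unit `a + cz` of `ℤ_p` attached to `g = (a b; c d) ∈ Σ₀(p)` and `z ∈ ℤ_p`. -/
def autUnit (g : Sigma0 p) (z : ℤ_[p]) : ℤ_[p]ˣ := (isUnit_of_mem_Sigma0 g.2 z).unit

/-- The fractional linear map `z ↦ (b + dz)/(a + cz)` of `ℤ_p`, for `g = (a b; c d) ∈ Σ₀(p)`. -/
def fracLin (g : Sigma0 p) (z : ℤ_[p]) : ℤ_[p] :=
  (g.1 0 1 + g.1 1 1 * z) * ((autUnit g z)⁻¹ : ℤ_[p]ˣ)

/-- The weight `χ` action `(g · f)(z) = χ(a + cz) f((b + dz)/(a + cz))` on functions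
`f : ℤ_p → R`. -/
def weightAct (χ : ℤ_[p]ˣ →* R) (g : Sigma0 p) : (ℤ_[p] → R) →ₗ[R] (ℤ_[p] → R) where
  toFun f z := χ (autUnit g z) * f (fracLin g z)
  map_add' f₁ f₂ := by ext z; simp [mul_add]
  map_smul' r f := by ext z; simp [mul_left_comm]

/-- A module of test functions `ℤ_p → R` is stable under the weight `χ` action of `Σ₀(p)`. -/
def IsStable (χ : ℤ_[p]ˣ →* R) (S : Submodule R (ℤ_[p] → R)) : Prop :=
  ∀ (g : Sigma0 p), ∀ f ∈ S, weightAct χ g f ∈ S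

/-- The right action `(μ ‖ g)(f) = μ(g · f)` on the linear functionals on a stable module of test
functions. -/
def dualAct {χ : ℤ_[p]ˣ →* R} {S : Submodule R (ℤ_[p] → R)} (hS : IsStable χ S) (g : Sigma0 p) :
    (S →ₗ[R] R) →ₗ[R] (S →ₗ[R] R) :=
  LinearMap.lcomp R R ((weightAct χ g).restrict (hS g))

end Action

section Cusps

/-- The set of cusps `C = ℙ¹(ℚ) - Γ₀(N)·{∞}`. -/
def cuspSet (N : ℕ) : Set (OnePoint ℚ) :=
  {x | ∀ γ ∈ CongruenceSubgroup.Gamma0 N,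
    Matrix.SpecialLinearGroup.mapGL ℚ γ • (OnePoint.infty : OnePoint ℚ) ≠ x}

/-- The group `Δ_C⁰` of divisors of degree zero on `ℙ¹(ℚ)` supported on `C`. -/
def degZeroDiv (C : Set (OnePoint ℚ)) : AddSubgroup (OnePoint ℚ →₀ ℤ) where
  carrier := {D | (∀ x ∈ D.support, x ∈ C) ∧ D.sum (fun _ n => n) = 0}
  zero_mem' := by simp
  add_mem' {D E} hD hE := by
    classical
    refine ⟨fun x hx => ?_, ?_⟩
    · rcases Finset.mem_union.1 (Finsupp.support_add hx) with h | h
      exacts [hD.1 x h, hE.1 x h]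
    · rw [Finsupp.sum_add_index' (by simp) (by simp), hD.2, hE.2, add_zero]
  neg_mem' {D} hD := by
    refine ⟨fun x hx => hD.1 x (by simpa using hx), ?_⟩
    rw [Finsupp.sum_neg_index (by simp)]
    have := hD.2
    simp only [Finsupp.sum, Finset.sum_neg_distrib, neg_eq_zero] at this ⊢
    exact this

/-- The action of a permutation of `ℙ¹(ℚ)` preserving `C` on `Δ_C⁰`. -/
def divAct {C : Set (OnePoint ℚ)} (σ : OnePoint ℚ → OnePoint ℚ) (hσ : ∀ x ∈ C, σ x ∈ C) :
    degZeroDiv C →+ degZeroDiv C :=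
  ((Finsupp.mapDomain.addMonoidHom σ).comp (degZeroDiv C).subtype).codRestrict (degZeroDiv C) (by
    classical
    rintro ⟨D, hD⟩
    refine ⟨fun x hx => ?_, ?_⟩
    · obtain ⟨y, hy, rfl⟩ := Finset.mem_image.1 (Finsupp.mapDomain_support hx)
      exact hσ y (hD.1 y hy)
    · have := hD.2
      simpa [Finsupp.sum_mapDomain_index] using this)

/-- `Γ₀(M)` preserves `C = ℙ¹(ℚ) - Γ₀(N)·{∞}` if `N ∣ M`. -/
lemma gamma_smul_mem_cuspSet {M N : ℕ} (h : N ∣ M) (γ : CongruenceSubgroup.Gamma0 M) :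
    ∀ x ∈ cuspSet N, Matrix.SpecialLinearGroup.mapGL ℚ γ.1 • x ∈ cuspSet N := by
  intro x hx δ hδ he
  have hγ : γ.1 ∈ CongruenceSubgroup.Gamma0 N := by
    have := γ.2
    rw [CongruenceSubgroup.Gamma0_mem, ZMod.intCast_zmod_eq_zero_iff_dvd] at this ⊢
    exact dvd_trans (mod_cast h) this
  refine hx (γ.1⁻¹ * δ) (mul_mem (inv_mem hγ) hδ) ?_
  rw [map_mul, mul_smul, he, map_inv, inv_smul_smul]

/-- The matrix `(1 a; 0 p)` in `GL₂(ℚ)`. -/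
def heckeGL (p : ℕ) [Fact p.Prime] (a : ℕ) : GL (Fin 2) ℚ :=
  Matrix.GeneralLinearGroup.mkOfDetNeZero !![1, (a : ℚ); 0, (p : ℚ)]
    (by simpa using (Fact.out : p.Prime).ne_zero)

/-- The matrix `(1 a; 0 p)` in `Σ₀(p)`. -/
def heckeSigma (p : ℕ) [Fact p.Prime] (a : ℕ) : Sigma0 p :=
  ⟨!![1, (a : ℤ_[p]); 0, (p : ℤ_[p])], by
    refine ⟨by simp, by simp, ?_⟩
    simpa using (Fact.out : p.Prime).ne_zero⟩

/-- A point `u/w` with `u, w` coprime integers and `N ∣ w` lies in `Γ₀(N)·{∞}`. -/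
lemma exists_gamma0_smul_infty {N : ℕ} {u w : ℤ} (h : IsCoprime u w) (hN : (N : ℤ) ∣ w) :
    ∃ γ ∈ CongruenceSubgroup.Gamma0 N, γ.1 0 0 = u ∧ γ.1 1 0 = w := by
  obtain ⟨r, s, hrs⟩ := h
  refine ⟨⟨!![u, -s; w, r], by rw [Matrix.det_fin_two_of]; linear_combination hrs⟩, ?_, rfl, rfl⟩
  exact CongruenceSubgroup.Gamma0_mem.2 ((ZMod.intCast_zmod_eq_zero_iff_dvd _ _).2 hN)

/-- `(1 a; 0 p)` preserves `C = ℙ¹(ℚ) - Γ₀(N)·{∞}` if `p` is prime to `N`. -/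
lemma heckeGL_smul_mem_cuspSet {p : ℕ} [Fact p.Prime] {N : ℕ} (hpN : p.Coprime N) (a : ℕ) :
    ∀ x ∈ cuspSet N, heckeGL p a • x ∈ cuspSet N := by
  intro x hx δ hδ he
  have hp := (Fact.out : p.Prime)
  have hpQ : (p : ℚ) ≠ 0 := mod_cast hp.ne_zero
  obtain ⟨k, hk⟩ : (N : ℤ) ∣ δ.1 1 0 := by
    rwa [CongruenceSubgroup.Gamma0_mem, ZMod.intCast_zmod_eq_zero_iff_dvd] at hδ
  set α := δ.1 0 0 with hα
  set w := δ.1 1 0 with hw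
  have hcop : IsCoprime α w := by
    refine ⟨δ.1 1 1, -δ.1 0 1, ?_⟩
    have := δ.2
    rw [Matrix.det_fin_two] at this
    linear_combination this
  -- `x` is the point with homogeneous coordinates `(p α - a w, w)`
  have hmain : ∃ u v m : ℤ, m ≠ 0 ∧ IsCoprime u v ∧ (N : ℤ) ∣ v ∧
      p * α - a * w = m * u ∧ w = m * v := by
    by_cases hpk : (p : ℤ) ∣ w
    · obtain ⟨v, hv⟩ := hpk
      have hNv : (N : ℤ) ∣ v := by
        have h1 : (N : ℤ) ∣ p * v := ⟨k, by rw [← hv, hk]⟩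
        exact (Nat.isCoprime_iff_coprime.2 hpN.symm).dvd_of_dvd_mul_left h1
      refine ⟨α - a * v, v, p, mod_cast hp.ne_zero, ?_, hNv, by rw [hv]; ring, hv⟩
      have h2 : IsCoprime α v := hcop.of_isCoprime_of_dvd_right ⟨p, by rw [hv]; ring⟩
      have h3 := h2.add_mul_right_left (-(a : ℤ))
      rwa [neg_mul, ← sub_eq_add_neg] at h3
    · refine ⟨p * α - a * w, w, 1, one_ne_zero, ?_, ⟨k, hk⟩, by ring, by ring⟩
      have h1 : IsCoprime (p : ℤ) w :=
        (Nat.prime_iff_prime_int.1 hp).coprime_iff_not_dvd.2 hpk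
      have h3 := (h1.mul_left hcop).add_mul_right_left (-(a : ℤ))
      rwa [neg_mul, ← sub_eq_add_neg] at h3
  obtain ⟨u, v, m, hm, huv, hNv, hu, hv⟩ := hmain
  have hmQ : (m : ℚ) ≠ 0 := mod_cast hm
  obtain ⟨γ, hγ, h0, h1⟩ := exists_gamma0_smul_infty huv hNv
  refine hx γ hγ ?_
  refine MulAction.injective (heckeGL p a) ?_
  change heckeGL p a • _ = heckeGL p a • _
  rw [← he, ← mul_smul, OnePoint.smul_infty_eq_ite, OnePoint.smul_infty_eq_ite]
  have huQ : (p : ℚ) * α - a * w = m * u := mod_cast hu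
  have hvQ : (w : ℚ) = m * v := mod_cast hv
  have e1 : (Matrix.SpecialLinearGroup.mapGL ℚ δ) 1 0 = (w : ℚ) := by simp [hw]
  have e0 : (Matrix.SpecialLinearGroup.mapGL ℚ δ) 0 0 = (α : ℚ) := by simp [hα]
  have f1 : (heckeGL p a * Matrix.SpecialLinearGroup.mapGL ℚ γ) 1 0 = (p : ℚ) * v := by
    simp [heckeGL, Matrix.GeneralLinearGroup.mkOfDetNeZero, Matrix.mul_apply, Fin.sum_univ_two, h1]
  have f0 : (heckeGL p a * Matrix.SpecialLinearGroup.mapGL ℚ γ) 0 0 = (u : ℚ) + a * v := by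
    simp [heckeGL, Matrix.GeneralLinearGroup.mkOfDetNeZero, Matrix.mul_apply, Fin.sum_univ_two,
      h0, h1]
  rw [e1, e0, f1, f0, hvQ]
  by_cases hv0 : (v : ℚ) = 0
  · simp [hv0]
  · rw [if_neg (mul_ne_zero hpQ hv0), if_neg (mul_ne_zero hmQ hv0)]
    congr 1
    rw [div_eq_div_iff (mul_ne_zero hpQ hv0) (mul_ne_zero hmQ hv0)]
    rw [hvQ] at huQ
    linear_combination (-(v : ℚ)) * huQ

/-- An element of `Γ₀(pN)` seen in `Σ₀(p)`. -/
def gammaSigma {p : ℕ} [Fact p.Prime] {N : ℕ} (γ : CongruenceSubgroup.Gamma0 (p * N)) :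
    Sigma0 p :=
  ⟨γ.1.1.map (Int.cast : ℤ → ℤ_[p]), by
    have h := γ.2
    rw [CongruenceSubgroup.Gamma0_mem, ZMod.intCast_zmod_eq_zero_iff_dvd] at h
    have h1 : (p : ℤ) ∣ γ.1.1 1 0 := dvd_trans ⟨N, by push_cast; rfl⟩ h
    have hdet : γ.1.1 0 0 * γ.1.1 1 1 - γ.1.1 0 1 * γ.1.1 1 0 = 1 := by
      rw [← Matrix.det_fin_two]; exact γ.1.2
    have hc : (p : ℤ_[p]) ∣ ((γ.1.1 1 0 : ℤ) : ℤ_[p]) := by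
      obtain ⟨k, hk⟩ := h1
      exact ⟨k, by rw [hk]; push_cast; rfl⟩
    refine ⟨?_, hc, ?_⟩
    · by_contra h3
      have h4 : (p : ℤ_[p]) ∣ ((γ.1.1 0 0 : ℤ) : ℤ_[p]) :=
        (PadicInt.norm_lt_one_iff_dvd _).1 (PadicInt.mem_nonunits.1 h3)
      have h5 : (p : ℤ_[p]) ∣ 1 := by
        have : (1 : ℤ_[p]) = (γ.1.1 0 0 : ℤ) * (γ.1.1 1 1 : ℤ) -
            (γ.1.1 0 1 : ℤ) * (γ.1.1 1 0 : ℤ) := by exact_mod_cast hdet.symm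
        rw [this]
        exact dvd_sub (h4.mul_right _) (hc.mul_left _)
      exact PadicInt.prime_p.not_isUnit (isUnit_of_dvd_one h5)
    · rw [Matrix.det_fin_two]
      simp only [Matrix.map_apply]
      have : ((γ.1.1 0 0 : ℤ) : ℤ_[p]) * (γ.1.1 1 1 : ℤ) -
            (γ.1.1 0 1 : ℤ) * (γ.1.1 1 0 : ℤ) = 1 := by exact_mod_cast hdet
      rw [this]
      exact one_ne_zero⟩

/-- The image of `Γ₀(M)` in `PSL₂(ℤ)`, which is identified with a group of permutations
(fractional linear transformations) of `ℙ¹(ℚ)`. -/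
def moebiusGamma0 (M : ℕ) : Subgroup (Equiv.Perm (OnePoint ℚ)) :=
  (CongruenceSubgroup.Gamma0 M).map
    ((MulAction.toPermHom (GL (Fin 2) ℚ) (OnePoint ℚ)).comp (Matrix.SpecialLinearGroup.mapGL ℚ))

/-- `e` is a basis of `Δ_C⁰` as a module over `ℤ[Γ]`, where `Γ` is the image of `Γ₀(M)` in
`PSL₂(ℤ)`: the translates `σ·e_i` (`σ ∈ Γ`) form a basis of `Δ_C⁰` over `ℤ`. -/
def IsFreeBasis (C : Set (OnePoint ℚ)) (M : ℕ) {ι : Type*} (e : ι → degZeroDiv C) : Prop :=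
  LinearIndependent ℤ
    (fun q : moebiusGamma0 M × ι => Finsupp.mapDomain q.1.1 (e q.2).1) ∧
  AddSubgroup.closure
    (Set.range fun q : moebiusGamma0 M × ι => Finsupp.mapDomain q.1.1 (e q.2).1) = degZeroDiv C

end Cusps

section Symbols

variable {p : ℕ} [Fact p.Prime] {R : Type*} [CommRing R] {χ : ℤ_[p]ˣ →* R}
  {S : Submodule R (ℤ_[p] → R)}

/-- The module `Symb_{Γ,C}(D)` of `D`-valued partial modular symbols for `Γ = Γ₀(pN)` and
`C = ℙ¹(ℚ) - Γ₀(N)·{∞}`: homomorphisms `φ : Δ_C⁰ → D` with `φ(γx) ‖ γ = φ(x)` for `γ ∈ Γ`.  Here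
`D` is a module of linear functionals on a `Σ₀(p)`-stable module `S` of test functions. -/
def Symb (N : ℕ) (hS : IsStable χ S) (D : Submodule R (S →ₗ[R] R)) :
    Submodule R (degZeroDiv (cuspSet N) →ₗ[ℤ] (S →ₗ[R] R)) where
  carrier := {φ | (∀ x, φ x ∈ D) ∧ ∀ (γ : CongruenceSubgroup.Gamma0 (p * N)) x,
    dualAct hS (gammaSigma γ)
      (φ (divAct (Matrix.SpecialLinearGroup.mapGL ℚ γ.1 • ·)
        (gamma_smul_mem_cuspSet (Dvd.intro_left p rfl) γ) x)) = φ x}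
  zero_mem' := ⟨fun _ => D.zero_mem, fun γ x => by simp⟩
  add_mem' hφ hψ := ⟨fun x => D.add_mem (hφ.1 x) (hψ.1 x), fun γ x => by
    simp only [LinearMap.add_apply, map_add, hφ.2 γ x, hψ.2 γ x]⟩
  smul_mem' r φ hφ := ⟨fun x => D.smul_mem r (hφ.1 x), fun γ x => by
    simp only [LinearMap.smul_apply, map_smul, hφ.2 γ x]⟩

/-- `U` is the operator `U_p = [Γ (1 0; 0 p) Γ]` on `Symb_{Γ,C}(D)`, given by
`(U_p φ)(x) = ∑_{a=0}^{p-1} φ(γ_a x) ‖ γ_a` with `γ_a = (1 a; 0 p)`. -/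
def IsUp {N : ℕ} (hpN : p.Coprime N) (hS : IsStable χ S) (D : Submodule R (S →ₗ[R] R))
    (U : Symb N hS D →ₗ[R] Symb N hS D) : Prop :=
  ∀ (φ : Symb N hS D) (x : degZeroDiv (cuspSet N)),
    (U φ).1 x = ∑ a ∈ Finset.range p,
      dualAct hS (heckeSigma p a)
        (φ.1 (divAct (heckeGL p a • ·) (heckeGL_smul_mem_cuspSet hpN a) x))

end Symbols

section IntegralDistributions

variable {p : ℕ} [Fact p.Prime]

lemma continuous_autUnit (g : Sigma0 p) : Continuous (autUnit g) := by
  have h1 : Continuous fun z => ((autUnit g z : ℤ_[p]ˣ) : ℤ_[p]) := by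
    have : (fun z => ((autUnit g z : ℤ_[p]ˣ) : ℤ_[p])) = fun z => g.1 0 0 + g.1 1 0 * z := by
      ext z; rfl
    rw [this]; fun_prop
  rw [Units.continuous_iff]
  refine ⟨h1, continuous_iff_continuousAt.2 fun z => ?_⟩
  have h2 := (NormedRing.inverse_continuousAt (autUnit g z)).comp
    (f := fun z => ((autUnit g z : ℤ_[p]ˣ) : ℤ_[p])) h1.continuousAt
  refine h2.congr (Eventually.of_forall fun w => ?_)
  simp

lemma continuous_fracLin (g : Sigma0 p) : Continuous (fracLin g) := by
  have h := (Units.continuous_val.comp (continuous_inv.comp (continuous_autUnit g)))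
  exact (by fun_prop : Continuous fun z : ℤ_[p] => g.1 0 1 + g.1 1 1 * z).mul h

variable (p) in
/-- The module `𝒞(ℤ_p; Λ)` of continuous functions `ℤ_p → Λ`. -/
def contFun : Submodule (Iwasawa p) (ℤ_[p] → Iwasawa p) where
  carrier := {f | Continuous f}
  zero_mem' := continuous_const
  add_mem' hf hg := hf.add hg
  smul_mem' _ _ hf := continuous_const.mul hf

lemma isStable_contFun : IsStable (univChar (p := p)) (contFun p) := fun g _ hf =>
  (continuous_univChar.comp (continuous_autUnit g)).mul (Continuous.comp hf (continuous_fracLin g))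

/-- The Mahler basis function `z^[n] = binom(z, n)` in `𝒞(ℤ_p; Λ)`. -/
def mahlerFun (n : ℕ) : contFun p :=
  ⟨fun z => algebraMap ℤ_[p] (Iwasawa p) (mahler n z), by
    change Continuous _
    classical
    rw [continuous_iwasawa_iff]
    intro m g
    have h : ∀ z : ℤ_[p], ((algebraMap ℤ_[p] (Iwasawa p) (mahler n z)).1 m).coeff g =
        if g = 1 then mahler n z else 0 := by
      intro z
      change (algebraMap ℤ_[p] (MonoidAlgebra ℤ_[p] (ZMod (p ^ m))ˣ) (mahler n z)).coeff g = _
      simp [MonoidAlgebra.coeff_single, Finsupp.single_apply, eq_comm]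
    simp_rw [h]
    split_ifs
    · exact (mahler n).continuous
    · exact continuous_const⟩

variable (p) in
/-- The module `D^int` of functionals on `𝒞(ℤ_p; Λ)` of the form `∑ c_i δ^[i]`, `c_i ∈ Λ`, where
`δ^[i]` sends `f` to its `i`-th Mahler coefficient `(Δ^i f)(0)`. -/
def Dint : Submodule (Iwasawa p) (contFun p →ₗ[Iwasawa p] Iwasawa p) where
  carrier := {μ | ∃ c : ℕ → Iwasawa p, ∀ f : contFun p,
    HasSum (fun i => c i * (fwdDiff (1 : ℤ_[p]))^[i] f.1 0) (μ f)}
  zero_mem' := ⟨0, fun f => by simp⟩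
  add_mem' := by
    rintro μ ν ⟨c, hc⟩ ⟨d, hd⟩
    exact ⟨c + d, fun f => by simpa [add_mul] using (hc f).add (hd f)⟩
  smul_mem' := by
    rintro r μ ⟨c, hc⟩
    exact ⟨fun i => r * c i, fun f => by simpa [mul_assoc] using (hc f).mul_left r⟩

end IntegralDistributions

section Analytic

variable {p : ℕ} [Fact p.Prime] {A : Type*} [NormedCommRing A] [NormedAlgebra ℚ_[p] A]

/-- On the disc `‖z - a‖ ≤ s`, the function `f` is the sum of the power series
`∑ c_n (z - a)^n`, whose coefficients satisfy `‖c_n‖ s^n → 0`. -/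
def HasTaylor (s : ℝ) (a : ℤ_[p]) (f : ℤ_[p] → A) (c : ℕ → A) : Prop :=
  Tendsto (fun n => ‖c n‖ * s ^ n) atTop (𝓝 0) ∧
  ∀ z : ℤ_[p], ‖z - a‖ ≤ s → HasSum (fun n => ((z - a : ℤ_[p]) : ℚ_[p]) ^ n • c n) (f z)

variable (p A) in
/-- The module `A_s(A)` of functions `f : ℤ_p → A` which are locally analytic of radius `s`, i.e.
restrictions of `A`-valued analytic functions on `{z : |z - a| ≤ s for some a ∈ ℤ_p}`. -/
def locAn (s : ℝ) : Submodule A (ℤ_[p] → A) where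
  carrier := {f | ∀ a, ∃ c, HasTaylor s a f c}
  zero_mem' a := ⟨0, by simp, fun z _ => by simp⟩
  add_mem' {f g} hf hg a := by
    obtain ⟨c, hc, hc'⟩ := hf a
    obtain ⟨d, hd, hd'⟩ := hg a
    refine ⟨c + d, ?_, fun z hz => by simpa [smul_add] using (hc' z hz).add (hd' z hz)⟩
    have hcd := (hc.abs.add hd.abs)
    simp only [abs_zero, add_zero] at hcd
    refine squeeze_zero_norm (fun n => ?_) hcd
    rw [norm_mul, norm_norm, Real.norm_eq_abs, abs_mul, abs_mul, abs_norm, abs_norm, ← add_mul]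
    exact mul_le_mul_of_nonneg_right (norm_add_le _ _) (abs_nonneg _)
  smul_mem' r f hf a := by
    obtain ⟨c, hc, hc'⟩ := hf a
    refine ⟨fun n => r * c n, ?_, fun z hz => ?_⟩
    · have h := hc.abs.const_mul ‖r‖
      simp only [abs_zero, mul_zero] at h
      refine squeeze_zero_norm (fun n => ?_) h
      rw [norm_mul, norm_norm, Real.norm_eq_abs, abs_mul, abs_norm, ← mul_assoc]
      exact mul_le_mul_of_nonneg_right (norm_mul_le _ _) (abs_nonneg _)
    · have h := (hc' z hz).mul_left r
      simp only [mul_smul_comm] at h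
      exact h

/-- The character `χ` of `ℤ_pˣ` is locally analytic of radius `s`. -/
def IsLocAnChar (s : ℝ) (χ : ℤ_[p]ˣ →* A) : Prop :=
  ∀ a : ℤ_[p]ˣ, ∃ c : ℕ → A, Tendsto (fun n => ‖c n‖ * s ^ n) atTop (𝓝 0) ∧
    ∀ u : ℤ_[p]ˣ, ‖(u : ℤ_[p]) - a‖ ≤ s →
      HasSum (fun n => (((u : ℤ_[p]) - a : ℤ_[p]) : ℚ_[p]) ^ n • c n) (χ u)

lemma tendsto_radius_mono {s t : ℝ} (hs : 0 ≤ s) (hst : s ≤ t) {c : ℕ → A}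
    (h : Tendsto (fun n => ‖c n‖ * t ^ n) atTop (𝓝 0)) :
    Tendsto (fun n => ‖c n‖ * s ^ n) atTop (𝓝 0) :=
  squeeze_zero (fun n => by positivity)
    (fun n => mul_le_mul_of_nonneg_left (pow_le_pow_left₀ hs hst n) (norm_nonneg _)) h

lemma locAn_mono {s t : ℝ} (hs : 0 ≤ s) (hst : s ≤ t) : locAn p A t ≤ locAn p A s := fun f hf a => by
  obtain ⟨c, hc, hc'⟩ := hf a
  exact ⟨c, tendsto_radius_mono hs hst hc, fun z hz => hc' z (hz.trans hst)⟩

lemma IsLocAnChar.mono {s t : ℝ} (hs : 0 ≤ s) (hst : s ≤ t) {χ : ℤ_[p]ˣ →* A}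
    (h : IsLocAnChar t χ) : IsLocAnChar s χ := fun a => by
  obtain ⟨c, hc, hc'⟩ := h a
  exact ⟨c, tendsto_radius_mono hs hst hc, fun z hz => hc' z (hz.trans hst)⟩

variable (p A) in
/-- The module `𝒜_r^†(A) = ⋃_{s > r} A_s(A)`. -/
def daggerFun (r : ℝ) : Submodule A (ℤ_[p] → A) where
  carrier := {f | ∃ s, 0 < s ∧ r < s ∧ f ∈ locAn p A s}
  zero_mem' := ⟨max r 0 + 1, by positivity, by linarith [le_max_left r 0], zero_mem _⟩
  add_mem' := by
    rintro f g ⟨s, hs, hrs, hf⟩ ⟨t, ht, hrt, hg⟩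
    exact ⟨min s t, lt_min hs ht, lt_min hrs hrt,
      add_mem (locAn_mono (lt_min hs ht).le (min_le_left _ _) hf)
        (locAn_mono (lt_min hs ht).le (min_le_right _ _) hg)⟩
  smul_mem' := by
    rintro a f ⟨s, hs, hrs, hf⟩
    exact ⟨s, hs, hrs, Submodule.smul_mem _ a hf⟩

lemma locAn_le_daggerFun {r s : ℝ} (hs : 0 < s) (hrs : r < s) :
    locAn p A s ≤ daggerFun p A r := fun _ hf => ⟨s, hs, hrs, hf⟩

/-- The supremum norm of `f ∈ A_s(A)`: the supremum over all the discs of radius `s` of the Gauss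
norm `sup_n ‖c_n‖ s^n` of the Taylor series of `f`. -/
def taylorNorm (s : ℝ) (f : ℤ_[p] → A) : ℝ :=
  sInf {K | 0 ≤ K ∧ ∀ a, ∃ c, HasTaylor s a f c ∧ ∀ n, ‖c n‖ * s ^ n ≤ K}

lemma taylorNorm_nonneg (s : ℝ) (f : ℤ_[p] → A) : 0 ≤ taylorNorm s f :=
  Real.sInf_nonneg fun _ hK => hK.1

/-- The operator norm of a functional on `A_s(A)`. -/
def distNorm (s : ℝ) (Ψ : locAn p A s →ₗ[A] A) : ℝ :=
  sInf {K | 0 ≤ K ∧ ∀ f, ‖Ψ f‖ ≤ K * taylorNorm s f.1}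

/-- A functional on `A_s(A)` is bounded. -/
def IsBdd (s : ℝ) (Ψ : locAn p A s →ₗ[A] A) : Prop :=
  ∃ K, 0 ≤ K ∧ ∀ f, ‖Ψ f‖ ≤ K * taylorNorm s f.1

variable (A) in
/-- The inclusion `A_s(ℚ_p) → A_s(A)`. -/
def baseChange (s : ℝ) (f : locAn p ℚ_[p] s) : locAn p A s :=
  ⟨fun z => algebraMap ℚ_[p] A (f.1 z), fun a => by
    obtain ⟨c, hc, hc'⟩ := f.2 a
    refine ⟨fun n => algebraMap ℚ_[p] A (c n), ?_, fun z hz => ?_⟩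
    · have h := hc.mul_const ‖(1 : A)‖
      rw [zero_mul] at h
      refine h.congr fun n => ?_
      rw [norm_algebraMap]
      ring
    · have h := (hc' z hz).map (algebraMap ℚ_[p] A) (algebraMapCLM ℚ_[p] A).continuous
      convert h using 2 with n
      simp [Algebra.smul_def]⟩

variable (p A) in
/-- The module `D_s(A) = D_s(ℚ_p) ⊗̂ A`, where `D_s(ℚ_p)` is the Banach dual of `A_s(ℚ_p)`.  It is
realized as the module of the bounded `A`-linear functionals on `A_s(A)` whose restrictions to
`A_s(ℚ_p)` lie in the closure, for the operator norm, of the image of `D_s(ℚ_p) ⊗ A`. -/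
def distMod (s : ℝ) : Submodule A (locAn p A s →ₗ[A] A) where
  carrier := {Ψ | IsBdd s Ψ ∧ ∀ ε > 0, ∃ (n : ℕ) (μ : Fin n → locAn p ℚ_[p] s →ₗ[ℚ_[p]] ℚ_[p])
    (a : Fin n → A), (∀ i, IsBdd s (μ i)) ∧
      ∀ f, ‖Ψ (baseChange A s f) - ∑ i, μ i f • a i‖ ≤ ε * taylorNorm s f.1}
  zero_mem' := by
    refine ⟨⟨0, le_rfl, fun f => by simp⟩, fun ε hε => ⟨0, 0, 0, fun i => i.elim0, fun f => ?_⟩⟩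
    simpa using mul_nonneg hε.le (taylorNorm_nonneg _ _)
  add_mem' := by
    rintro Ψ Φ ⟨⟨K, hK, hb⟩, hΨ⟩ ⟨⟨L, hL, hb'⟩, hΦ⟩
    refine ⟨⟨K + L, add_nonneg hK hL, fun f => ?_⟩, fun ε hε => ?_⟩
    · rw [add_mul]
      exact (norm_add_le _ _).trans (add_le_add (hb f) (hb' f))
    · obtain ⟨n, μ, a, hμ, h⟩ := hΨ (ε / 2) (half_pos hε)
      obtain ⟨m, ν, b, hν, h'⟩ := hΦ (ε / 2) (half_pos hε)
      refine ⟨n + m, Fin.append μ ν, Fin.append a b, fun i => ?_, fun f => ?_⟩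
      · refine Fin.addCases (fun i => ?_) (fun i => ?_) i
        · simpa using hμ i
        · simpa using hν i
      · rw [Fin.sum_univ_add]
        simp only [Fin.append_left, Fin.append_right, LinearMap.add_apply]
        rw [add_sub_add_comm]
        refine (norm_add_le _ _).trans ((add_le_add (h f) (h' f)).trans_eq ?_)
        ring
  smul_mem' := by
    rintro r Ψ ⟨⟨K, hK, hb⟩, hΨ⟩
    refine ⟨⟨‖r‖ * K, by positivity, fun f => ?_⟩, fun ε hε => ?_⟩
    · rw [mul_assoc]
      exact (norm_mul_le _ _).trans (mul_le_mul_of_nonneg_left (hb f) (norm_nonneg _))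
    · obtain ⟨n, μ, a, hμ, h⟩ := hΨ (ε / (‖r‖ + 1)) (by positivity)
      refine ⟨n, μ, fun i => r * a i, hμ, fun f => ?_⟩
      have e : (r • Ψ) (baseChange A s f) - ∑ i, μ i f • (r * a i) =
          r * (Ψ (baseChange A s f) - ∑ i, μ i f • a i) := by
        rw [mul_sub, Finset.mul_sum]
        simp
      rw [e]
      have h1 : ‖r‖ * (ε / (‖r‖ + 1)) ≤ ε := by
        rw [mul_div_assoc', div_le_iff₀ (by positivity)]
        nlinarith [norm_nonneg r]
      calc _ ≤ ‖r‖ * (ε / (‖r‖ + 1) * taylorNorm s f.1) :=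
            (norm_mul_le _ _).trans (mul_le_mul_of_nonneg_left (h f) (norm_nonneg _))
        _ = (‖r‖ * (ε / (‖r‖ + 1))) * taylorNorm s f.1 := by ring
        _ ≤ _ := mul_le_mul_of_nonneg_right h1 (taylorNorm_nonneg _ _)

/-- The restriction to `A_s(A)` of a functional on `𝒜_r^†(A)`, for `s > r`. -/
def restrictDist {r s : ℝ} (hs : 0 < s) (hrs : r < s) :
    (daggerFun p A r →ₗ[A] A) →ₗ[A] (locAn p A s →ₗ[A] A) :=
  LinearMap.lcomp A A (Submodule.inclusion (locAn_le_daggerFun hs hrs))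

variable (p A) in
/-- The module `𝒟_r^†(A) = lim_{s > r} D_s(A)`: since the transition maps are dual to the
inclusions `A_t(A) ⊂ A_s(A)`, `s ≤ t`, a compatible family of elements of the `D_s(A)` is the same
as a functional on `𝒜_r^†(A) = ⋃_{s > r} A_s(A)` whose restriction to each `A_s(A)` is in
`D_s(A)`. -/
def daggerDist (r : ℝ) : Submodule A (daggerFun p A r →ₗ[A] A) where
  carrier := {Ψ | ∀ s (hs : 0 < s) (hrs : r < s), restrictDist hs hrs Ψ ∈ distMod p A s}
  zero_mem' s hs hrs := by rw [map_zero]; exact zero_mem _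
  add_mem' hΨ hΦ s hs hrs := by rw [map_add]; exact add_mem (hΨ s hs hrs) (hΦ s hs hrs)
  smul_mem' a Ψ hΨ s hs hrs := by rw [map_smul]; exact Submodule.smul_mem _ a (hΨ s hs hrs)

end Analytic

section Stability

variable {p : ℕ} [Fact p.Prime]

lemma nonarchimedeanRing_of_ultrametric (B : Type*) [NormedRing B] [IsUltrametricDist B] :
    NonarchimedeanRing B where
  is_nonarchimedean := NonarchimedeanAddGroup.is_nonarchimedean

/-- Cauchy products of convergent series in a nonarchimedean normed ring. -/
lemma hasSum_antidiagonal {B : Type*} [NormedRing B] [IsUltrametricDist B] {f g : ℕ → B}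
    {a b : B} (hf : HasSum f a) (hg : HasSum g b) :
    HasSum (fun n => ∑ q ∈ Finset.HasAntidiagonal.antidiagonal n, f q.1 * g q.2) (a * b) := by
  have := nonarchimedeanRing_of_ultrametric B
  have h := (Finset.HasAntidiagonal.sigmaAntidiagonalEquivProd (A := ℕ)).hasSum_iff.2 (hf.mul_of_nonarchimedean hg)
  refine h.sigma fun n => ?_
  rw [← Finset.sum_coe_sort]
  exact hasSum_fintype _

/-- Powers of a power series over `ℤ_p` can be evaluated termwise. -/
lemma hasSum_pow_coeff {H : PowerSeries ℤ_[p]} {y h : ℤ_[p]}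
    (hH : HasSum (fun k => PowerSeries.coeff k H * y ^ k) h) (n : ℕ) :
    HasSum (fun k => PowerSeries.coeff k (H ^ n) * y ^ k) (h ^ n) := by
  induction n with
  | zero =>
    simp only [pow_zero, PowerSeries.coeff_one]
    convert hasSum_ite_eq 0 (1 : ℤ_[p]) using 2 with k
    by_cases hk : k = 0 <;> simp [hk]
  | succ n ih =>
    have h2 := hasSum_antidiagonal ih hH
    rw [← pow_succ] at h2
    convert h2 using 2 with k
    rw [pow_succ, PowerSeries.coeff_mul, Finset.sum_mul]
    refine Finset.sum_congr rfl fun q hq => ?_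
    rw [← Finset.HasAntidiagonal.mem_antidiagonal.1 hq, pow_add]
    ring

lemma exists_bound_tail {e : ℕ → ℝ} (he : Tendsto e atTop (𝓝 0)) (he0 : ∀ n, 0 ≤ e n) {s : ℝ}
    (hs : 0 ≤ s) (hs1 : s < 1) {ε : ℝ} (hε : 0 < ε) :
    ∃ K, ∀ n k, n ≤ k → K ≤ k → e n * s ^ (k - n) < ε := by
  obtain ⟨N, hN⟩ := eventually_atTop.1 (he.eventually_lt_const hε)
  obtain ⟨M, hM⟩ := he.bddAbove_range
  have hM' : ∀ n, e n ≤ M := fun n => hM ⟨n, rfl⟩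
  have hM0 : 0 ≤ M := (he0 0).trans (hM' 0)
  have h2 : Tendsto (fun j : ℕ => M * s ^ j) atTop (𝓝 0) := by
    simpa using (tendsto_pow_atTop_nhds_zero_of_lt_one hs hs1).const_mul M
  obtain ⟨J, hJ⟩ := eventually_atTop.1 (h2.eventually_lt_const hε)
  refine ⟨N + J, fun n k hnk hk => ?_⟩
  rcases le_or_gt N n with h | h
  · exact (mul_le_of_le_one_right (he0 n) (pow_le_one₀ hs hs1.le)).trans_lt (hN n h)
  · exact (mul_le_mul_of_nonneg_right (hM' n) (pow_nonneg hs _)).trans_lt (hJ _ (by omega))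

variable {A : Type*} [NormedCommRing A] [NormedAlgebra ℚ_[p] A] [IsUltrametricDist A]

/-- Products of functions with convergent Taylor series. -/
lemma HasTaylor.mul {s : ℝ} (hs : 0 ≤ s) {a : ℤ_[p]} {f g : ℤ_[p] → A} {c d : ℕ → A}
    (hf : HasTaylor s a f c) (hg : HasTaylor s a g d) :
    HasTaylor s a (f * g) (fun n => ∑ q ∈ Finset.HasAntidiagonal.antidiagonal n, c q.1 * d q.2) := by
  refine ⟨?_, fun z hz => ?_⟩
  · obtain ⟨M, hM⟩ := hf.1.bddAbove_range
    obtain ⟨M', hM'⟩ := hg.1.bddAbove_range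
    have hcM : ∀ n, ‖c n‖ * s ^ n ≤ max M 1 := fun n => (hM ⟨n, rfl⟩).trans (le_max_left _ _)
    have hdM : ∀ n, ‖d n‖ * s ^ n ≤ max M' 1 := fun n => (hM' ⟨n, rfl⟩).trans (le_max_left _ _)
    have h1 : 0 < max M 1 := lt_max_of_lt_right one_pos
    have h2 : 0 < max M' 1 := lt_max_of_lt_right one_pos
    rw [Metric.tendsto_atTop]
    intro ε hε
    obtain ⟨N, hN⟩ := eventually_atTop.1 (hf.1.eventually_lt_const (u := ε / 2 / max M' 1)
      (by positivity))
    obtain ⟨N', hN'⟩ := eventually_atTop.1 (hg.1.eventually_lt_const (u := ε / 2 / max M 1)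
      (by positivity))
    refine ⟨N + N', fun n hn => ?_⟩
    rw [Real.dist_0_eq_abs, abs_of_nonneg (by positivity)]
    refine lt_of_le_of_lt ?_ (half_lt_self hε)
    have key : ∀ q ∈ Finset.HasAntidiagonal.antidiagonal n, ‖c q.1 * d q.2‖ * s ^ n ≤ ε / 2 := by
      intro q hq
      have hqn := Finset.HasAntidiagonal.mem_antidiagonal.1 hq
      calc ‖c q.1 * d q.2‖ * s ^ n ≤ ‖c q.1‖ * ‖d q.2‖ * s ^ n :=
            mul_le_mul_of_nonneg_right (norm_mul_le _ _) (by positivity)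
        _ = (‖c q.1‖ * s ^ q.1) * (‖d q.2‖ * s ^ q.2) := by rw [← hqn, pow_add]; ring
        _ ≤ ε / 2 := by
          rcases le_or_gt N q.1 with h | h
          · calc _ ≤ (ε / 2 / max M' 1) * max M' 1 :=
                  mul_le_mul (hN _ h).le (hdM _) (by positivity) (by positivity)
              _ = ε / 2 := div_mul_cancel₀ _ h2.ne'
          · calc _ ≤ max M 1 * (ε / 2 / max M 1) :=
                  mul_le_mul (hcM _) (hN' _ (by omega)).le (by positivity) (by positivity)
              _ = ε / 2 := mul_div_cancel₀ _ h1.ne'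
    rcases eq_or_lt_of_le (pow_nonneg hs n) with h0 | h0
    · rw [← h0, mul_zero]; positivity
    · rw [← le_div_iff₀ h0]
      refine IsUltrametricDist.norm_sum_le_of_forall_le_of_nonneg (by positivity) fun q hq => ?_
      rw [le_div_iff₀ h0]
      exact key q hq
  · have h := hasSum_antidiagonal (hf.2 z hz) (hg.2 z hz)
    change HasSum _ (f z * g z)
    convert h using 2 with n
    rw [Finset.smul_sum]
    refine Finset.sum_congr rfl fun q hq => ?_
    rw [← Finset.HasAntidiagonal.mem_antidiagonal.1 hq, pow_add, smul_mul_smul_comm]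

/-- Composition of a convergent Taylor series with a power series over `ℤ_p`. -/
lemma HasTaylor.comp [CompleteSpace A] {s : ℝ} (hs : 0 ≤ s) (hs1 : s < 1) {a b : ℤ_[p]}
    {f : ℤ_[p] → A} {c : ℕ → A} (hf : HasTaylor s b f c) {u : ℤ_[p] → ℤ_[p]}
    {H : PowerSeries ℤ_[p]} (hH0 : PowerSeries.constantCoeff H = 0)
    (hu : ∀ z, ‖z - a‖ ≤ s → ‖u z - b‖ ≤ s)
    (hH : ∀ z, ‖z - a‖ ≤ s →
      HasSum (fun k => PowerSeries.coeff k H * (z - a) ^ k) (u z - b)) :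
    ∃ d, HasTaylor s a (f ∘ u) d := by
  have hcoeff : ∀ n k, k < n → PowerSeries.coeff k (H ^ n) = 0 := fun n k h =>
    PowerSeries.coeff_of_lt_order _ (lt_of_lt_of_le (mod_cast h)
      (PowerSeries.le_order_pow_of_constantCoeff_eq_zero n hH0))
  have hnorm : ∀ n k, ‖((PowerSeries.coeff k (H ^ n) : ℤ_[p]) : ℚ_[p])‖ ≤ 1 := fun n k =>
    PadicInt.norm_le_one _
  have he0 : ∀ n, 0 ≤ ‖c n‖ * s ^ n := fun n => by positivity
  refine ⟨fun k => ∑ n ∈ Finset.range (k + 1),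
    ((PowerSeries.coeff k (H ^ n) : ℤ_[p]) : ℚ_[p]) • c n, ?_, fun z hz => ?_⟩
  · rw [Metric.tendsto_atTop]
    intro ε hε
    obtain ⟨K, hK⟩ := exists_bound_tail hf.1 he0 hs hs1 (half_pos hε)
    refine ⟨K, fun k hk => ?_⟩
    rw [Real.dist_0_eq_abs, abs_of_nonneg (by positivity)]
    refine lt_of_le_of_lt ?_ (half_lt_self hε)
    rcases eq_or_lt_of_le (pow_nonneg hs k) with h0 | h0
    · rw [← h0, mul_zero]; positivity
    · rw [← le_div_iff₀ h0]
      refine IsUltrametricDist.norm_sum_le_of_forall_le_of_nonneg (by positivity) fun n hn => ?_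
      rw [le_div_iff₀ h0, norm_smul]
      have hnk : n ≤ k := by simpa [Nat.lt_succ_iff] using hn
      calc _ ≤ 1 * ‖c n‖ * s ^ k := by gcongr; exact hnorm n k
        _ = ‖c n‖ * s ^ n * s ^ (k - n) := by
          rw [one_mul, mul_assoc, ← pow_add, Nat.add_sub_cancel' hnk]
        _ ≤ _ := (hK n k hnk hk).le
  · set y := z - a with hy
    let G : ℕ × ℕ → A := fun q =>
      ((PowerSeries.coeff q.2 (H ^ q.1) * y ^ q.2 : ℤ_[p]) : ℚ_[p]) • c q.1
    have hG : Summable G := by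
      apply NonarchimedeanAddGroup.summable_of_tendsto_cofinite_zero
      rw [Metric.tendsto_nhds]
      intro ε hε
      obtain ⟨K, hK⟩ := exists_bound_tail hf.1 he0 hs hs1 hε
      rw [Filter.eventually_cofinite]
      refine ((Finset.range K ×ˢ Finset.range K).finite_toSet).subset ?_
      rintro ⟨n, k⟩ hq
      by_contra hn
      refine hq ?_
      rw [dist_zero_right]
      rcases lt_or_ge k n with hkn | hnk
      · simp only [G, hcoeff n k hkn, zero_mul, PadicInt.coe_zero, zero_smul, norm_zero, hε]
      · have hk : K ≤ k := by
          by_contra hk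
          exact hn (by simp only [Finset.coe_product, Finset.coe_range, Set.mem_prod, Set.mem_Iio]; omega)
        refine lt_of_le_of_lt ?_ (hK n k hnk hk)
        simp only [G, norm_smul, PadicInt.coe_mul, PadicInt.coe_pow, norm_mul, norm_pow]
        calc _ ≤ 1 * s ^ k * ‖c n‖ := by
              gcongr
              · exact hnorm n k
              · exact hz
          _ = ‖c n‖ * s ^ n * s ^ (k - n) := by
            rw [one_mul, mul_assoc, ← pow_add, Nat.add_sub_cancel' hnk, mul_comm]
    have h1 : ∀ n, HasSum (fun k => G (n, k)) (((u z - b : ℤ_[p]) : ℚ_[p]) ^ n • c n) := by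
      intro n
      have h := hasSum_pow_coeff (hH z hz) n
      have h' := h.map (PadicInt.Coe.ringHom (p := p)) continuous_subtype_val
      have h'' := h'.smul_const (c n)
      convert h'' using 1
      · rfl
      · rw [map_pow]
        rfl
    have hsum : HasSum G (f (u z)) := by
      have h2 := hG.hasSum.prod_fiberwise h1
      rw [← h2.unique (hf.2 (u z) (hu z hz))]
      exact hG.hasSum
    have hsum' : HasSum (G ∘ Equiv.prodComm ℕ ℕ) (f (u z)) :=
      (Equiv.prodComm ℕ ℕ).hasSum_iff.2 hsum
    refine hsum'.prod_fiberwise fun k => ?_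
    have h3 : HasSum (fun n => (G ∘ Equiv.prodComm ℕ ℕ) (k, n))
        (∑ n ∈ Finset.range (k + 1), G (n, k)) := by
      refine hasSum_sum_of_ne_finset_zero fun n hn => ?_
      have hkn : k < n := by simpa [Nat.lt_succ_iff] using hn
      simp only [G, Function.comp, Equiv.prodComm_apply, Prod.swap, hcoeff n k hkn, zero_mul,
        PadicInt.coe_zero, zero_smul]
    convert h3 using 1
    rw [Finset.smul_sum]
    refine Finset.sum_congr rfl fun n _ => ?_
    simp only [G, PadicInt.coe_mul, PadicInt.coe_pow, smul_smul]
    rw [mul_comm]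

lemma coe_autUnit (g : Sigma0 p) (z : ℤ_[p]) :
    ((autUnit g z : ℤ_[p]ˣ) : ℤ_[p]) = g.1 0 0 + g.1 1 0 * z := rfl

lemma fracLin_sub (g : Sigma0 p) (z a : ℤ_[p]) :
    fracLin g z - fracLin g a = g.1.det * (((autUnit g a)⁻¹ : ℤ_[p]ˣ) : ℤ_[p]) *
      (((autUnit g z)⁻¹ : ℤ_[p]ˣ) : ℤ_[p]) * (z - a) := by
  have h1 := (autUnit g a).mul_inv
  have h2 := (autUnit g z).mul_inv
  rw [coe_autUnit] at h1 h2
  simp only [fracLin, Matrix.det_fin_two]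
  set U := (((autUnit g a)⁻¹ : ℤ_[p]ˣ) : ℤ_[p])
  set W := (((autUnit g z)⁻¹ : ℤ_[p]ˣ) : ℤ_[p])
  linear_combination (-(g.1 0 1 + g.1 1 1 * z) * W) * h1 + ((g.1 0 1 + g.1 1 1 * a) * U) * h2

/-- The Taylor expansion of `z ↦ (b + dz)/(a + cz)`. -/
lemma exists_fracLin_series (g : Sigma0 p) (a : ℤ_[p]) :
    ∃ H : PowerSeries ℤ_[p], PowerSeries.constantCoeff H = 0 ∧ ∀ z, ‖z - a‖ < 1 →
      HasSum (fun k => PowerSeries.coeff k H * (z - a) ^ k) (fracLin g z - fracLin g a) := by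
  set u := autUnit g a with hu
  set v : ℤ_[p] := -(g.1 1 0 * ((u⁻¹ : ℤ_[p]ˣ) : ℤ_[p])) with hv
  refine ⟨PowerSeries.C (g.1.det * ((u⁻¹ : ℤ_[p]ˣ) : ℤ_[p]) ^ 2) *
    (PowerSeries.X * PowerSeries.mk fun k => v ^ k), by simp, fun z hz => ?_⟩
  set y := z - a with hy
  have hvy : ‖v * y‖ < 1 := by
    rw [norm_mul]
    exact mul_lt_one_of_nonneg_of_lt_one_right (PadicInt.norm_le_one _) (norm_nonneg _) hz
  have hgeo : HasSum (fun k => (v * y) ^ k) (Ring.inverse (1 - v * y)) := by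
    have h := hasSum_geom_series_inverse (v * y) hvy
    exact h
  have hval : fracLin g z - fracLin g a =
      g.1.det * ((u⁻¹ : ℤ_[p]ˣ) : ℤ_[p]) ^ 2 * (y * Ring.inverse (1 - v * y)) := by
    have hw : ((autUnit g z * u⁻¹ : ℤ_[p]ˣ) : ℤ_[p]) = 1 - v * y := by
      have h1 : (u : ℤ_[p]) * ((u⁻¹ : ℤ_[p]ˣ) : ℤ_[p]) = 1 := u.mul_inv
      rw [Units.val_mul, coe_autUnit, hv, hy]
      rw [hu, coe_autUnit] at h1
      rw [hu]
      linear_combination h1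
    rw [← hw, Ring.inverse_unit]
    have h1 : (u : ℤ_[p]) * ((u⁻¹ : ℤ_[p]ˣ) : ℤ_[p]) = 1 := u.mul_inv
    rw [fracLin_sub, ← hu, mul_inv_rev, inv_inv, Units.val_mul, hy]
    linear_combination (-(g.1.det * ((u⁻¹ : ℤ_[p]ˣ) : ℤ_[p]) *
      (((autUnit g z)⁻¹ : ℤ_[p]ˣ) : ℤ_[p]) * (z - a))) * h1
  rw [hval]
  have h := (hgeo.mul_left y).mul_left (g.1.det * ((u⁻¹ : ℤ_[p]ˣ) : ℤ_[p]) ^ 2)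
  rw [← hasSum_nat_add_iff' 1]
  simp only [Finset.range_one, Finset.sum_singleton, PowerSeries.coeff_C_mul,
    PowerSeries.coeff_zero_X_mul, PowerSeries.coeff_succ_X_mul, PowerSeries.coeff_mk, mul_zero,
    zero_mul, sub_zero]
  have e : (fun k => g.1.det * ((u⁻¹ : ℤ_[p]ˣ) : ℤ_[p]) ^ 2 * v ^ k * y ^ (k + 1)) =
      fun k => g.1.det * ((u⁻¹ : ℤ_[p]ˣ) : ℤ_[p]) ^ 2 * (y * (v * y) ^ k) := by
    ext k : 1
    rw [mul_pow, pow_succ]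
    ring
  rw [e]
  exact h

/-- `(b + dz)/(a + cz)` is `1`-Lipschitz on `ℤ_p`. -/
lemma norm_fracLin_sub_le (g : Sigma0 p) (z a : ℤ_[p]) :
    ‖fracLin g z - fracLin g a‖ ≤ ‖z - a‖ := by
  rw [fracLin_sub, norm_mul]
  exact mul_le_of_le_one_left (norm_nonneg _) (PadicInt.norm_le_one _)

lemma exists_hasTaylor_weightAct [CompleteSpace A] {s : ℝ} (hs : 0 ≤ s) (hs1 : s < 1)
    {χ : ℤ_[p]ˣ →* A} (hχ : IsLocAnChar s χ) (g : Sigma0 p) {f : ℤ_[p] → A}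
    (hf : f ∈ locAn p A s) : weightAct χ g f ∈ locAn p A s := by
  intro a
  obtain ⟨b, hb, hb'⟩ := hχ (autUnit g a)
  obtain ⟨c, hc⟩ := hf (fracLin g a)
  obtain ⟨H, hH0, hH⟩ := exists_fracLin_series g a
  obtain ⟨d, hd⟩ := hc.comp hs hs1 (u := fracLin g) hH0
    (fun z hz => (norm_fracLin_sub_le g z a).trans hz) (fun z hz => hH z (hz.trans_lt hs1))
  have hχT : HasTaylor s a (fun z => χ (autUnit g z))
      (fun n => ((g.1 1 0 : ℤ_[p]) : ℚ_[p]) ^ n • b n) := by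
    refine ⟨squeeze_zero (fun n => by positivity) (fun n => ?_) hb, fun z hz => ?_⟩
    · rw [norm_smul, norm_pow]
      refine mul_le_mul_of_nonneg_right ?_ (by positivity)
      exact mul_le_of_le_one_left (norm_nonneg _)
        (pow_le_one₀ (norm_nonneg _) (PadicInt.norm_le_one _))
    · have e : (autUnit g z : ℤ_[p]) - autUnit g a = g.1 1 0 * (z - a) := by
        rw [coe_autUnit, coe_autUnit]; ring
      have h := hb' (autUnit g z) (by
        rw [e, norm_mul]
        exact (mul_le_of_le_one_left (norm_nonneg _) (PadicInt.norm_le_one _)).trans hz)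
      convert h using 2 with n
      rw [e, smul_smul, PadicInt.coe_mul, mul_pow, mul_comm]
  exact ⟨_, HasTaylor.mul hs hχT hd⟩

/-- `𝒜_r^†(A)` is stable under the weight `χ` action if `χ` is locally analytic of some radius
`> r`. -/
lemma isStable_daggerFun [CompleteSpace A] {r : ℝ} (hr1 : r < 1) {χ : ℤ_[p]ˣ →* A}
    (hχ : ∃ s, 0 < s ∧ r < s ∧ IsLocAnChar s χ) : IsStable χ (daggerFun p A r) := by
  obtain ⟨t, ht, hrt, hχ⟩ := hχ
  rintro g f ⟨s, hs, hrs, hf⟩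
  obtain ⟨q, hq, hq1⟩ := exists_between (show max r 0 < 1 from max_lt hr1 one_pos)
  set m := min (min s t) q with hm
  have h0 : 0 < m := lt_min (lt_min hs ht) ((le_max_right _ _).trans_lt hq)
  refine ⟨m, h0, lt_min (lt_min hrs hrt) ((le_max_left _ _).trans_lt hq), ?_⟩
  exact exists_hasTaylor_weightAct h0.le ((min_le_right _ _).trans_lt hq1)
    (hχ.mono h0.le ((min_le_left _ _).trans (min_le_right _ _))) g
    (locAn_mono h0.le ((min_le_left _ _).trans (min_le_left _ _)) hf)

end Stability

section Fredholm

/-- `F` is the characteristic power series (Fredholm determinant) `det(1 - X U)` of the compact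
operator `U` on the module `M` normed by `‖·‖ = N` over the Banach algebra `A`: `U` is a limit, in
the operator norm, of operators of finite rank `U_k = ∑_{i < d_k} λ_{k,i} ⊗ m_{k,i}`, where the
`λ_{k,i}` are bounded functionals on `M` and `m_{k,i} ∈ M`, and `F` is the coefficientwise limit of
the polynomials `det(1 - X U_k) = det(1 - X (λ_{k,i}(m_{k,j}))_{i,j < d_k})`. -/
def IsCharSeries {A : Type*} [NormedCommRing A] {M : Type*} [AddCommGroup M] [Module A M]
    (N : M → ℝ) (U : M →ₗ[A] M) (F : PowerSeries A) : Prop :=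
  ∃ (d : ℕ → ℕ) (lam : ∀ k, Fin (d k) → M →ₗ[A] A) (m : ∀ k, Fin (d k) → M),
    (∀ k i, ∃ K, ∀ x, ‖lam k i x‖ ≤ K * N x) ∧
    (∀ ε > 0, ∀ᶠ k in atTop, ∀ x, N (U x - ∑ i, lam k i x • m k i) ≤ ε * N x) ∧
    ∀ n, Tendsto (fun k => (Matrix.of fun i j => lam k i (m k j)).charpolyRev.coeff n) atTop
      (𝓝 (PowerSeries.coeff n F))

variable {p : ℕ} [Fact p.Prime]

/-- The norm `φ ↦ max_i ‖φ(e_i)‖_s` on `Symb_{Γ,C}(𝒟_r^†(A))`, for `s > r`, where `(e_i)` is a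
finite family of generators of `Δ_C⁰` over `ℤ[Γ]` and `‖·‖_s` is the norm of `D_s(A)`.  The norms
for the various `s > r` define the Fréchet topology of `Symb_{Γ,C}(𝒟_r^†(A))`. -/
def symbNorm {A : Type*} [NormedCommRing A] [NormedAlgebra ℚ_[p] A] {χ : ℤ_[p]ˣ →* A} {r : ℝ}
    {N : ℕ} {hS : IsStable χ (daggerFun p A r)} {ι : Type*} (e : ι → degZeroDiv (cuspSet N))
    {s : ℝ} (hs : 0 < s) (hrs : r < s) (φ : Symb N hS (daggerDist p A r)) : ℝ :=
  ⨆ i, distNorm s (restrictDist hs hrs (φ.1 (e i)))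

/-- `F ∈ A[[X]]` is the characteristic power series of `U` acting on the Fréchet module
`Symb_{Γ,C}(𝒟_r^†(A))`, for a character `χ`: for every `s > r` (`s < 1`) such that `χ` is locally
analytic of radius `s`, `U` is compact with characteristic power series `F` for the norm induced by
`D_s(A)`. -/
def IsCharSeriesDagger {A : Type*} [NormedCommRing A] [NormedAlgebra ℚ_[p] A] {χ : ℤ_[p]ˣ →* A}
    {r : ℝ} {N : ℕ} {hS : IsStable χ (daggerFun p A r)} {ι : Type*}
    (e : ι → degZeroDiv (cuspSet N))
    (U : Symb N hS (daggerDist p A r) →ₗ[A] Symb N hS (daggerDist p A r)) (F : PowerSeries A) :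
    Prop :=
  ∀ (s : ℝ) (hs : 0 < s) (hrs : r < s), s < 1 → IsLocAnChar s χ →
    IsCharSeries (A := A) (M := Symb N hS (daggerDist p A r)) (symbNorm e hs hrs) U F

/-- The character `ℤ_pˣ → Λˣ → Aˣ` attached to a ring homomorphism `κ : Λ → A`. -/
def tautChar {A : Type*} [CommRing A] (κ : Iwasawa p →+* A) : ℤ_[p]ˣ →* A :=
  κ.toMonoidHom.comp univChar

end Fredholm

section UpMatrix

variable {p : ℕ} [Fact p.Prime]

/-- The map `ρ : Symb_{Γ,C}(D^int) → (D^int)^d`, `φ ↦ (φ(e_i))_i`. -/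
def evalMap {N : ℕ} {d : ℕ} (e : Fin d → degZeroDiv (cuspSet N))
    (φ : Symb N (isStable_contFun (p := p)) (Dint p)) : Fin d → Dint p :=
  fun i => ⟨φ.1 (e i), φ.2.1 (e i)⟩

/-- `P` is the matrix of the operator `U` on `Symb_{Γ,C}(D^int)`, via `ρ`, with respect to the basis
`δ_0^[0], …, δ_{d-1}^[0], δ_0^[1], …, δ_{d-1}^[1], …`, in which `δ_i^[n]` has the index `n d + i`:
the coordinates of `U φ` (that is, the values of `(U φ)(e_i)` on the Mahler basis) are obtained
from those of `φ` by multiplication by `P`.  Since `-1 ∈ Γ` acts on `D^int` by `[-1] ∈ Λ`, only the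
part of `(D^int)^d` on which `[-1] = 1` comes from symbols; `P` is the matrix of `U` on this part
and of zero on its complement, where `[-1] = -1`. -/
def IsMahlerMatrix {N : ℕ} {d : ℕ} (e : Fin d → degZeroDiv (cuspSet N))
    (U : Symb N (isStable_contFun (p := p)) (Dint p) →ₗ[Iwasawa p]
      Symb N (isStable_contFun (p := p)) (Dint p))
    (P : ℕ → ℕ → Iwasawa p) : Prop :=
  (∀ φ (m : ℕ) (i : Fin d), HasSum (fun q : ℕ × Fin d =>
      P (m * d + i) (q.1 * d + q.2) * (evalMap e φ q.2).1 (mahlerFun q.1))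
    ((evalMap e (U φ) i).1 (mahlerFun m))) ∧
  ∀ k k', univChar (-1) * P k k' = P k k'

/-- `F` is the limit, coefficient by coefficient, of the characteristic polynomials
`det(1 - (P_{i,j})_{i,j<n} X)`. -/
def IsLimitCharSeries (P : ℕ → ℕ → Iwasawa p) (F : PowerSeries (Iwasawa p)) : Prop :=
  ∀ k, Tendsto (fun n : ℕ => (Matrix.of fun i j : Fin n => P i j).charpolyRev.coeff k) atTop
    (𝓝 (PowerSeries.coeff k F))

/-- The function `λ` with `λ(0) = 0` and
`λ(n) - λ(n-1) = ⌊(n-1)/((p+1)t)⌋ - ⌊(n-1)/(p(p+1)t)⌋`. -/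
def lowerBound (p t : ℕ) : ℕ → ℕ
  | 0 => 0
  | n + 1 => lowerBound p t n + (n / ((p + 1) * t) - n / (p * ((p + 1) * t)))

end UpMatrix

end Halo

end

open Halo

noncomputable section

namespace Halo

/-! Each `γ_a e_i` is a finite integral combination of translates `σ e_j`, so `U_p` is a finite sum
of terms `φ ↦ φ(e_j) ‖ g` with `g = σ⁻¹ γ_a` (`IsUp.apply_basis`). The lower row `(c, d)` of such a
`g` is divisible by `p` (`heckeElt_dvd`). Everything rests on this contraction.

The integral estimate says that the `n`-th difference of `z ↦ [a+cz] binom((b+dz)/(a+cz), m)` has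
values in `(p, T)^(n - ⌊m/p⌋)` (`fwdDiff_weightAct_mahler_mem`). These functions are the
coefficients of `[v(z)] (1+X)^{h(z)}`, a product of two exponentials composed with functions whose
`n`-th differences are divisible by `p^n`. For such compositions (`filDiff_exp`) it is enough to
know that `[v] - 1` is in `(p, T)^k` when `v ≡ 1` modulo `p^k` (`univChar_sub_one_mem`), and that
`(1+X)^x - 1` has weight `k` when `p^k ∣ x`, where `X^m` counts with weight `⌊m/p⌋`
(`binomialSeries_sub_one_mem`).

The matrix thus satisfies `P i j ∈ (p, T)^(⌊j/d⌋ - ⌊i/(pd)⌋)`, with `d` now the rank. In a principal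
minor on a set `S` the exponents add up to at least `∑_{i ∈ S} (⌊i/d⌋ - ⌊i/(pd)⌋)` whatever the
permutation (`principalMinor_mem`). This is large unless `S` lies in a fixed finite range, so the
series of principal minors giving the coefficients of `F` converges; it is smallest for `S = {0, …,
n-1}`, which gives `λ(n)`. In `Λ^{>1/p}` the element `p` is a multiple of `T`, so `(p, T)^k` maps
into `(T^k)`.

For the analytic part, truncating the Mahler expansion of a symbol before applying `U_p` gives
operators of finite rank whose matrices are the images under `κ` of truncations of `P`. They
converge to `U_p` in norm: the contraction makes `g · f` analytic on discs larger than those of `f`,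
and then Amice's factorial bound for its differences beats the growth of the Gauss norms of the
binomials (`tendsto_factorial_mul_mahlerGauss`, `IsUp.eventually_symbNorm_sub_le`). Continuity of
`κ` identifies the limits of the determinants. -/

lemma hasSum_of_forall_eq {ι M : Type*} [AddCommMonoid M] [TopologicalSpace M] {f g : ι → M} {a : M}
    (h : HasSum f a) (e : ∀ i, g i = f i) : HasSum g a := by
  rwa [funext e]

/-! ### The profinite topology of `Λ`: compactness, a basis of open ideals, Mahler series. -/

section IwasawaTopology

variable {p : ℕ} [Fact p.Prime]

/-- The coefficient of `x ∈ Λ` at `g ∈ (ℤ/p^n)ˣ`. -/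
def coef (q : Σ n : ℕ, (ZMod (p ^ n))ˣ) : Iwasawa p →+ ℤ_[p] where
  toFun x := (x.1 q.1).coeff q.2
  map_zero' := rfl
  map_add' _ _ := rfl

lemma continuous_coef (q : Σ n : ℕ, (ZMod (p ^ n))ˣ) : Continuous (coef (p := p) q) :=
  continuous_iwasawa_iff.1 continuous_id q.1 q.2

lemma iwasawa_ext {x y : Iwasawa p} (h : ∀ q, coef q x = coef q y) : x = y :=
  Subtype.ext (funext fun n => MonoidAlgebra.coeff_injective (Finsupp.ext fun g => h ⟨n, g⟩))

lemma isInducing_coef : IsInducing fun (x : Iwasawa p) q => coef q x := ⟨rfl⟩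

instance : T2Space (Iwasawa p) :=
  (IsEmbedding.mk isInducing_coef fun _ _ h => iwasawa_ext fun q => congrFun h q).t2Space

lemma coeff_groupRingRed (n : ℕ) (y : MonoidAlgebra ℤ_[p] (ZMod (p ^ (n + 1)))ˣ)
    (g : (ZMod (p ^ n))ˣ) :
    (groupRingRed p n y).coeff g = ∑ h : (ZMod (p ^ (n + 1)))ˣ,
      if Units.map (ZMod.castHom (pow_dvd_pow p n.le_succ) (ZMod (p ^ n))).toMonoidHom h = g then
        y.coeff h else 0 := by
  classical
  have e : (groupRingRed p n y).coeff = Finsupp.mapDomain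
    (Units.map (ZMod.castHom (pow_dvd_pow p n.le_succ) (ZMod (p ^ n))).toMonoidHom) y.coeff := rfl
  rw [e, Finsupp.mapDomain, Finsupp.sum_apply, Finsupp.sum_fintype _ _ (by simp)]
  exact Finset.sum_congr rfl fun h _ => Finsupp.single_apply

lemma coef_eq_sum (x : Iwasawa p) (n : ℕ) (g : (ZMod (p ^ n))ˣ) :
    coef ⟨n, g⟩ x = ∑ h : (ZMod (p ^ (n + 1)))ˣ,
      if Units.map (ZMod.castHom (pow_dvd_pow p n.le_succ) (ZMod (p ^ n))).toMonoidHom h = g then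
        coef ⟨n + 1, h⟩ x else 0 := by
  change (x.1 n).coeff g = _
  rw [← x.2 n, coeff_groupRingRed]
  rfl

/-- The compatibility conditions are closed linear conditions in a product of copies of the compact
space `ℤ_p`, so the coordinate embedding is closed. -/
instance : CompactSpace (Iwasawa p) := by
  have hr : Set.range (fun (x : Iwasawa p) q => coef q x) =
      {f : (Σ n : ℕ, (ZMod (p ^ n))ˣ) → ℤ_[p] | ∀ n g, f ⟨n, g⟩ = ∑ h : (ZMod (p ^ (n + 1)))ˣ,
        if Units.map (ZMod.castHom (pow_dvd_pow p n.le_succ) (ZMod (p ^ n))).toMonoidHom h = g then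
          f ⟨n + 1, h⟩ else 0} := by
    ext f
    constructor
    · rintro ⟨x, rfl⟩ n g
      exact coef_eq_sum x n g
    · intro hf
      refine ⟨⟨fun n => .ofCoeff (Finsupp.equivFunOnFinite.symm fun g => f ⟨n, g⟩),
        fun n => ?_⟩, ?_⟩
      · apply MonoidAlgebra.coeff_injective
        ext g
        rw [coeff_groupRingRed]
        exact (hf n g).symm
      · rfl
  have hc : IsClosed (Set.range (fun (x : Iwasawa p) q => coef q x)) := by
    rw [hr]
    simp only [Set.ofPred_forall]
    refine isClosed_iInter fun n => isClosed_iInter fun g => isClosed_eq (continuous_apply _) ?_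
    refine continuous_finsetSum _ fun h _ => ?_
    split_ifs
    · exact continuous_apply _
    · exact continuous_const
  exact (IsClosedEmbedding.mk (IsEmbedding.mk isInducing_coef
    fun _ _ h => iwasawa_ext fun q => congrFun h q) hc).compactSpace

instance : IsTopologicalRing (Iwasawa p) where
  continuous_neg := by
    rw [continuous_iwasawa_iff]
    intro n g
    exact (continuous_coef ⟨n, g⟩).neg

lemma coef_algebraMap (q : Σ n : ℕ, (ZMod (p ^ n))ˣ) (z : ℤ_[p]) [Decidable (q.2 = 1)] :
    coef q (algebraMap ℤ_[p] (Iwasawa p) z) = if q.2 = 1 then z else 0 := by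
  classical
  change (algebraMap ℤ_[p] (MonoidAlgebra ℤ_[p] (ZMod (p ^ q.1))ˣ) z).coeff q.2 = _
  simp [MonoidAlgebra.coeff_single, Finsupp.single_apply, eq_comm]

lemma coef_smul (q : Σ n : ℕ, (ZMod (p ^ n))ˣ) (z : ℤ_[p]) (x : Iwasawa p) :
    coef q (algebraMap ℤ_[p] (Iwasawa p) z * x) = z * coef q x := by
  rw [← Algebra.smul_def]
  rfl

lemma continuous_algebraMap_iwasawa : Continuous (algebraMap ℤ_[p] (Iwasawa p)) := by
  classical
  rw [continuous_iwasawa_iff]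
  intro n g
  have h : ∀ z, ((algebraMap ℤ_[p] (Iwasawa p) z).1 n).coeff g = if g = 1 then z else 0 :=
    fun z => coef_algebraMap ⟨n, g⟩ z
  simp_rw [h]
  split_ifs
  · exact continuous_id
  · exact continuous_const

lemma coef_mul (n : ℕ) (g : (ZMod (p ^ n))ˣ) (x y : Iwasawa p) :
    coef ⟨n, g⟩ (x * y) = ∑ a : (ZMod (p ^ n))ˣ, coef ⟨n, g * a⁻¹⟩ x * coef ⟨n, a⟩ y := by
  classical
  have : (x * y).1 n = x.1 n * y.1 n := rfl
  change ((x * y).1 n).coeff g = _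
  rw [this, MonoidAlgebra.coeff_mul, Finsupp.sum_fintype _ _ (by simp)]
  have : ∀ a : (ZMod (p ^ n))ˣ, ((y.1 n).coeff.sum fun b s =>
      if a * b = g then (x.1 n).coeff a * s else 0) =
      ∑ b : (ZMod (p ^ n))ˣ, if a = g * b⁻¹ then coef ⟨n, a⟩ x * coef ⟨n, b⟩ y else 0 := by
    intro a
    rw [Finsupp.sum_fintype _ _ (by simp)]
    refine Finset.sum_congr rfl fun b _ => ?_
    simp only [eq_mul_inv_iff_mul_eq]
    rfl
  rw [Finset.sum_congr rfl fun a _ => this a, Finset.sum_comm]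
  simp

variable (p) in
/-- The ideal of the `x ∈ Λ` whose image in `ℤ_p[(ℤ/p^n)ˣ]` is divisible by `p^k`. -/
def coefIdeal (n k : ℕ) : Ideal (Iwasawa p) where
  carrier := {x | ∀ g : (ZMod (p ^ n))ˣ, (p : ℤ_[p]) ^ k ∣ coef ⟨n, g⟩ x}
  zero_mem' g := by simp
  add_mem' hx hy g := by simpa using dvd_add (hx g) (hy g)
  smul_mem' r x hx g := by
    rw [smul_eq_mul, coef_mul]
    exact Finset.dvd_sum fun a _ => (hx a).mul_left _

lemma mem_coefIdeal {n k : ℕ} {x : Iwasawa p} :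
    x ∈ coefIdeal p n k ↔ ∀ g : (ZMod (p ^ n))ˣ, (p : ℤ_[p]) ^ k ∣ coef ⟨n, g⟩ x := Iff.rfl

lemma isOpen_dvd_pow (k : ℕ) : IsOpen {z : ℤ_[p] | (p : ℤ_[p]) ^ k ∣ z} := by
  have : {z : ℤ_[p] | (p : ℤ_[p]) ^ k ∣ z} = (PadicInt.toZModPow k) ⁻¹' {0} := by
    ext z
    rw [Set.mem_preimage, Set.mem_singleton_iff, ← RingHom.mem_ker, PadicInt.ker_toZModPow,
      Ideal.mem_span_singleton]
    rfl
  rw [this]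
  exact (isOpen_discrete _).preimage (continuous_toZModPow k)

lemma isOpen_coefIdeal (n k : ℕ) : IsOpen (coefIdeal p n k : Set (Iwasawa p)) := by
  have : (coefIdeal p n k : Set (Iwasawa p)) =
      ⋂ g : (ZMod (p ^ n))ˣ, coef ⟨n, g⟩ ⁻¹' {z : ℤ_[p] | (p : ℤ_[p]) ^ k ∣ z} := by
    ext x
    simp [mem_coefIdeal]
  rw [this]
  exact isOpen_iInter_of_finite fun g => (isOpen_dvd_pow k).preimage (continuous_coef _)

/-- A coefficient at level `n` is a sum of coefficients at level `n + 1`, so divisibility descends.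
-/
lemma coefIdeal_anti {n n' k k' : ℕ} (hn : n ≤ n') (hk : k ≤ k') :
    coefIdeal p n' k' ≤ coefIdeal p n k := by
  have h1 : ∀ n k, coefIdeal p (n + 1) k ≤ coefIdeal p n k := by
    intro n k x hx g
    rw [coef_eq_sum]
    refine Finset.dvd_sum fun a _ => ?_
    split_ifs
    · exact hx a
    · exact dvd_zero _
  have h2 : coefIdeal p n' k' ≤ coefIdeal p n k' := by
    induction n', hn using Nat.le_induction with
    | base => exact le_rfl
    | succ m _ ih => exact (h1 m k').trans ih
  exact fun x hx g => (pow_dvd_pow _ hk).trans (h2 hx g)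

/-- A neighbourhood of zero constrains finitely many coordinates to finite precision; the ideals
decrease in both indices, so one diagonal ideal beyond all these levels and precisions suffices. -/
lemma exists_coefIdeal_subset {U : Set (Iwasawa p)} (hU : U ∈ 𝓝 (0 : Iwasawa p)) :
    ∃ m, (coefIdeal p m m : Set (Iwasawa p)) ⊆ U := by
  rw [isInducing_coef.nhds_eq_comap, mem_comap] at hU
  obtain ⟨V, hV, hVU⟩ := hU
  rw [nhds_pi, Filter.mem_pi] at hV
  obtain ⟨I, hI, W, hW, hWV⟩ := hV
  have hWk : ∀ q, ∃ k : ℕ, ∀ z : ℤ_[p], (p : ℤ_[p]) ^ k ∣ z → z ∈ W q := by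
    intro q
    have h := hW q
    rw [map_zero] at h
    obtain ⟨ε, hε, hb⟩ := Metric.mem_nhds_iff.1 h
    obtain ⟨k, hk⟩ := PadicInt.exists_pow_neg_lt p hε
    refine ⟨k, fun z hz => hb ?_⟩
    rw [Metric.mem_ball, dist_zero_right]
    refine lt_of_le_of_lt ?_ hk
    rwa [PadicInt.norm_le_pow_iff_mem_span_pow, Ideal.mem_span_singleton]
  choose k hk using hWk
  refine ⟨hI.toFinset.sup (fun q => max q.1 (k q)), fun x hx => hVU (hWV fun q hq => ?_)⟩
  have hle : max q.1 (k q) ≤ hI.toFinset.sup (fun q => max q.1 (k q)) :=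
    Finset.le_sup (f := fun q => max q.1 (k q)) (by simpa using hq)
  exact hk q _ (coefIdeal_anti ((le_max_left _ _).trans hle) ((le_max_right _ _).trans hle) hx q.2)

instance : NonarchimedeanRing (Iwasawa p) where
  is_nonarchimedean U hU := by
    obtain ⟨m, hm⟩ := exists_coefIdeal_subset hU
    exact ⟨⟨(coefIdeal p m m).toAddSubgroup, isOpen_coefIdeal m m⟩, hm⟩

instance : NonarchimedeanAddGroup (Iwasawa p) := inferInstance

lemma tendsto_iwasawa_zero {ι : Type*} {l : Filter ι} {f : ι → Iwasawa p} :
    Tendsto f l (𝓝 0) ↔ ∀ m, ∀ᶠ i in l, f i ∈ coefIdeal p m m := by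
  constructor
  · intro h m
    exact h ((isOpen_coefIdeal m m).mem_nhds (zero_mem _))
  · intro h U hU
    obtain ⟨m, hm⟩ := exists_coefIdeal_subset hU
    exact (h m).mono fun i hi => hm hi

/-- In `Λ`, a family which tends to zero is summable. -/
lemma summable_iwasawa {ι : Type*} {f : ι → Iwasawa p}
    (h : ∀ m, ∀ᶠ i in cofinite, f i ∈ coefIdeal p m m) : Summable f := by
  -- The uniform structure serves only to apply the nonarchimedean summability criterion;
  -- completeness comes from compactness.
  let _ : UniformSpace (Iwasawa p) := IsTopologicalAddGroup.rightUniformSpace (Iwasawa p)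
  have : IsUniformAddGroup (Iwasawa p) := isUniformAddGroup_of_addCommGroup
  exact NonarchimedeanAddGroup.summable_of_tendsto_cofinite_zero (tendsto_iwasawa_zero.2 h)

lemma hasSum_iwasawa_iff {ι : Type*} {f : ι → Iwasawa p} {a : Iwasawa p} :
    HasSum f a ↔ ∀ q, HasSum (fun i => coef q (f i)) (coef q a) := by
  unfold HasSum
  rw [isInducing_coef.tendsto_nhds_iff, tendsto_pi_nhds]
  simp only [Function.comp_def, map_sum]

lemma coef_fwdDiff (q : Σ n : ℕ, (ZMod (p ^ n))ˣ) (f : ℤ_[p] → Iwasawa p) (n : ℕ) (z : ℤ_[p]) :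
    coef q ((fwdDiff (1 : ℤ_[p]))^[n] f z) = (fwdDiff (1 : ℤ_[p]))^[n] (fun z => coef q (f z)) z := by
  simp only [fwdDiff_iter_eq_sum_shift, map_sum, map_zsmul]

/-- Mahler coefficients of continuous `Λ`-valued functions tend to zero. -/
lemma fwdDiff_mem_coefIdeal {f : ℤ_[p] → Iwasawa p} (hf : Continuous f) (m : ℕ) :
    ∀ᶠ n in atTop, (fwdDiff (1 : ℤ_[p]))^[n] f 0 ∈ coefIdeal p m m := by
  simp only [mem_coefIdeal, eventually_all, coef_fwdDiff]
  intro g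
  have h := PadicInt.fwdDiff_tendsto_zero
    (⟨fun z => coef ⟨m, g⟩ (f z), (continuous_coef _).comp hf⟩ : C(ℤ_[p], ℤ_[p]))
  exact h ((isOpen_dvd_pow m).mem_nhds (dvd_zero _))

/-- Mahler's theorem for continuous `Λ`-valued functions. -/
lemma hasSum_mahler_iwasawa {f : ℤ_[p] → Iwasawa p} (hf : Continuous f) (z : ℤ_[p]) :
    HasSum (fun n => algebraMap ℤ_[p] (Iwasawa p) (mahler n z) * (fwdDiff (1 : ℤ_[p]))^[n] f 0) (f z) := by
  rw [hasSum_iwasawa_iff]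
  intro q
  have h := PadicInt.hasSum_mahler
    (⟨fun z => coef q (f z), (continuous_coef _).comp hf⟩ : C(ℤ_[p], ℤ_[p]))
  have h2 := ContinuousMap.hasSum_apply h z
  refine hasSum_of_forall_eq h2 fun n => ?_
  rw [coef_smul, coef_fwdDiff, PadicInt.mahlerTerm_apply, smul_eq_mul]
  rfl

end IwasawaTopology

/-! ### The ideal `(p, T)` and the size of `[v] - 1`. -/

section MaximalIdeal

variable {p : ℕ} [Fact p.Prime]

lemma padic_dvd_pow_iff {z : ℤ_[p]} {n : ℕ} : (p : ℤ_[p]) ^ n ∣ z ↔ ‖z‖ ≤ (p : ℝ) ^ (-n : ℤ) := by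
  rw [PadicInt.norm_le_pow_iff_mem_span_pow, Ideal.mem_span_singleton]

lemma padic_toZModPow_eq_iff {x y : ℤ_[p]} {n : ℕ} :
    PadicInt.toZModPow n x = PadicInt.toZModPow n y ↔ (p : ℤ_[p]) ^ n ∣ x - y := by
  rw [← sub_eq_zero, ← map_sub, ← RingHom.mem_ker, PadicInt.ker_toZModPow,
    Ideal.mem_span_singleton]

lemma norm_exp_prime_sub (hp2 : p ≠ 2) :
    ‖NormedSpace.exp (p : ℚ_[p]) - 1 - p‖ ≤ (p : ℝ) ^ (-2 : ℤ) := by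
  have hp := (Fact.out : p.Prime)
  have h1 : (1 : ℝ) < p := mod_cast hp.one_lt
  set f : ℕ → ℚ_[p] := fun n => (n.factorial : ℚ_[p])⁻¹ * (p : ℚ_[p]) ^ n with hf
  have hs : Summable f := by
    apply NonarchimedeanAddGroup.summable_of_tendsto_cofinite_zero
    rw [Nat.cofinite_eq_atTop]
    apply squeeze_zero_norm' (a := fun n : ℕ => ((p : ℝ)⁻¹) ^ ((n + 1) / 2))
    · filter_upwards [eventually_ne_atTop 0] with n hn
      refine (norm_pow_div_factorial_le n hp2 hn).trans_eq ?_
      rw [zpow_neg, zpow_natCast, inv_pow]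
    · refine (tendsto_pow_atTop_nhds_zero_of_lt_one (by positivity) (inv_lt_one_of_one_lt₀ h1)).comp
        (tendsto_atTop_atTop.2 fun b => ⟨2 * b, fun n hn => by omega⟩)
  have he : NormedSpace.exp (p : ℚ_[p]) - 1 - p = ∑' n, f (n + 2) := by
    rw [NormedSpace.exp_eq_tsum ℚ_[p]]
    simp only [smul_eq_mul]
    rw [← hs.sum_add_tsum_nat_add 2]
    simp [hf, Finset.sum_range_succ]
    ring
  rw [he]
  refine IsUltrametricDist.norm_tsum_le_of_forall_le_of_nonneg (by positivity) fun n => ?_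
  -- For the term `p²/2` the general bound gives only `p⁻¹`, so it is treated by hand, using that
  -- `2` is a unit.
  rcases Nat.eq_zero_or_pos n with rfl | hn
  · have h2 : ‖(2 : ℚ_[p])‖ = 1 := by
      have : ¬ (p : ℕ) ∣ 2 := fun h => hp2 ((Nat.prime_dvd_prime_iff_eq hp Nat.prime_two).1 h)
      rw [show (2 : ℚ_[p]) = ((2 : ℕ) : ℚ_[p]) by norm_cast, Padic.norm_natCast_eq_one_iff]
      exact (Nat.Prime.coprime_iff_not_dvd hp).2 this
    simp [hf, h2]
  · refine (norm_pow_div_factorial_le (n + 2) hp2 (by omega)).trans ?_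
    apply zpow_le_zpow_right₀ h1.le
    omega

lemma exists_expUnit_eq (hp2 : p ≠ 2) :
    ∃ z : ℤ_[p], (expUnit p : ℤ_[p]) - 1 - p = (p : ℤ_[p]) ^ 2 * z := by
  have h := norm_exp_prime_sub hp2
  rw [← coe_expUnit hp2] at h
  have h2 : ‖((expUnit p : ℤ_[p]) - 1 - p : ℤ_[p])‖ ≤ (p : ℝ) ^ (-(2 : ℕ) : ℤ) := by
    rw [PadicInt.norm_def]
    push_cast
    exact h
  exact padic_dvd_pow_iff.2 h2

/-- `exp(p)^(p^n) = 1 + p^(n+1) y` with `y` a unit. -/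
lemma exists_expUnit_pow_eq (hp2 : p ≠ 2) (n : ℕ) :
    ∃ y : ℤ_[p]ˣ, (expUnit p : ℤ_[p]) ^ p ^ n = 1 + (p : ℤ_[p]) ^ (n + 1) * y := by
  have hp := (Fact.out : p.Prime)
  obtain ⟨z, hz⟩ := exists_expUnit_eq (p := p) hp2
  have hpr : Prime (p : ℤ_[p]) := PadicInt.prime_p
  have h1 : (expUnit p : ℤ_[p]) - 1 = p * (1 + p * z) := by linear_combination hz
  have hnd : ¬ (p : ℤ_[p]) ∣ 1 + p * z := fun h => hpr.not_isUnit (isUnit_of_dvd_one (by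
    simpa using dvd_sub h (dvd_mul_right (p : ℤ_[p]) z)))
  -- Lifting the exponent: for odd `p`, the valuation of `u^(p^n) - 1` is `n` plus that of `u - 1`,
  -- which is `1` here.
  have h := emultiplicity_pow_prime_pow_sub_pow_prime_pow (R := ℤ_[p]) hpr
    (hp.odd_of_ne_two hp2) (x := (expUnit p : ℤ_[p])) (y := 1) ⟨_, h1⟩
    (fun h => hpr.not_isUnit (isUnit_of_dvd_unit h (expUnit p).isUnit)) n
  have h0 : emultiplicity (p : ℤ_[p]) ((expUnit p : ℤ_[p]) - 1) = 1 := by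
    have : emultiplicity (p : ℤ_[p]) ((expUnit p : ℤ_[p]) - 1) = (1 : ℕ) := by
      rw [emultiplicity_eq_coe, h1, pow_one]
      refine ⟨dvd_mul_right _ _, fun h => hnd ?_⟩
      rw [pow_two] at h
      exact (mul_dvd_mul_iff_left hpr.ne_zero).1 h
    simpa using this
  rw [h0, one_pow] at h
  have h' : emultiplicity (p : ℤ_[p]) ((expUnit p : ℤ_[p]) ^ p ^ n - 1) = (n + 1 : ℕ) := by
    rw [h]; push_cast; ring
  rw [emultiplicity_eq_coe] at h'
  obtain ⟨⟨y, hy⟩, h2⟩ := h'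
  have hyu : IsUnit y := by
    by_contra hn
    obtain ⟨w, hw⟩ := (PadicInt.norm_lt_one_iff_dvd y).1 (PadicInt.mem_nonunits.1 hn)
    exact h2 ⟨w, by rw [hy, hw]; ring⟩
  exact ⟨hyu.unit, by rw [IsUnit.unit_spec]; linear_combination hy⟩

/-- The powers of `exp(p)^(p^k)` are dense in `1 + p^(k+1) ℤ_p`. -/
lemma exists_expUnit_pow_sub_dvd (hp2 : p ≠ 2) {k : ℕ} {v : ℤ_[p]}
    (hv : (p : ℤ_[p]) ^ (k + 1) ∣ v - 1) (n : ℕ) :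
    ∃ j : ℕ, (p : ℤ_[p]) ^ n ∣ v - (expUnit p : ℤ_[p]) ^ (p ^ k * j) := by
  suffices h : ∀ m, ∃ j : ℕ, (p : ℤ_[p]) ^ (k + 1 + m) ∣ v - (expUnit p : ℤ_[p]) ^ (p ^ k * j) by
    obtain ⟨j, hj⟩ := h n
    exact ⟨j, (pow_dvd_pow _ (by omega)).trans hj⟩
  intro m
  induction m with
  | zero => exact ⟨0, by simpa using hv⟩
  | succ m ih =>
    obtain ⟨j, x, hx⟩ := ih
    obtain ⟨y, hy⟩ := exists_expUnit_pow_eq (p := p) hp2 (k + m)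
    set w : ℤ_[p]ˣ := (expUnit p) ^ (p ^ k * j) with hw
    -- The next digit: to first order `(1 + p^(k+m+1) y)^i` is `1 + i p^(k+m+1) y`, so the error
    -- `p^(k+m+1) x` is removed modulo one more power of `p` when `w y i ≡ x` modulo `p`.
    obtain ⟨i, -, hi⟩ := PadicInt.exists_mem_range (x * (((w * y)⁻¹ : ℤ_[p]ˣ) : ℤ_[p]))
    rw [PadicInt.maximalIdeal_eq_span_p, Ideal.mem_span_singleton] at hi
    obtain ⟨c, hc⟩ := hi
    refine ⟨j + p ^ m * i, ?_⟩
    have e : (expUnit p : ℤ_[p]) ^ (p ^ k * (j + p ^ m * i)) =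
        w * (1 + (p : ℤ_[p]) ^ (k + m + 1) * y) ^ i := by
      rw [← hy, mul_add, pow_add, ← pow_mul, hw]
      push_cast
      congr 2
      rw [pow_add]; ring
    obtain ⟨r, hr⟩ := Polynomial.powAddExpansion (1 : ℤ_[p]) ((p : ℤ_[p]) ^ (k + m + 1) * y) i
    have hx' : v - w = (p : ℤ_[p]) ^ (k + 1 + m) * x := by rw [← hx, hw]; push_cast; rfl
    have hwy : (((w * y)⁻¹ : ℤ_[p]ˣ) : ℤ_[p]) * (w * y) = 1 := by
      rw [← Units.val_mul, ← Units.val_mul, inv_mul_cancel, Units.val_one]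
    rw [e, hr]
    have hxx : x = (w : ℤ_[p]) * y * i + p * c * ((w : ℤ_[p]) * y) := by
      linear_combination ((w : ℤ_[p]) * y) * hc - x * hwy
    refine ⟨c * ((w : ℤ_[p]) * y) - w * (r * (p : ℤ_[p]) ^ (k + m) * y ^ 2), ?_⟩
    simp only [one_pow, mul_one]
    have : (p : ℤ_[p]) ^ (k + 1 + m) * x = 
        (p : ℤ_[p]) ^ (k + 1 + m) * ((w : ℤ_[p]) * y * i + p * c * ((w : ℤ_[p]) * y)) := by
      rw [← hxx]
    linear_combination hx' + this

variable (p) in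
/-- The ideal `(p, T)` of `Λ`. -/
def maxId : Ideal (Iwasawa p) := Ideal.span {(p : Iwasawa p), paramT p}

lemma p_mem_maxId : (p : Iwasawa p) ∈ maxId p := Ideal.subset_span (by simp)

lemma paramT_mem_maxId : paramT p ∈ maxId p := Ideal.subset_span (by simp)

lemma maxId_fg : (maxId p).FG := by
  classical
  exact ⟨{(p : Iwasawa p), paramT p}, by simp [maxId]⟩

/-- Finitely generated ideals of a compact ring are compact. Closedness is what lets membership in
`(p, T)^k` pass to limits, both for `[v] - 1` and for the coefficients of `F`. -/
lemma isClosed_maxId_pow (k : ℕ) : IsClosed ((maxId p ^ k : Ideal (Iwasawa p)) : Set (Iwasawa p)) :=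
  (Ideal.isCompact_of_fg (Ideal.FG.pow maxId_fg)).isClosed

lemma univChar_sub_mem_coefIdeal {v w : ℤ_[p]ˣ} {n : ℕ}
    (h : (p : ℤ_[p]) ^ n ∣ (v : ℤ_[p]) - w) (k : ℕ) : univChar v - univChar w ∈ coefIdeal p n k := by
  intro g
  have : (univChar v).1 n = (univChar w).1 n := by
    rw [univChar_apply, univChar_apply]
    congr 1
    ext
    exact padic_toZModPow_eq_iff.2 h
  have h2 : coef ⟨n, g⟩ (univChar v) = coef ⟨n, g⟩ (univChar w) := by
    change ((univChar v).1 n).coeff g = ((univChar w).1 n).coeff g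
    rw [this]
  rw [map_sub, h2, sub_self]
  exact dvd_zero _

lemma p_mem_coefIdeal (n : ℕ) : (p : Iwasawa p) ∈ coefIdeal p n 1 := by
  intro g
  have := coef_smul ⟨n, g⟩ (p : ℤ_[p]) 1
  rw [mul_one, map_natCast] at this
  rw [this, pow_one]
  exact dvd_mul_right _ _

lemma mul_mem_coefIdeal {n a b : ℕ} {x y : Iwasawa p} (hx : x ∈ coefIdeal p n a)
    (hy : y ∈ coefIdeal p n b) : x * y ∈ coefIdeal p n (a + b) := by
  intro g
  rw [coef_mul, pow_add]
  exact Finset.dvd_sum fun c _ => mul_dvd_mul (hx _) (hy _)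

lemma pow_mem_coefIdeal {n : ℕ} {x : Iwasawa p} (hx : x ∈ coefIdeal p n 1) (k : ℕ) :
    x ^ k ∈ coefIdeal p n k := by
  induction k with
  | zero => intro g; simp
  | succ k ih => rw [pow_succ]; exact mul_mem_coefIdeal ih hx

/-- Both generators are nilpotent modulo `coefIdeal p m m`: for `T`, the power `T^(p^m)` differs
from `[exp(p)^(p^m)] - 1` by a multiple of `p`, and the latter dies at level `m` because
`exp(p)^(p^m) ≡ 1` modulo `p^m`. Hence `(p, T)`-adic estimates imply convergence in the profinite
topology. -/
lemma exists_maxId_pow_le (hp2 : p ≠ 2) (m : ℕ) : ∃ j, maxId p ^ j ≤ coefIdeal p m m := by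
  refine Ideal.exists_pow_le_of_le_radical_of_fg ?_ maxId_fg
  rw [maxId, Ideal.span_le]
  rintro x (rfl | rfl)
  · exact ⟨m, pow_mem_coefIdeal (p_mem_coefIdeal m) m⟩
  · refine ⟨p ^ m * m, ?_⟩
    rw [pow_mul]
    refine pow_mem_coefIdeal ?_ m
    obtain ⟨r, hr⟩ := exists_add_pow_prime_pow_eq (Fact.out : p.Prime) (paramT p) 1 m
    have e : paramT p ^ p ^ m = (univChar (expUnit p ^ p ^ m) - univChar 1) -
        (p : Iwasawa p) * (paramT p * r) := by
      rw [map_pow, map_one, show univChar (expUnit p) = paramT p + 1 by rw [paramT]; ring, hr]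
      ring
    rw [e]
    refine sub_mem (univChar_sub_mem_coefIdeal ?_ 1) (Ideal.mul_mem_right _ _ (p_mem_coefIdeal m))
    obtain ⟨y, hy⟩ := exists_expUnit_pow_eq (p := p) hp2 m
    refine ⟨p * y, ?_⟩
    push_cast
    rw [hy]
    ring

/-- `[v] - 1 ∈ (p, T)^k` if `v ≡ 1` modulo `p^k`. -/
lemma univChar_sub_one_mem (hp2 : p ≠ 2) {k : ℕ} {v : ℤ_[p]ˣ}
    (hv : (p : ℤ_[p]) ^ k ∣ (v : ℤ_[p]) - 1) : univChar v - 1 ∈ maxId p ^ k := by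
  have hp := (Fact.out : p.Prime)
  rcases k with _ | k
  · simp
  have hpow : ∀ k, univChar (expUnit p) ^ p ^ k - 1 ∈ maxId p ^ (k + 1) := by
    intro k
    induction k with
    | zero => simpa [paramT] using paramT_mem_maxId (p := p)
    | succ k ih =>
      set t := univChar (expUnit p) ^ p ^ k - 1 with ht
      obtain ⟨r, hr⟩ := exists_add_pow_prime_eq hp t 1
      -- In `(1+t)^p - 1 = t^p + p t r` both terms gain at least one power of `(p, T)` over `t`, the
      -- first because `t²` divides it.
      have e : univChar (expUnit p) ^ p ^ (k + 1) - 1 = t ^ (p - 2) * (t * t) + p * t * r := by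
        rw [pow_succ p, pow_mul, show univChar (expUnit p) ^ p ^ k = t + 1 by rw [ht]; ring, hr,
          ← pow_two, ← pow_add, Nat.sub_add_cancel hp.two_le]
        ring
      rw [e]
      refine add_mem (Ideal.mul_mem_left _ _ ?_) (Ideal.mul_mem_right _ _ ?_)
      · exact Ideal.pow_le_pow_right (by omega) (by
          rw [pow_add]; exact Ideal.mul_mem_mul ih ih : t * t ∈ maxId p ^ (k + 1 + (k + 1)))
      · rw [pow_succ']
        exact Ideal.mul_mem_mul p_mem_maxId ih
  -- `v` is a limit of powers of `exp(p)^(p^k)`; the claim holds for those, and the ideal is closed.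
  choose j hj using fun n => exists_expUnit_pow_sub_dvd hp2 hv n
  have hmem : ∀ n, univChar (expUnit p ^ (p ^ k * j n)) - 1 ∈ maxId p ^ (k + 1) := by
    intro n
    rw [map_pow, pow_mul]
    exact Ideal.mem_of_dvd _ (sub_one_dvd_pow_sub_one _ _) (hpow k)
  have hlim : Tendsto (fun n => univChar (expUnit p ^ (p ^ k * j n)) - 1) atTop
      (𝓝 (univChar v - 1)) := by
    rw [← tendsto_sub_nhds_zero_iff, tendsto_iwasawa_zero]
    intro m
    filter_upwards [eventually_ge_atTop m] with n hn
    rw [sub_sub_sub_cancel_right, ← neg_mem_iff, neg_sub]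
    exact coefIdeal_anti hn le_rfl (univChar_sub_mem_coefIdeal (by simpa using hj n) m)
  exact (isClosed_maxId_pow (k + 1)).mem_of_tendsto hlim (Eventually.of_forall hmem)

end MaximalIdeal

/-! ### Finite differences of exponentials, and the integral estimate on matrix coefficients. -/

section DifferenceFiltration

variable {p : ℕ} [Fact p.Prime]

section General

variable {R : Type*} [CommRing R]

/-- The finite differences `Δ^n f`, `n ≤ N`, have values in the ideals `I (n + k)`. -/
def FilDiff (I : ℕ → Ideal R) (N k : ℕ) (f : ℤ_[p] → R) : Prop :=
  ∀ n ≤ N, ∀ y, (fwdDiff (1 : ℤ_[p]))^[n] f y ∈ I (n + k)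

/-- A decreasing multiplicative filtration of a ring by ideals. -/
structure IsFiltration (I : ℕ → Ideal R) : Prop where
  zero : I 0 = ⊤
  anti : Antitone I
  mul : ∀ {a b x y}, x ∈ I a → y ∈ I b → x * y ∈ I (a + b)

variable {I : ℕ → Ideal R} {N k j : ℕ} {f g : ℤ_[p] → R}

lemma FilDiff.diff (h : FilDiff I (N + 1) k f) : FilDiff I N (k + 1) (fwdDiff (1 : ℤ_[p]) f) := by
  intro n hn y
  rw [← Function.iterate_succ_apply, show n + (k + 1) = n + 1 + k by ring]
  exact h (n + 1) (by omega) y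

lemma FilDiff.succ (h0 : ∀ y, f y ∈ I k) (h : FilDiff I N (k + 1) (fwdDiff (1 : ℤ_[p]) f)) :
    FilDiff I (N + 1) k f := by
  intro n hn y
  rcases n with _ | n
  · simpa using h0 y
  · rw [Function.iterate_succ_apply, show n + 1 + k = n + (k + 1) by ring]
    exact h n (by omega) y

lemma FilDiff.shift (h : FilDiff I N k f) : FilDiff I N k (fun y => f (y + 1)) := by
  intro n hn y
  rw [fwdDiff_iter_comp_add]
  exact h n hn _

lemma FilDiff.of_le (h : FilDiff I N k f) {N' : ℕ} (hN : N' ≤ N) : FilDiff I N' k f :=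
  fun n hn y => h n (hn.trans hN) y

lemma FilDiff.mono (hI : IsFiltration I) (h : FilDiff I N k f) (hk : j ≤ k) : FilDiff I N j f :=
  fun n hn y => hI.anti (by omega) (h n hn y)

lemma FilDiff.add (hf : FilDiff I N k f) (hg : FilDiff I N k g) :
    FilDiff I N k (fun y => f y + g y) := by
  intro n hn y
  have : (fun y => f y + g y) = f + g := rfl
  rw [this, fwdDiff_iter_add]
  exact add_mem (hf n hn y) (hg n hn y)

lemma filDiff_zero : FilDiff I N k (fun _ : ℤ_[p] => 0) := by
  intro n _ y
  have : (fwdDiff (1 : ℤ_[p]))^[n] (fun _ => (0 : R)) y = 0 := by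
    simp [fwdDiff_iter_eq_sum_shift]
  rw [this]
  exact zero_mem _

lemma filDiff_const {c : R} (hc : c ∈ I k) : FilDiff I N k (fun _ : ℤ_[p] => c) := by
  rcases N with _ | N
  · intro n hn y
    obtain rfl : n = 0 := by omega
    simpa using hc
  · refine FilDiff.succ (fun _ => hc) ?_
    rw [fwdDiff_const]
    exact filDiff_zero

/-- By the Leibniz rule `Δ(fg) = Δf · g(· + 1) + f · Δg` each summand has one more unit of weight,
and the number of differences still to be controlled drops by one. -/
lemma FilDiff.mul (hI : IsFiltration I) (hf : FilDiff I N j f) (hg : FilDiff I N k g) :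
    FilDiff I N (j + k) (fun y => f y * g y) := by
  induction N generalizing j k f g with
  | zero =>
    intro n hn y
    obtain rfl : n = 0 := by omega
    simpa using hI.mul (hf 0 le_rfl y) (hg 0 le_rfl y)
  | succ N ih =>
    refine FilDiff.succ (fun y => hI.mul (by simpa using hf 0 (by omega) y)
      (by simpa using hg 0 (by omega) y)) ?_
    have e : fwdDiff (1 : ℤ_[p]) (fun y => f y * g y) = fun y =>
        fwdDiff (1 : ℤ_[p]) f y * g (y + 1) + f y * fwdDiff (1 : ℤ_[p]) g y := by
      ext y
      simp only [fwdDiff]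
      ring
    rw [e]
    refine FilDiff.add ?_ ?_
    · have h := ih hf.diff (hg.of_le N.le_succ).shift
      rwa [show j + 1 + k = j + k + 1 by ring] at h
    · have h := ih (hf.of_le N.le_succ) hg.diff
      rwa [← add_assoc] at h

lemma filDiff_affine (hI : IsFiltration I) {a c : R} (hc : c ∈ I 1) (φ : ℤ_[p] →+* R) :
    FilDiff I N 0 (fun z => a + c * φ z) := by
  rcases N with _ | N
  · intro n hn y
    obtain rfl : n = 0 := by omega
    rw [hI.zero]
    trivial
  · refine FilDiff.succ (fun y => by rw [hI.zero]; trivial) ?_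
    have e : fwdDiff (1 : ℤ_[p]) (fun z => a + c * φ z) = fun _ => c := by
      ext y
      simp only [fwdDiff, map_add, map_one]
      ring
    rw [e]
    exact filDiff_const hc

/-- From `v w = 1` follows `Δw = -Δv · w · w(· + 1)`, which needs only `N` differences of `w` to
bound the `(N+1)`-st. -/
lemma FilDiff.inv (hI : IsFiltration I) {v w : ℤ_[p] → R} (hvw : ∀ y, v y * w y = 1)
    (hv : FilDiff I N 0 v) : FilDiff I N 0 w := by
  induction N with
  | zero =>
    intro n hn y
    obtain rfl : n = 0 := by omega
    rw [hI.zero]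
    trivial
  | succ N ih =>
    have hw := ih (hv.of_le N.le_succ)
    refine FilDiff.succ (fun y => by rw [hI.zero]; trivial) ?_
    have e : fwdDiff (1 : ℤ_[p]) w = fun y =>
        fwdDiff (1 : ℤ_[p]) v y * ((fun _ => -1) y * (w y * w (y + 1))) := by
      ext y
      simp only [fwdDiff]
      linear_combination (-w (y + 1)) * hvw y + w y * hvw (y + 1)
    rw [e]
    have hm1 : FilDiff I N 0 (fun _ : ℤ_[p] => (-1 : R)) := filDiff_const (by rw [hI.zero]; trivial)
    have h := hv.diff.mul hI (hm1.mul hI (hw.mul hI hw.shift))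
    simpa using h

/-- If `E` is an exponential map which carries a filtration `G k` into the subsets `1 + I k`, and
the finite differences of `v` satisfy `Δ^n v ∈ G (n + k)`, then `Δ^n (E ∘ v - 1) ∈ I (n + k)`. -/
lemma filDiff_exp (hI : IsFiltration I) {A : Type*} [AddCommGroup A] {E : A → R}
    (hadd : ∀ a b, E (a + b) = E a * E b) {G : ℕ → Set A}
    (hE : ∀ k, ∀ a ∈ G k, E a - 1 ∈ I k) {v : ℤ_[p] → A}
    (hv : ∀ n y, (fwdDiff (1 : ℤ_[p]))^[n] v y ∈ G (n + k)) :
    FilDiff I N k (fun y => E (v y) - 1) := by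
  have h0 : ∀ y, E (v y) - 1 ∈ I k := fun y => hE k _ (by simpa using hv 0 y)
  induction N generalizing k v with
  | zero =>
    intro n hn y
    obtain rfl : n = 0 := by omega
    simpa using h0 y
  | succ N ih =>
    refine FilDiff.succ h0 ?_
    -- Since `E` turns sums into products, the difference is a factor of weight zero times `E ∘ Δv -
    -- 1`, to which induction applies with `k + 1`.
    have e : fwdDiff (1 : ℤ_[p]) (fun y => E (v y) - 1) = fun y =>
        (E (v y) - 1 + 1) * (E (fwdDiff (1 : ℤ_[p]) v y) - 1) := by
      ext y
      have : v (y + 1) = v y + fwdDiff (1 : ℤ_[p]) v y := by simp [fwdDiff]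
      rw [fwdDiff, this, hadd]
      ring
    rw [e]
    have h1 : FilDiff I N 0 (fun y => E (v y) - 1 + 1) :=
      ((ih hv h0).mono hI (Nat.zero_le k)).add (filDiff_const (by rw [hI.zero]; trivial))
    have hv' : ∀ n y, (fwdDiff (1 : ℤ_[p]))^[n] (fwdDiff (1 : ℤ_[p]) v) y ∈ G (n + (k + 1)) := by
      intro n y
      rw [← Function.iterate_succ_apply, show n + (k + 1) = n + 1 + k by ring]
      exact hv (n + 1) y
    have h2 := ih hv' fun y => hE _ _ (by simpa using hv' 0 y)
    simpa using h1.mul hI h2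

end General

variable (p) in
/-- The `p`-adic filtration of `ℤ_p`. -/
def padicFil (n : ℕ) : Ideal ℤ_[p] := Ideal.span {(p : ℤ_[p]) ^ n}

lemma mem_padicFil {n : ℕ} {x : ℤ_[p]} : x ∈ padicFil p n ↔ (p : ℤ_[p]) ^ n ∣ x :=
  Ideal.mem_span_singleton

lemma isFiltration_padicFil : IsFiltration (padicFil p) where
  zero := by simp [padicFil]
  anti m n h := by
    rw [padicFil, padicFil, Ideal.span_singleton_le_span_singleton]
    exact pow_dvd_pow _ h
  mul hx hy := by
    rw [mem_padicFil] at *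
    rw [pow_add]
    exact mul_dvd_mul hx hy

/-- If `Δ^n v` is divisible by `p^n` for all `n`, then the `n`-th multiplicative finite difference
of `v` is congruent to `1` modulo `p^n`. -/
lemma mulDiff_sub_one_dvd {v : ℤ_[p] → ℤ_[p]ˣ}
    (hv : ∀ N, FilDiff (padicFil p) N 0 fun y => (v y : ℤ_[p])) (n : ℕ) (y : ℤ_[p]) :
    (p : ℤ_[p]) ^ n ∣
      ((((fwdDiff (1 : ℤ_[p]))^[n] (fun y => Additive.ofMul (v y)) y).toMul : ℤ_[p]ˣ) : ℤ_[p])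
        - 1 := by
  have hI := isFiltration_padicFil (p := p)
  set w : ℕ → ℤ_[p] → ℤ_[p]ˣ := fun n y =>
    ((fwdDiff (1 : ℤ_[p]))^[n] (fun y => Additive.ofMul (v y)) y).toMul with hw
  -- The induction must control all ordinary differences of the multiplicative difference `w n`, not
  -- only its values.
  suffices h : ∀ n N, FilDiff (padicFil p) N n fun y => (w n y : ℤ_[p]) - 1 by
    simpa [mem_padicFil] using h n 0 0 le_rfl y
  have h1 : ∀ N, FilDiff (padicFil p) N 0 (fun _ : ℤ_[p] => (1 : ℤ_[p])) :=
    fun _ => filDiff_const (hI.zero ▸ trivial)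
  have hm1 : ∀ N, FilDiff (padicFil p) N 0 (fun _ : ℤ_[p] => (-1 : ℤ_[p])) :=
    fun _ => filDiff_const (hI.zero ▸ trivial)
  intro n
  induction n with
  | zero => exact fun N => by simpa [hw, sub_eq_add_neg] using (hv N).add (hm1 N)
  | succ n ih =>
    intro N
    have hwn : FilDiff (padicFil p) N 0 (fun y => (w n y : ℤ_[p])) := by
      simpa using ((ih N).mono hI (Nat.zero_le n)).add (h1 N)
    have hwi : FilDiff (padicFil p) N 0 (fun y => (((w n y)⁻¹ : ℤ_[p]ˣ) : ℤ_[p])) :=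
      hwn.inv hI fun y => (w n y).mul_inv
    have hs : ∀ y, w (n + 1) y = w n (y + 1) * (w n y)⁻¹ := by
      intro y
      simp only [hw, Function.iterate_succ_apply', fwdDiff]
      rw [toMul_sub, div_eq_mul_inv]
    -- A quotient minus `1` is the ordinary difference divided by the denominator, so one
    -- multiplicative difference gains the same weight as an additive one.
    have e : (fun y => (w (n + 1) y : ℤ_[p]) - 1) = fun y =>
        fwdDiff (1 : ℤ_[p]) (fun y => (w n y : ℤ_[p]) - 1) y * (((w n y)⁻¹ : ℤ_[p]ˣ) : ℤ_[p]) := by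
      ext y
      rw [hs, Units.val_mul, fwdDiff]
      linear_combination (w n y).mul_inv
    rw [e]
    have h := FilDiff.mul hI (ih (N + 1)).diff hwi
    rwa [add_zero] at h

variable (p) in
/-- The ideal of the power series `∑ a_m X^m` over `Λ` with `a_m ∈ (p, T)^(k - ⌊m/p⌋)`. -/
def seriesFil (k : ℕ) : Ideal (PowerSeries (Iwasawa p)) where
  carrier := {f | ∀ m, PowerSeries.coeff m f ∈ maxId p ^ (k - m / p)}
  zero_mem' m := by simp
  add_mem' hf hg m := by simpa using add_mem (hf m) (hg m)
  smul_mem' r f hf m := by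
    rw [smul_eq_mul, PowerSeries.coeff_mul]
    refine sum_mem fun q hq => Ideal.mul_mem_left _ _ (Ideal.pow_le_pow_right ?_ (hf q.2))
    have h := Finset.HasAntidiagonal.mem_antidiagonal.1 hq
    exact Nat.sub_le_sub_left (Nat.div_le_div_right (by omega)) _

lemma mem_seriesFil {k : ℕ} {f : PowerSeries (Iwasawa p)} :
    f ∈ seriesFil p k ↔ ∀ m, PowerSeries.coeff m f ∈ maxId p ^ (k - m / p) := Iff.rfl

/-- Multiplicativity is the inequality `⌊i/p⌋ + ⌊j/p⌋ ≤ ⌊(i+j)/p⌋`. -/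
lemma isFiltration_seriesFil : IsFiltration (seriesFil p) where
  zero := by
    rw [Ideal.eq_top_iff_one, mem_seriesFil]
    simp
  anti m n h f hf i := Ideal.pow_le_pow_right (by omega) (hf i)
  mul {a b f g} hf hg m := by
    rw [PowerSeries.coeff_mul]
    refine sum_mem fun q hq => ?_
    have h := Finset.HasAntidiagonal.mem_antidiagonal.1 hq
    have h2 := Ideal.mul_mem_mul (hf q.1) (hg q.2)
    rw [← pow_add] at h2
    refine Ideal.pow_le_pow_right ?_ h2
    have h3 := Nat.div_add_div_le_add_div (x := q.1) (y := q.2) (z := p)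
    rw [h] at h3
    omega

lemma C_mem_seriesFil {k : ℕ} {x : Iwasawa p} (hx : x ∈ maxId p ^ k) :
    PowerSeries.C x ∈ seriesFil p k := by
  intro m
  rw [PowerSeries.coeff_C]
  split_ifs with h
  · simpa [h] using hx
  · exact zero_mem _

lemma binomialSeries_nsmul (n : ℕ) (x : ℤ_[p]) :
    PowerSeries.binomialSeries (Iwasawa p) (n * x) =
      PowerSeries.binomialSeries (Iwasawa p) x ^ n := by
  induction n with
  | zero => simp
  | succ n ih => rw [pow_succ, ← ih, ← PowerSeries.binomialSeries_add]; push_cast; ring_nf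

/-- Multiplying the exponent by `p` turns `1 + t` into `(1+t)^p = 1 + t^p + p t r`. The term `p t r`
gains a weight from `p`; the term `t^p` does so for `k ≥ 1` because it contains `t²`. -/
lemma binomialSeries_sub_one_mem {k : ℕ} {x : ℤ_[p]} (hx : (p : ℤ_[p]) ^ k ∣ x) :
    PowerSeries.binomialSeries (Iwasawa p) x - 1 ∈ seriesFil p k := by
  have hp := (Fact.out : p.Prime)
  have hI := isFiltration_seriesFil (p := p)
  obtain ⟨y, rfl⟩ := hx
  induction k with
  | zero => rw [hI.zero]; trivial
  | succ k ih =>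
    set t := PowerSeries.binomialSeries (Iwasawa p) ((p : ℤ_[p]) ^ k * y) - 1 with ht
    obtain ⟨r, hr⟩ := exists_add_pow_prime_eq hp t 1
    have e : PowerSeries.binomialSeries (Iwasawa p) ((p : ℤ_[p]) ^ (k + 1) * y) - 1 =
        t ^ p + PowerSeries.C (p : Iwasawa p) * t * r := by
      rw [pow_succ', mul_assoc, binomialSeries_nsmul,
        show PowerSeries.binomialSeries (Iwasawa p) ((p : ℤ_[p]) ^ k * y) = t + 1 by rw [ht]; ring,
        hr, map_natCast]
      ring
    rw [e]
    refine add_mem ?_ (Ideal.mul_mem_right _ _ ?_)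
    -- For `k = 0` the only information on `t` is that `X` divides it, so `t^p` is a multiple of
    -- `X^p`, of weight one. This is where the `⌊m/p⌋` of the final estimate originates.
    · rcases k with _ | k
      · have h0 : PowerSeries.X ∣ t := by
          rw [PowerSeries.X_dvd_iff, ht]
          simp
        obtain ⟨s, hs⟩ := h0
        rw [hs, mul_pow]
        refine Ideal.mul_mem_right _ _ fun m => ?_
        rw [PowerSeries.coeff_X_pow]
        split_ifs with h
        · rw [h, Nat.div_self hp.pos]; simp
        · exact zero_mem _
      · rw [show t ^ p = t ^ (p - 2) * (t * t) by
          rw [← pow_two, ← pow_add, Nat.sub_add_cancel hp.two_le]]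
        exact Ideal.mul_mem_left _ _ (hI.anti (by omega) (hI.mul ih ih))
    · rw [add_comm k 1]
      exact hI.mul (C_mem_seriesFil (by simpa using p_mem_maxId)) ih

/-- If `Δ^n v` and `Δ^n h` are divisible by `p^n` for all `n`, then the `n`-th finite difference of
`z ↦ [v(z)] binom(h(z), m)` has values in `(p, T)^(n - ⌊m/p⌋)`. -/
lemma fwdDiff_univChar_mul_choose_mem (hp2 : p ≠ 2) {v : ℤ_[p] → ℤ_[p]ˣ} {h : ℤ_[p] → ℤ_[p]}
    (hv : ∀ N, FilDiff (padicFil p) N 0 fun y => (v y : ℤ_[p]))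
    (hh : ∀ N, FilDiff (padicFil p) N 0 h) (m n : ℕ) (y : ℤ_[p]) :
    (fwdDiff (1 : ℤ_[p]))^[n]
      (fun z => univChar (v z) * algebraMap ℤ_[p] (Iwasawa p) (mahler m (h z))) y ∈
        maxId p ^ (n - m / p) := by
  have hI := isFiltration_seriesFil (p := p)
  -- The function in question is the coefficient of `X^m` in `[v(z)] (1+X)^{h(z)}`. The two factors
  -- are estimated separately as exponentials, of `ℤ_p` and of the multiplicative group `ℤ_pˣ`, and
  -- then multiplied.
  have h1 : FilDiff (seriesFil p) n 0 (fun _ : ℤ_[p] => (1 : PowerSeries (Iwasawa p))) :=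
    filDiff_const (by rw [hI.zero]; trivial)
  have hE1 : FilDiff (seriesFil p) n 0
      (fun z => PowerSeries.binomialSeries (Iwasawa p) (h z) - 1) :=
    filDiff_exp hI (PowerSeries.binomialSeries_add (A := Iwasawa p))
      (G := fun k => {x | (p : ℤ_[p]) ^ k ∣ x}) (fun k a ha => binomialSeries_sub_one_mem ha)
      fun n y => by simpa [mem_padicFil] using hh n n le_rfl y
  have hE2 : FilDiff (seriesFil p) n 0
      (fun z => PowerSeries.C (univChar (Additive.ofMul (v z)).toMul) - 1) :=
    filDiff_exp (v := fun z => Additive.ofMul (v z)) hI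
      (E := fun x : Additive ℤ_[p]ˣ => PowerSeries.C (univChar x.toMul))
      (fun a b => by simp)
      (G := fun k => {x | (p : ℤ_[p]) ^ k ∣ ((x.toMul : ℤ_[p]ˣ) : ℤ_[p]) - 1})
      (fun k a ha => by
        rw [← map_one (PowerSeries.C (R := Iwasawa p)), ← map_sub]
        exact C_mem_seriesFil (univChar_sub_one_mem hp2 ha))
      fun n y => mulDiff_sub_one_dvd hv n y
  have hE := (hE2.add h1).mul hI (hE1.add h1)
  simp only [sub_add_cancel, toMul_ofMul] at hE
  have hm := hE n le_rfl y m
  rw [fwdDiff_iter_eq_sum_shift, map_sum] at hm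
  rw [fwdDiff_iter_eq_sum_shift]
  rw [show n + (0 + 0) = n by ring] at hm
  refine Eq.subst (motive := (· ∈ maxId p ^ (n - m / p))) ?_ hm
  refine Finset.sum_congr rfl fun i hi => ?_
  rw [map_zsmul, PowerSeries.coeff_C_mul, PowerSeries.binomialSeries_coeff, 
    Algebra.algebraMap_eq_smul_one (R := ℤ_[p]) (A := Iwasawa p)]
  rfl

lemma filDiff_autUnit (g : Sigma0 p) (N : ℕ) :
    FilDiff (padicFil p) N 0 fun z => (autUnit g z : ℤ_[p]) := by
  simp only [coe_autUnit]
  exact filDiff_affine isFiltration_padicFil (by rw [mem_padicFil, pow_one]; exact g.2.2.1)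
    (RingHom.id _)

/-- Numerator and denominator are affine with slopes divisible by `p`; for the numerator this is the
hypothesis on `g`. -/
lemma filDiff_fracLin (g : Sigma0 p) (hg : (p : ℤ_[p]) ∣ g.1 1 1) (N : ℕ) :
    FilDiff (padicFil p) N 0 (fracLin g) := by
  have hI := isFiltration_padicFil (p := p)
  have h1 : FilDiff (padicFil p) N 0 fun z : ℤ_[p] => g.1 0 1 + g.1 1 1 * z :=
    filDiff_affine hI (by rwa [mem_padicFil, pow_one]) (RingHom.id _)
  have h2 : FilDiff (padicFil p) N 0 fun z : ℤ_[p] => (((autUnit g z)⁻¹ : ℤ_[p]ˣ) : ℤ_[p]) :=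
    FilDiff.inv hI (v := fun z => (autUnit g z : ℤ_[p])) (fun y => (autUnit g y).mul_inv)
      (filDiff_autUnit g N)
  have h3 := FilDiff.mul hI h1 h2
  rw [add_zero] at h3
  have e : fracLin g = fun z => (g.1 0 1 + g.1 1 1 * z) * (((autUnit g z)⁻¹ : ℤ_[p]ˣ) : ℤ_[p]) := by
    ext z
    rfl
  rw [e]
  exact h3

/-- The integral estimate for the matrix coefficients of `g = (a b; c d)`, `p ∣ c, d`, on the Mahler
basis. -/
lemma fwdDiff_weightAct_mahler_mem (hp2 : p ≠ 2) (g : Sigma0 p) (hg : (p : ℤ_[p]) ∣ g.1 1 1)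
    (m n : ℕ) (y : ℤ_[p]) :
    (fwdDiff (1 : ℤ_[p]))^[n] (weightAct univChar g (mahlerFun m).1) y ∈ maxId p ^ (n - m / p) :=
  fwdDiff_univChar_mul_choose_mem hp2 (filDiff_autUnit g) (filDiff_fracLin g hg) m n y

end DifferenceFiltration

/-! ### Coordinates on `D^int` and its stability under `Σ₀(p)`. -/

section IntegralDistributionCoordinates

variable {p : ℕ} [Fact p.Prime]

lemma fwdDiff_map_mahler {R : Type*} [CommRing R] (φ : ℤ_[p] →+* R) (i j : ℕ) :
    (fwdDiff (1 : ℤ_[p]))^[i] (fun z => φ (mahler j z)) 0 = if i = j then 1 else 0 := by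
  have h := fwdDiff_iter_choose_zero j i
  rw [fwdDiff_iter_eq_sum_shift] at h ⊢
  have h2 := congrArg (Int.cast : ℤ → R) h
  rw [Int.cast_sum] at h2
  convert h2 using 1
  · refine Finset.sum_congr rfl fun k _ => ?_
    rw [zero_add, zero_add, nsmul_one, mahler_natCast_eq, map_natCast, smul_eq_mul, zsmul_eq_mul]
    simp
  · split_ifs <;> simp

lemma fwdDiff_mahlerFun (i j : ℕ) :
    (fwdDiff (1 : ℤ_[p]))^[i] (mahlerFun (p := p) j).1 0 = if i = j then 1 else 0 :=
  fwdDiff_map_mahler (algebraMap ℤ_[p] (Iwasawa p)) i j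

lemma fwdDiff_const_mul {R : Type*} [CommRing R] (r : R) (f : ℤ_[p] → R) (n : ℕ) (z : ℤ_[p]) :
    (fwdDiff (1 : ℤ_[p]))^[n] (fun z => r * f z) z = r * (fwdDiff (1 : ℤ_[p]))^[n] f z := by
  have : (fun z => r * f z) = r • f := rfl
  rw [this, fwdDiff_iter_const_smul]
  rfl

lemma summable_mul_fwdDiff (c : ℕ → Iwasawa p) (f : contFun p) :
    Summable fun i => c i * (fwdDiff (1 : ℤ_[p]))^[i] f.1 0 :=
  summable_iwasawa fun m => by
    rw [Nat.cofinite_eq_atTop]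
    filter_upwards [fwdDiff_mem_coefIdeal f.2 m] with i hi
    exact Ideal.mul_mem_left _ _ hi

/-- The functional `∑ c_i δ^[i]`. -/
def sumDelta (c : ℕ → Iwasawa p) : contFun p →ₗ[Iwasawa p] Iwasawa p where
  toFun f := ∑' i, c i * (fwdDiff (1 : ℤ_[p]))^[i] f.1 0
  map_add' f g := by
    rw [← (summable_mul_fwdDiff c f).tsum_add (summable_mul_fwdDiff c g)]
    refine tsum_congr fun i => ?_
    rw [Submodule.coe_add, fwdDiff_iter_add, Pi.add_apply, mul_add]
  map_smul' r f := by
    rw [RingHom.id_apply, smul_eq_mul, ← (summable_mul_fwdDiff c f).tsum_mul_left r]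
    refine tsum_congr fun i => ?_
    have : ((r • f : contFun p) : ℤ_[p] → Iwasawa p) = fun z => r * f.1 z := rfl
    rw [this, fwdDiff_const_mul]
    ring

lemma hasSum_sumDelta (c : ℕ → Iwasawa p) (f : contFun p) :
    HasSum (fun i => c i * (fwdDiff (1 : ℤ_[p]))^[i] f.1 0) (sumDelta c f) :=
  (summable_mul_fwdDiff c f).hasSum

lemma sumDelta_mem (c : ℕ → Iwasawa p) : sumDelta c ∈ Dint p := ⟨c, hasSum_sumDelta c⟩

lemma eq_of_hasSum_mahlerFun {c : ℕ → Iwasawa p} {i : ℕ} {x : Iwasawa p}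
    (h : HasSum (fun j => c j * (fwdDiff (1 : ℤ_[p]))^[j] (mahlerFun (p := p) i).1 0) x) :
    x = c i := by
  refine h.unique ?_
  have := hasSum_ite_eq i (c i)
  refine hasSum_of_forall_eq this fun j => ?_
  rw [fwdDiff_mahlerFun]
  by_cases hj : j = i <;> simp [hj]

lemma sumDelta_mahlerFun (c : ℕ → Iwasawa p) (i : ℕ) : sumDelta c (mahlerFun i) = c i :=
  eq_of_hasSum_mahlerFun (hasSum_sumDelta c _)

lemma hasSum_of_mem_Dint {μ : contFun p →ₗ[Iwasawa p] Iwasawa p} (hμ : μ ∈ Dint p) (f : contFun p) :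
    HasSum (fun i => μ (mahlerFun i) * (fwdDiff (1 : ℤ_[p]))^[i] f.1 0) (μ f) := by
  obtain ⟨c, hc⟩ := hμ
  refine hasSum_of_forall_eq (hc f) fun i => ?_
  rw [eq_of_hasSum_mahlerFun (hc (mahlerFun i))]

lemma dualAct_mahlerFun_hasSum {μ : contFun p →ₗ[Iwasawa p] Iwasawa p} (hμ : μ ∈ Dint p)
    (g : Sigma0 p) (m : ℕ) :
    HasSum (fun i => μ (mahlerFun i) *
      (fwdDiff (1 : ℤ_[p]))^[i] (weightAct univChar g (mahlerFun m).1) 0)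
      (dualAct isStable_contFun g μ (mahlerFun m)) :=
  hasSum_of_mem_Dint hμ ⟨_, isStable_contFun g _ (mahlerFun m).2⟩

/-- Terms are small for large `m` because of `a`, and for each of the remaining finitely many `m`
once `i` is large. The `c i` need no decay, since smallness is membership in ideals. -/
lemma summable_double (c : ℕ → Iwasawa p) {a : ℕ → Iwasawa p} {X : ℕ → ℕ → Iwasawa p}
    (ha : ∀ M, ∀ᶠ m in atTop, a m ∈ coefIdeal p M M)
    (hX : ∀ m M, ∀ᶠ i in atTop, X i m ∈ coefIdeal p M M) :
    Summable fun q : ℕ × ℕ => c q.1 * (X q.1 q.2 * a q.2) := by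
  refine summable_iwasawa fun M => ?_
  obtain ⟨m0, hm0⟩ := eventually_atTop.1 (ha M)
  choose i0 hi0 using fun m => eventually_atTop.1 (hX m M)
  rw [Filter.eventually_cofinite]
  refine ((Finset.range ((Finset.range m0).sup i0) ×ˢ Finset.range m0).finite_toSet).subset ?_
  rintro ⟨i, m⟩ hq
  rw [Finset.mem_coe, Finset.mem_product, Finset.mem_range, Finset.mem_range]
  have hm : m < m0 := by
    by_contra hm
    exact hq (Ideal.mul_mem_left _ _ (Ideal.mul_mem_left _ _ (hm0 m (not_lt.1 hm))))
  refine ⟨?_, hm⟩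
  by_contra hi
  refine hq (Ideal.mul_mem_left _ _ (Ideal.mul_mem_right _ _ (hi0 m i ?_)))
  exact (Finset.le_sup (f := i0) (Finset.mem_range.2 hm)).trans (not_lt.1 hi)

/-- Interchange of the sums: expanding `g · f` in Mahler functions before applying `∑ c_i δ^[i]`
shows that `μ ‖ g` again has Mahler coordinates. -/
lemma hasSum_double_comm {c a b d : ℕ → Iwasawa p} {X : ℕ → ℕ → Iwasawa p} {S : Iwasawa p}
    (ha : ∀ M, ∀ᶠ m in atTop, a m ∈ coefIdeal p M M)
    (hX : ∀ m M, ∀ᶠ i in atTop, X i m ∈ coefIdeal p M M)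
    (hb : ∀ i, HasSum (fun m => X i m * a m) (b i)) (hS : HasSum (fun i => c i * b i) S)
    (hd : ∀ m, HasSum (fun i => c i * X i m) (d m)) : HasSum (fun m => d m * a m) S := by
  have hG := summable_double c ha hX
  have hsum : HasSum (fun q : ℕ × ℕ => c q.1 * (X q.1 q.2 * a q.2)) S := by
    have h2 := hG.hasSum.prod_fiberwise fun i => (hb i).mul_left (c i)
    rw [← h2.unique hS]
    exact hG.hasSum
  refine ((Equiv.prodComm ℕ ℕ).hasSum_iff.2 hsum).prod_fiberwise fun m => ?_
  refine hasSum_of_forall_eq ((hd m).mul_right (a m)) fun i => ?_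
  exact (mul_assoc _ _ _).symm

lemma hasSum_fwdDiff {R : Type*} [CommRing R] [TopologicalSpace R] [IsTopologicalRing R]
    {F : ℤ_[p] → R} {K : ℕ → ℤ_[p] → R} {a : ℕ → R}
    (h : ∀ z, HasSum (fun m => K m z * a m) (F z)) (i : ℕ) (z : ℤ_[p]) :
    HasSum (fun m => (fwdDiff (1 : ℤ_[p]))^[i] (K m) z * a m) ((fwdDiff (1 : ℤ_[p]))^[i] F z) := by
  simp only [fwdDiff_iter_eq_sum_shift, Finset.sum_mul]
  refine hasSum_sum fun k _ => ?_
  have h' := (h (z + k • 1)).mul_left (((((-1) ^ (i - k) * (i.choose k : ℤ) : ℤ)) : R))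
  rw [← zsmul_eq_mul] at h'
  refine hasSum_of_forall_eq h' fun m => ?_
  rw [zsmul_eq_mul, mul_assoc]

lemma hasSum_fwdDiff_weightAct (g : Sigma0 p) (f : contFun p) (i : ℕ) :
    HasSum (fun m => (fwdDiff (1 : ℤ_[p]))^[i] (weightAct univChar g (mahlerFun m).1) 0 *
      (fwdDiff (1 : ℤ_[p]))^[m] f.1 0)
      ((fwdDiff (1 : ℤ_[p]))^[i] (weightAct univChar g f.1) 0) := by
  refine hasSum_fwdDiff (K := fun m => weightAct univChar g (mahlerFun m).1) (fun z => ?_) i 0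
  refine hasSum_of_forall_eq ((hasSum_mahler_iwasawa f.2 (fracLin g z)).mul_left
    (univChar (autUnit g z))) fun m => ?_
  exact mul_assoc _ _ _

/-- `D^int` is stable under the action of `Σ₀(p)`. -/
lemma dualAct_mem_Dint (g : Sigma0 p) {μ : contFun p →ₗ[Iwasawa p] Iwasawa p} (hμ : μ ∈ Dint p) :
    dualAct isStable_contFun g μ ∈ Dint p :=
  ⟨fun m => dualAct isStable_contFun g μ (mahlerFun m), fun f =>
    hasSum_double_comm (c := fun i => μ (mahlerFun i))
      (b := fun i => (fwdDiff (1 : ℤ_[p]))^[i] (weightAct univChar g f.1) 0)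
      (fwdDiff_mem_coefIdeal f.2)
      (fun m => fwdDiff_mem_coefIdeal (isStable_contFun g _ (mahlerFun m).2))
      (hasSum_fwdDiff_weightAct g f)
      (hasSum_of_mem_Dint hμ ⟨weightAct univChar g f.1, isStable_contFun g f.1 f.2⟩)
      (dualAct_mahlerFun_hasSum hμ g)⟩

end IntegralDistributionCoordinates

/-! ### Cocycle identities: the weight action and its dual are monoid actions. -/

section ActionLaws

variable {p : ℕ} [Fact p.Prime]

lemma fracLin_mul_autUnit (g : Sigma0 p) (z : ℤ_[p]) :
    fracLin g z * (autUnit g z : ℤ_[p]) = g.1 0 1 + g.1 1 1 * z := by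
  rw [fracLin, mul_assoc, Units.inv_mul, mul_one]

/-- The row vector identity `(1, z) g = (a + cz) (1, g z)`, applied twice, gives both this cocycle
relation and `fracLin_mul`. -/
lemma autUnit_mul (g h : Sigma0 p) (z : ℤ_[p]) :
    autUnit (g * h) z = autUnit g z * autUnit h (fracLin g z) := by
  ext1
  have h1 := fracLin_mul_autUnit g z
  have e0 : (g * h).1 0 0 = g.1 0 0 * h.1 0 0 + g.1 0 1 * h.1 1 0 := by
    simp [Matrix.mul_apply, Fin.sum_univ_two]
  have e1 : (g * h).1 1 0 = g.1 1 0 * h.1 0 0 + g.1 1 1 * h.1 1 0 := by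
    simp [Matrix.mul_apply, Fin.sum_univ_two]
  rw [Units.val_mul]
  rw [coe_autUnit] at h1
  simp only [coe_autUnit]
  rw [e0, e1]
  linear_combination (-h.1 1 0) * h1

lemma fracLin_mul (g h : Sigma0 p) (z : ℤ_[p]) :
    fracLin (g * h) z = fracLin h (fracLin g z) := by
  have h1 := fracLin_mul_autUnit g z
  have h2 := fracLin_mul_autUnit (g * h) z
  have h3 := fracLin_mul_autUnit h (fracLin g z)
  have e0 : (g * h).1 0 1 = g.1 0 0 * h.1 0 1 + g.1 0 1 * h.1 1 1 := by
    simp [Matrix.mul_apply, Fin.sum_univ_two]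
  have e1 : (g * h).1 1 1 = g.1 1 0 * h.1 0 1 + g.1 1 1 * h.1 1 1 := by
    simp [Matrix.mul_apply, Fin.sum_univ_two]
  refine (autUnit (g * h) z).isUnit.mul_right_cancel ?_
  rw [h2, autUnit_mul, Units.val_mul, e0, e1]
  have h4 := coe_autUnit g z
  linear_combination (-(autUnit g z : ℤ_[p])) * h3 - h.1 1 1 * h1 - h.1 0 1 * h4

lemma autUnit_one (z : ℤ_[p]) : autUnit (1 : Sigma0 p) z = 1 := by
  ext1
  rw [coe_autUnit]
  simp

lemma fracLin_one (z : ℤ_[p]) : fracLin (1 : Sigma0 p) z = z := by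
  rw [fracLin, autUnit_one]
  simp

variable {R : Type*} [CommRing R] {χ : ℤ_[p]ˣ →* R} {S : Submodule R (ℤ_[p] → R)}

lemma weightAct_apply (g : Sigma0 p) (f : ℤ_[p] → R) (z : ℤ_[p]) :
    weightAct χ g f z = χ (autUnit g z) * f (fracLin g z) := rfl

lemma weightAct_mul (g h : Sigma0 p) (f : ℤ_[p] → R) :
    weightAct χ (g * h) f = weightAct χ g (weightAct χ h f) := by
  ext z
  simp only [weightAct_apply, autUnit_mul, fracLin_mul, map_mul, mul_assoc]

lemma weightAct_one (f : ℤ_[p] → R) : weightAct χ 1 f = f := by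
  ext z
  simp only [weightAct_apply, autUnit_one, fracLin_one, map_one, one_mul]

lemma dualAct_apply (hS : IsStable χ S) (g : Sigma0 p) (μ : S →ₗ[R] R) (f : S) :
    dualAct hS g μ f = μ ⟨weightAct χ g f.1, hS g f.1 f.2⟩ := rfl

lemma dualAct_mul (hS : IsStable χ S) (g h : Sigma0 p) (μ : S →ₗ[R] R) :
    dualAct hS (g * h) μ = dualAct hS h (dualAct hS g μ) := by
  ext f
  simp only [dualAct_apply, weightAct_mul]

lemma dualAct_one (hS : IsStable χ S) (μ : S →ₗ[R] R) : dualAct hS 1 μ = μ := by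
  ext f
  simp only [dualAct_apply, weightAct_one]

end ActionLaws

/-! ### The action of `Γ₀(pN)` on divisors and functionals, and the role of `-1`. -/

section GammaAction

variable {p : ℕ} [Fact p.Prime] {N : ℕ}

lemma gammaSigma_mul (γ δ : CongruenceSubgroup.Gamma0 (p * N)) :
    gammaSigma (γ * δ) = gammaSigma γ * gammaSigma δ := by
  refine Subtype.ext ?_
  change (γ.1.1 * δ.1.1).map (Int.cast : ℤ → ℤ_[p]) = γ.1.1.map _ * δ.1.1.map _
  exact Matrix.map_mul (f := Int.castRingHom ℤ_[p])

lemma gammaSigma_one : gammaSigma (1 : CongruenceSubgroup.Gamma0 (p * N)) = 1 := by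
  refine Subtype.ext ?_
  change (1 : Matrix (Fin 2) (Fin 2) ℤ).map (Int.cast : ℤ → ℤ_[p]) = 1
  exact Matrix.map_one _ Int.cast_zero Int.cast_one

variable (N) in
/-- The element `-1` of `Γ₀(M)`. -/
def gammaNegOne : CongruenceSubgroup.Gamma0 N :=
  ⟨-1, by simp [CongruenceSubgroup.Gamma0_mem]⟩

variable {R : Type*} [CommRing R] {χ : ℤ_[p]ˣ →* R} {S : Submodule R (ℤ_[p] → R)}

lemma dualAct_gammaNegOne (hS : IsStable χ S) (μ : S →ₗ[R] R) :
    dualAct hS (gammaSigma (gammaNegOne (p * N))) μ = χ (-1) • μ := by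
  ext f
  have h1 : ∀ z, autUnit (gammaSigma (gammaNegOne (p * N))) z = -1 := by
    intro z
    ext1
    rw [coe_autUnit]
    simp [gammaSigma, gammaNegOne]
  have h2 : ∀ z, fracLin (gammaSigma (gammaNegOne (p * N))) z = z := by
    intro z
    rw [fracLin, h1]
    simp [gammaSigma, gammaNegOne]
  have e : (⟨weightAct χ (gammaSigma (gammaNegOne (p * N))) f.1, hS _ f.1 f.2⟩ : S) =
      χ (-1) • f := by
    refine Subtype.ext (funext fun z => ?_)
    change weightAct χ _ f.1 z = χ (-1) • f.1 z
    rw [weightAct_apply, h1, h2, smul_eq_mul]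
  rw [dualAct_apply, e, map_smul]
  rfl

lemma dualAct_gamma_inv (hS : IsStable χ S) (γ : CongruenceSubgroup.Gamma0 (p * N))
    (μ : S →ₗ[R] R) : dualAct hS (gammaSigma γ⁻¹) (dualAct hS (gammaSigma γ) μ) = μ := by
  rw [← dualAct_mul, ← gammaSigma_mul, mul_inv_cancel, gammaSigma_one, dualAct_one]

/-- The action of `Γ₀(pN)` on `Δ_C⁰`. -/
abbrev gammaDiv (γ : CongruenceSubgroup.Gamma0 (p * N)) :
    degZeroDiv (cuspSet N) →+ degZeroDiv (cuspSet N) :=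
  divAct (Matrix.SpecialLinearGroup.mapGL ℚ γ.1 • ·)
    (gamma_smul_mem_cuspSet (Dvd.intro_left p rfl) γ)

/-- The action of `(1 a; 0 p)` on `Δ_C⁰`. -/
abbrev heckeDiv (hpN : p.Coprime N) (a : ℕ) :
    degZeroDiv (cuspSet N) →+ degZeroDiv (cuspSet N) :=
  divAct (heckeGL p a • ·) (heckeGL_smul_mem_cuspSet hpN a)

lemma coe_divAct {C : Set (OnePoint ℚ)} (σ : OnePoint ℚ → OnePoint ℚ) (hσ : ∀ x ∈ C, σ x ∈ C)
    (x : degZeroDiv C) : (divAct σ hσ x).1 = Finsupp.mapDomain σ x.1 := rfl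

lemma divAct_divAct {C : Set (OnePoint ℚ)} {σ τ υ : OnePoint ℚ → OnePoint ℚ}
    (hσ : ∀ x ∈ C, σ x ∈ C) (hτ : ∀ x ∈ C, τ x ∈ C) (hυ : ∀ x ∈ C, υ x ∈ C)
    (h : ∀ x, σ (τ x) = υ x) (x : degZeroDiv C) : divAct σ hσ (divAct τ hτ x) = divAct υ hυ x := by
  refine Subtype.ext ?_
  rw [coe_divAct, coe_divAct, coe_divAct, ← Finsupp.mapDomain_comp]
  congr 1
  ext y
  exact h y

lemma gammaDiv_mul (γ δ : CongruenceSubgroup.Gamma0 (p * N)) (x : degZeroDiv (cuspSet N)) :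
    gammaDiv γ (gammaDiv δ x) = gammaDiv (γ * δ) x :=
  divAct_divAct _ _ _ (fun y => by
    change _ = Matrix.SpecialLinearGroup.mapGL ℚ (γ.1 * δ.1) • y
    rw [map_mul, mul_smul]) x

lemma gammaDiv_one (x : degZeroDiv (cuspSet N)) :
    gammaDiv (1 : CongruenceSubgroup.Gamma0 (p * N)) x = x := by
  refine Subtype.ext ?_
  rw [coe_divAct]
  have : (fun y : OnePoint ℚ => Matrix.SpecialLinearGroup.mapGL ℚ
      (1 : CongruenceSubgroup.Gamma0 (p * N)).1 • y) = id := by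
    ext1 y
    change Matrix.SpecialLinearGroup.mapGL ℚ (1 : Matrix.SpecialLinearGroup (Fin 2) ℤ) • y = y
    rw [map_one, one_smul]
  rw [this, Finsupp.mapDomain_id]

lemma Symb.apply_gammaDiv {hS : IsStable χ S} {D : Submodule R (S →ₗ[R] R)} (φ : Symb N hS D)
    (γ : CongruenceSubgroup.Gamma0 (p * N)) (x : degZeroDiv (cuspSet N)) :
    φ.1 (gammaDiv γ x) = dualAct hS (gammaSigma γ⁻¹) (φ.1 x) := by
  rw [← φ.2.2 γ x, dualAct_gamma_inv]

/-- `-1` fixes every cusp but acts on functionals by `χ(-1)`, so equivariance confines the values of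
a symbol to the part where `χ(-1) = 1`. -/
lemma Symb.neg_one_smul {hS : IsStable χ S} {D : Submodule R (S →ₗ[R] R)} (φ : Symb N hS D)
    (x : degZeroDiv (cuspSet N)) : χ (-1) • φ.1 x = φ.1 x := by
  have h := φ.2.2 (gammaNegOne (p * N)) x
  rw [dualAct_gammaNegOne] at h
  have e : gammaDiv (gammaNegOne (p * N)) x = x := by
    refine Subtype.ext ?_
    rw [coe_divAct]
    have : (fun y : OnePoint ℚ => Matrix.SpecialLinearGroup.mapGL ℚ
        (gammaNegOne (p * N)).1 • y) = id := by
      ext1 y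
      have hm : Matrix.SpecialLinearGroup.mapGL ℚ (gammaNegOne (p * N)).1 = (-1 : GL (Fin 2) ℚ) := by
        ext i j
        fin_cases i <;> fin_cases j <;> simp [gammaNegOne]
      rw [hm]
      cases y with
      | infty => simp [OnePoint.smul_infty_eq_ite]
      | coe y => simp [OnePoint.smul_some_eq_ite]
    rw [this, Finsupp.mapDomain_id]
  rw [show divAct _ _ x = gammaDiv (gammaNegOne (p * N)) x from rfl, e] at h
  exact h

/-- Two elements of `Γ₀(M)` which act in the same way on `ℙ¹(ℚ)` agree up to sign. -/
lemma gamma_eq_or_eq_mul_negOne {M : ℕ} {γ δ : CongruenceSubgroup.Gamma0 M}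
    (h : ∀ y : OnePoint ℚ, Matrix.SpecialLinearGroup.mapGL ℚ γ.1 • y =
      Matrix.SpecialLinearGroup.mapGL ℚ δ.1 • y) : γ = δ ∨ γ = δ * gammaNegOne M := by
  set ε : Matrix.SpecialLinearGroup (Fin 2) ℤ := δ.1⁻¹ * γ.1 with hε
  have hfix : ∀ y : OnePoint ℚ, Matrix.SpecialLinearGroup.mapGL ℚ ε • y = y := by
    intro y
    rw [hε, map_mul, mul_smul, h, map_inv, inv_smul_smul]
  -- Fixing `∞` kills the lower left entry and fixing `0` the upper right one; an integral diagonal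
  -- matrix of determinant one is `±1`.
  have h10 : ε.1 1 0 = 0 := by
    have := hfix OnePoint.infty
    rw [OnePoint.smul_infty_eq_ite] at this
    by_contra hne
    rw [if_neg (by simpa using hne)] at this
    exact OnePoint.coe_ne_infty _ this
  have hdet := ε.2
  rw [Matrix.det_fin_two, h10, mul_zero, sub_zero] at hdet
  have h01 : ε.1 0 1 = 0 := by
    have := hfix ((0 : ℚ) : OnePoint ℚ)
    rw [OnePoint.smul_some_eq_ite] at this
    have h11 : ε.1 1 1 ≠ 0 := fun h => by simp [h] at hdet
    rw [if_neg (by simpa using h11)] at this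
    have h2 := OnePoint.coe_injective this
    simpa [h11] using h2
  have hγ : γ.1 = δ.1 * ε := by rw [hε, mul_inv_cancel_left]
  rcases Int.mul_eq_one_iff_eq_one_or_neg_one.1 hdet with ⟨h0, h1⟩ | ⟨h0, h1⟩
  · left
    have : ε = 1 := by
      ext i j
      fin_cases i <;> fin_cases j <;> simp [h10, h01, h0, h1]
    refine Subtype.ext ?_
    rw [hγ, this, mul_one]
  · right
    have : ε = -1 := by
      ext i j
      fin_cases i <;> fin_cases j <;> simp [h10, h01, h0, h1]
    refine Subtype.ext ?_
    rw [hγ, this]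
    rfl

end GammaAction

/-! ### Symbols are determined by, and can be built from, their values on the basis. -/

section FreeBasis

variable {p : ℕ} [Fact p.Prime] {N : ℕ} {ι : Type*} {e : ι → degZeroDiv (cuspSet N)}

lemma exists_lift_moebius {M : ℕ} (σ : moebiusGamma0 M) :
    ∃ γ : CongruenceSubgroup.Gamma0 M,
      ∀ y, Matrix.SpecialLinearGroup.mapGL ℚ γ.1 • y = σ.1 y := by
  obtain ⟨γ, hγ, h⟩ := σ.2
  refine ⟨⟨γ, hγ⟩, fun y => ?_⟩
  rw [← h]
  rfl

/-- A lift to `Γ₀(M)` of an element of its image in `PSL₂(ℤ)`. -/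
def liftMoebius {M : ℕ} (σ : moebiusGamma0 M) : CongruenceSubgroup.Gamma0 M :=
  (exists_lift_moebius σ).choose

lemma liftMoebius_smul {M : ℕ} (σ : moebiusGamma0 M) (y : OnePoint ℚ) :
    Matrix.SpecialLinearGroup.mapGL ℚ (liftMoebius σ).1 • y = σ.1 y :=
  (exists_lift_moebius σ).choose_spec y

/-- The image in `PSL₂(ℤ)` of an element of `Γ₀(M)`. -/
def toMoebius {M : ℕ} (γ : CongruenceSubgroup.Gamma0 M) : moebiusGamma0 M :=
  ⟨_, Subgroup.mem_map_of_mem _ γ.2⟩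

variable (he : IsFreeBasis (cuspSet N) (p * N) e)

/-- The translates of the `e_i` under lifts of the elements of the image of `Γ₀(pN)` in `PSL₂(ℤ)`
form a `ℤ`-basis of `Δ_C⁰`. -/
def freeBasis : Module.Basis (moebiusGamma0 (p * N) × ι) ℤ (degZeroDiv (cuspSet N)) :=
  Module.Basis.mk (v := fun q => gammaDiv (liftMoebius q.1) (e q.2))
    (by
      have hinj : Function.Injective (degZeroDiv (cuspSet N)).subtype.toIntLinearMap :=
        Subtype.val_injective
      rw [← LinearMap.linearIndependent_iff_of_injOn _ hinj.injOn]
      have hv : (degZeroDiv (cuspSet N)).subtype.toIntLinearMap ∘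
          (fun q : moebiusGamma0 (p * N) × ι => gammaDiv (liftMoebius q.1) (e q.2)) =
          fun q => Finsupp.mapDomain q.1.1 (e q.2).1 := by
        ext1 q
        change Finsupp.mapDomain _ _ = _
        congr 1
        ext1 y
        exact liftMoebius_smul q.1 y
      rw [hv]
      exact he.1)
    (by
      have hcl := he.2
      set v : moebiusGamma0 (p * N) × ι → degZeroDiv (cuspSet N) :=
        fun q => gammaDiv (liftMoebius q.1) (e q.2)
      have hv : ∀ q, (v q).1 = Finsupp.mapDomain q.1.1 (e q.2).1 := by
        intro q
        change Finsupp.mapDomain _ _ = _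
        congr 1
        ext1 y
        exact liftMoebius_smul q.1 y
      have key : AddSubgroup.closure (Set.range fun q : moebiusGamma0 (p * N) × ι =>
          Finsupp.mapDomain q.1.1 (e q.2).1) ≤
          ((Submodule.span ℤ (Set.range v)).toAddSubgroup).map (degZeroDiv (cuspSet N)).subtype := by
        rw [AddSubgroup.closure_le]
        rintro _ ⟨q, rfl⟩
        exact ⟨v q, Submodule.subset_span ⟨q, rfl⟩, hv q⟩
      rw [hcl] at key
      rintro x -
      obtain ⟨y, hy, hyx⟩ := key x.2
      have : y = x := Subtype.ext hyx
      rw [← this]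
      exact hy)

lemma freeBasis_apply (q : moebiusGamma0 (p * N) × ι) :
    freeBasis he q = gammaDiv (liftMoebius q.1) (e q.2) := by
  rw [freeBasis, Module.Basis.mk_apply]

lemma freeBasis_toMoebius (γ : CongruenceSubgroup.Gamma0 (p * N)) (i : ι) :
    freeBasis he (toMoebius γ, i) = gammaDiv γ (e i) := by
  rw [freeBasis_apply]
  refine Subtype.ext ?_
  rw [coe_divAct, coe_divAct]
  congr 1
  ext1 y
  exact liftMoebius_smul (toMoebius γ) y

variable {R : Type*} [CommRing R] {χ : ℤ_[p]ˣ →* R} {S : Submodule R (ℤ_[p] → R)}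
  {hS : IsStable χ S} {D : Submodule R (S →ₗ[R] R)}

lemma Symb.ext_of_basis (he : IsFreeBasis (cuspSet N) (p * N) e) {φ ψ : Symb N hS D}
    (h : ∀ i, φ.1 (e i) = ψ.1 (e i)) : φ = ψ := by
  refine Subtype.ext ((freeBasis he).ext fun q => ?_)
  rw [freeBasis_apply, Symb.apply_gammaDiv φ, Symb.apply_gammaDiv ψ, h]

/-- The homomorphism `Δ_C⁰ → D` which extends `e_i ↦ μ_i` equivariantly. -/
def symbHom (hS : IsStable χ S) (μ : ι → S →ₗ[R] R) :
    degZeroDiv (cuspSet N) →ₗ[ℤ] (S →ₗ[R] R) :=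
  (freeBasis he).constr ℤ fun q => dualAct hS (gammaSigma (liftMoebius q.1)⁻¹) (μ q.2)

/-- The chosen lift of the image of `γ` is `γ` or `-γ`; the hypothesis on `μ` absorbs the sign. -/
lemma symbHom_gammaDiv {μ : ι → S →ₗ[R] R} (hμ : ∀ i, χ (-1) • μ i = μ i)
    (γ : CongruenceSubgroup.Gamma0 (p * N)) (i : ι) :
    symbHom he hS μ (gammaDiv γ (e i)) = dualAct hS (gammaSigma γ⁻¹) (μ i) := by
  rw [← freeBasis_toMoebius he, symbHom, Module.Basis.constr_basis]
  rcases gamma_eq_or_eq_mul_negOne (γ := liftMoebius (toMoebius γ)) (δ := γ)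
    (fun y => liftMoebius_smul _ y) with h | h
  · rw [h]
  · have hneg : (gammaNegOne (p * N))⁻¹ = gammaNegOne (p * N) := by
      rw [inv_eq_iff_mul_eq_one]
      refine Subtype.ext ?_
      change (-1 : Matrix.SpecialLinearGroup (Fin 2) ℤ) * -1 = 1
      simp
    rw [h, mul_inv_rev, hneg, gammaSigma_mul, dualAct_mul, dualAct_gammaNegOne, hμ]

/-- The symbol with given values `μ_i` at the `e_i`. -/
def mkSymb (hD : ∀ g, ∀ μ ∈ D, dualAct hS g μ ∈ D) (μ : ι → S →ₗ[R] R) (hμD : ∀ i, μ i ∈ D)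
    (hμ : ∀ i, χ (-1) • μ i = μ i) : Symb N hS D :=
  ⟨symbHom he hS μ, fun x => by
    have hx : x ∈ Submodule.span ℤ (Set.range (freeBasis he)) := by
      rw [Module.Basis.span_eq]
      trivial
    induction hx using Submodule.span_induction with
    | zero => rw [map_zero]; exact D.zero_mem
    | add x y _ _ hx hy => rw [map_add]; exact D.add_mem hx hy
    | smul c x _ hx => rw [map_smul]; exact zsmul_mem hx c
    | mem x hx =>
      obtain ⟨q, rfl⟩ := hx
      rw [freeBasis_apply, symbHom_gammaDiv he hμ]
      exact hD _ _ (hμD _), fun γ x => by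
    have h : (((dualAct hS (gammaSigma γ)).restrictScalars ℤ).comp (symbHom he hS μ)).comp
        (gammaDiv γ).toIntLinearMap = symbHom he hS μ := by
      refine (freeBasis he).ext fun q => ?_
      change dualAct hS (gammaSigma γ) (symbHom he hS μ (gammaDiv γ (freeBasis he q))) = _
      rw [freeBasis_apply, gammaDiv_mul, symbHom_gammaDiv he hμ, symbHom_gammaDiv he hμ,
        ← dualAct_mul, ← gammaSigma_mul, mul_inv_rev, inv_mul_cancel_right]
    exact LinearMap.congr_fun h x⟩

lemma mkSymb_apply (hD : ∀ g, ∀ μ ∈ D, dualAct hS g μ ∈ D) (μ : ι → S →ₗ[R] R)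
    (hμD : ∀ i, μ i ∈ D) (hμ : ∀ i, χ (-1) • μ i = μ i) (i : ι) :
    (mkSymb he hD μ hμD hμ).1 (e i) = μ i := by
  have h := symbHom_gammaDiv (hS := hS) he hμ 1 i
  rw [gammaDiv_one, inv_one, gammaSigma_one, dualAct_one] at h
  exact h

end FreeBasis

/-! ### Construction of `U_p` and its expression on the basis. -/

section HeckeOperator

variable {p : ℕ} [Fact p.Prime] {N : ℕ}

/-- The index `b` with `(1 a; 0 p) γ ∈ Γ₀(pN) (1 b; 0 p)`. -/
def heckeIndex (γ : CongruenceSubgroup.Gamma0 (p * N)) (a : ℕ) : ℕ :=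
  ((γ.1.1 1 1 * (γ.1.1 0 1 + a * γ.1.1 1 1)) % p).toNat

lemma heckeIndex_modEq (γ : CongruenceSubgroup.Gamma0 (p * N)) (a : ℕ) :
    (heckeIndex γ a : ℤ) ≡ γ.1.1 1 1 * (γ.1.1 0 1 + a * γ.1.1 1 1) [ZMOD p] := by
  have hp0 : (p : ℤ) ≠ 0 := mod_cast (Fact.out : p.Prime).ne_zero
  rw [heckeIndex, Int.toNat_of_nonneg (Int.emod_nonneg _ hp0)]
  exact Int.mod_modEq _ _

lemma heckeIndex_lt (γ : CongruenceSubgroup.Gamma0 (p * N)) (a : ℕ) : heckeIndex γ a < p := by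
  have hp0 : (0 : ℤ) < p := mod_cast (Fact.out : p.Prime).pos
  have h := Int.emod_lt_of_pos (γ.1.1 1 1 * (γ.1.1 0 1 + a * γ.1.1 1 1)) hp0
  have h2 := Int.emod_nonneg (γ.1.1 1 1 * (γ.1.1 0 1 + a * γ.1.1 1 1)) hp0.ne'
  unfold heckeIndex
  omega

lemma gamma0_det (γ : CongruenceSubgroup.Gamma0 (p * N)) :
    γ.1.1 0 0 * γ.1.1 1 1 - γ.1.1 0 1 * γ.1.1 1 0 = 1 := by
  rw [← Matrix.det_fin_two]
  exact γ.1.2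

lemma gamma0_dvd (γ : CongruenceSubgroup.Gamma0 (p * N)) : ((p * N : ℕ) : ℤ) ∣ γ.1.1 1 0 := by
  have h := γ.2
  rwa [CongruenceSubgroup.Gamma0_mem, ZMod.intCast_zmod_eq_zero_iff_dvd] at h

/-- Modulo `p` the index is an affine function of `a` with slope `D²`, where `D` is the lower right
entry of `γ` and is prime to `p`. So it permutes the residues, which is what makes `U_p φ`
equivariant. -/
lemma injOn_heckeIndex (γ : CongruenceSubgroup.Gamma0 (p * N)) :
    Set.InjOn (heckeIndex γ) (Finset.range p : Set ℕ) := by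
  have hp := Nat.prime_iff_prime_int.1 (Fact.out : p.Prime)
  intro a ha b hb hab
  simp only [Finset.coe_range, Set.mem_Iio] at ha hb
  have h1 := (heckeIndex_modEq γ a).symm.trans (hab ▸ heckeIndex_modEq γ b)
  have h2 := h1.dvd
  have h3 : (p : ℤ) ∣ γ.1.1 1 1 * (γ.1.1 1 1 * (b - a)) := by
    convert h2 using 1
    ring
  have hD : ¬ (p : ℤ) ∣ γ.1.1 1 1 := by
    intro hd
    have hc : (p : ℤ) ∣ γ.1.1 1 0 := dvd_trans ⟨N, by push_cast; rfl⟩ (gamma0_dvd γ)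
    refine hp.not_isUnit (isUnit_of_dvd_one ?_)
    rw [← gamma0_det γ]
    exact dvd_sub (hd.mul_left _) (hc.mul_left _)
  have h4 := (hp.dvd_or_dvd ((hp.dvd_or_dvd h3).resolve_left hD)).resolve_left hD
  have h5 := Int.eq_zero_of_abs_lt_dvd h4 (by rw [abs_lt]; omega)
  omega

/-- `(1 a; 0 p) γ = δ (1 b; 0 p)` with `δ ∈ Γ₀(pN)`, where `b` is the index `heckeIndex γ a`. -/
lemma exists_hecke_comm (γ : CongruenceSubgroup.Gamma0 (p * N)) (a : ℕ) :
    ∃ δ : CongruenceSubgroup.Gamma0 (p * N),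
      δ.1.1 0 0 = γ.1.1 0 0 + a * γ.1.1 1 0 ∧
      p * δ.1.1 0 1 = γ.1.1 0 1 + a * γ.1.1 1 1 - δ.1.1 0 0 * heckeIndex γ a ∧
      δ.1.1 1 0 = p * γ.1.1 1 0 ∧ δ.1.1 1 1 = γ.1.1 1 1 - γ.1.1 1 0 * heckeIndex γ a := by
  have hdet := gamma0_det γ
  obtain ⟨c, hc⟩ := gamma0_dvd γ
  obtain ⟨k, hk⟩ := (heckeIndex_modEq γ a).dvd
  set A := γ.1.1 0 0
  set B := γ.1.1 0 1
  set C := γ.1.1 1 0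
  set D := γ.1.1 1 1
  set b : ℤ := (heckeIndex γ a : ℤ)
  push_cast at hc
  -- `β` is the upper right entry of `δ`. It is integral because `C ≡ 0` and `A D ≡ 1` modulo `p`,
  -- so that `A b ≡ B + a D`.
  have hb : ∃ β, B + a * D - (A + a * C) * b = p * β := by
    refine ⟨-B * (N * c) * (B + a * D) - a * (N * c) * b + A * k, ?_⟩
    linear_combination (-(B + a * D)) * hdet + (-B * (B + a * D) - a * b) * hc + A * hk
  obtain ⟨β, hβ⟩ := hb
  refine ⟨⟨⟨!![A + a * C, β; p * C, D - C * b], ?_⟩, ?_⟩, ?_, ?_, ?_, ?_⟩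
  · rw [Matrix.det_fin_two_of]
    linear_combination hdet + C * hβ
  · exact CongruenceSubgroup.Gamma0_mem.2
      ((ZMod.intCast_zmod_eq_zero_iff_dvd _ _).2 ((gamma0_dvd γ).mul_left _))
  · simp
  · simp [hβ]
  · simp
  · simp

lemma exists_hecke_comm_smul (γ : CongruenceSubgroup.Gamma0 (p * N)) (a : ℕ) :
    ∃ δ : CongruenceSubgroup.Gamma0 (p * N),
      heckeSigma p a * gammaSigma γ = gammaSigma δ * heckeSigma p (heckeIndex γ a) ∧
      heckeGL p a * Matrix.SpecialLinearGroup.mapGL ℚ γ.1 =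
        Matrix.SpecialLinearGroup.mapGL ℚ δ.1 * heckeGL p (heckeIndex γ a) := by
  obtain ⟨δ, h00, h01, h10, h11⟩ := exists_hecke_comm γ a
  refine ⟨δ, Subtype.ext ?_, ?_⟩
  · have h00' := congrArg (Int.cast : ℤ → ℤ_[p]) h00
    have h01' := congrArg (Int.cast : ℤ → ℤ_[p]) h01
    have h10' := congrArg (Int.cast : ℤ → ℤ_[p]) h10
    have h11' := congrArg (Int.cast : ℤ → ℤ_[p]) h11
    push_cast at h00' h01' h10' h11'
    ext i j
    fin_cases i <;> fin_cases j <;>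
      simp [heckeSigma, gammaSigma, Matrix.mul_apply, Fin.sum_univ_two]
    · linear_combination -h00'
    · linear_combination -h01'
    · linear_combination -h10'
    · linear_combination -(heckeIndex γ a : ℤ_[p]) * h10' - (p : ℤ_[p]) * h11'
  · have h00' := congrArg (Int.cast : ℤ → ℚ) h00
    have h01' := congrArg (Int.cast : ℤ → ℚ) h01
    have h10' := congrArg (Int.cast : ℤ → ℚ) h10
    have h11' := congrArg (Int.cast : ℤ → ℚ) h11
    push_cast at h00' h01' h10' h11'
    ext i j
    fin_cases i <;> fin_cases j <;>
      simp [heckeGL, Matrix.GeneralLinearGroup.mkOfDetNeZero, Matrix.mul_apply, Fin.sum_univ_two]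
    · linear_combination -h00'
    · linear_combination -h01'
    · linear_combination -h10'
    · linear_combination -(heckeIndex γ a : ℚ) * h10' - (p : ℚ) * h11'

variable {R : Type*} [CommRing R] {χ : ℤ_[p]ˣ →* R} {S : Submodule R (ℤ_[p] → R)}
  {hS : IsStable χ S} {D : Submodule R (S →ₗ[R] R)}

lemma heckeDiv_gammaDiv (hpN : p.Coprime N) {γ δ : CongruenceSubgroup.Gamma0 (p * N)} {a b : ℕ}
    (h : heckeGL p a * Matrix.SpecialLinearGroup.mapGL ℚ γ.1 =
        Matrix.SpecialLinearGroup.mapGL ℚ δ.1 * heckeGL p b) (x : degZeroDiv (cuspSet N)) :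
    heckeDiv hpN a (gammaDiv γ x) = gammaDiv δ (heckeDiv hpN b x) := by
  refine Subtype.ext ?_
  rw [coe_divAct, coe_divAct, coe_divAct, coe_divAct, ← Finsupp.mapDomain_comp,
    ← Finsupp.mapDomain_comp]
  congr 1
  ext1 y
  simp only [Function.comp_apply, ← mul_smul, h]

/-- The operator `U_p` on `Symb_{Γ,C}(D)`. -/
def heckeU (hpN : p.Coprime N) (hS : IsStable χ S) (D : Submodule R (S →ₗ[R] R))
    (hD : ∀ g, ∀ μ ∈ D, dualAct hS g μ ∈ D) : Symb N hS D →ₗ[R] Symb N hS D where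
  toFun φ := ⟨∑ a ∈ Finset.range p, (((dualAct hS (heckeSigma p a)).restrictScalars ℤ).comp
      φ.1).comp (heckeDiv hpN a).toIntLinearMap, fun x => by
    rw [LinearMap.sum_apply]
    exact sum_mem fun a _ => hD _ _ (φ.2.1 _), fun γ x => by
    simp only [LinearMap.sum_apply, LinearMap.comp_apply, LinearMap.coe_restrictScalars,
      AddMonoidHom.coe_toIntLinearMap, map_sum]
    -- Moving `γ` across `γ_a` replaces `a` by its index, a permutation of the terms.
    refine Finset.sum_nbij (heckeIndex γ) (fun a _ => Finset.mem_range.2 (heckeIndex_lt γ a))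
      (injOn_heckeIndex γ) (Finset.surjOn_of_injOn_of_card_le _
        (fun a _ => by simpa using heckeIndex_lt γ a) (injOn_heckeIndex γ) le_rfl) fun a _ => ?_
    obtain ⟨δ, h1, h2⟩ := exists_hecke_comm_smul γ a
    rw [← dualAct_mul, h1, heckeDiv_gammaDiv hpN h2, dualAct_mul]
    congr 1
    exact φ.2.2 δ _⟩
  map_add' φ ψ := Subtype.ext (LinearMap.ext fun x => by
    simp [Finset.sum_add_distrib])
  map_smul' r φ := Subtype.ext (LinearMap.ext fun x => by
    simp [Finset.smul_sum])

lemma isUp_heckeU (hpN : p.Coprime N) (hD : ∀ g, ∀ μ ∈ D, dualAct hS g μ ∈ D) :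
    IsUp hpN hS D (heckeU hpN hS D hD) := by
  intro φ x
  simp [heckeU]

variable {ι : Type*} {e : ι → degZeroDiv (cuspSet N)} (he : IsFreeBasis (cuspSet N) (p * N) e)

/-- The index set of the terms of `∑_a γ_a e_i = ∑ n σ e_j`. -/
def heckeSupp (hpN : p.Coprime N) (i : ι) : Finset (ℕ × (moebiusGamma0 (p * N) × ι)) :=
  open Classical in
  Finset.range p ×ˢ (Finset.range p).biUnion fun a =>
    ((freeBasis he).repr (heckeDiv hpN a (e i))).support

/-- The coefficient of `σ e_j` in `γ_a e_i`. -/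
def heckeCoeff (hpN : p.Coprime N) (i : ι) (k : ℕ × (moebiusGamma0 (p * N) × ι)) : ℤ :=
  (freeBasis he).repr (heckeDiv hpN k.1 (e i)) k.2

/-- The element `σ⁻¹ γ_a` of `Σ₀(p)`. -/
def heckeElt (k : ℕ × (moebiusGamma0 (p * N) × ι)) : Sigma0 p :=
  gammaSigma (liftMoebius k.2.1)⁻¹ * heckeSigma p k.1

/-- The lower left entry of `σ⁻¹` is divisible by `p` and the second column of `γ_a` is `(a, p)`.
This divisibility, on top of the one in `Σ₀(p)`, is the hypothesis of all the contraction estimates.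
-/
lemma heckeElt_dvd (k : ℕ × (moebiusGamma0 (p * N) × ι)) :
    (p : ℤ_[p]) ∣ (heckeElt k).1 1 1 := by
  have h := (gammaSigma (liftMoebius k.2.1)⁻¹).2.2.1
  have e : (heckeElt k).1 1 1 = (gammaSigma (liftMoebius k.2.1)⁻¹).1 1 0 * (k.1 : ℤ_[p]) +
      (gammaSigma (liftMoebius k.2.1)⁻¹).1 1 1 * p := by
    simp [heckeElt, heckeSigma, Matrix.mul_apply, Fin.sum_univ_two]
  rw [e]
  exact dvd_add (h.mul_right _) (dvd_mul_left _ _)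

/-- The values of `U φ` at the `e_i` in terms of those of `φ`. -/
lemma IsUp.apply_basis {hpN : p.Coprime N} {U : Symb N hS D →ₗ[R] Symb N hS D}
    (hU : IsUp hpN hS D U) (φ : Symb N hS D) (i : ι) :
    (U φ).1 (e i) = ∑ k ∈ heckeSupp he hpN i,
      heckeCoeff he hpN i k • dualAct hS (heckeElt k) (φ.1 (e k.2.2)) := by
  classical
  rw [hU, heckeSupp, Finset.sum_product]
  refine Finset.sum_congr rfl fun a ha => ?_
  have h1 : heckeDiv hpN a (e i) = ∑ q ∈ (Finset.range p).biUnion fun a =>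
      ((freeBasis he).repr (heckeDiv hpN a (e i))).support,
      (freeBasis he).repr (heckeDiv hpN a (e i)) q • freeBasis he q := by
    conv_lhs => rw [← (freeBasis he).linearCombination_repr (heckeDiv hpN a (e i))]
    rw [Finsupp.linearCombination_apply]
    exact Finsupp.sum_of_support_subset _ (Finset.subset_biUnion_of_mem
      (fun a => ((freeBasis he).repr (heckeDiv hpN a (e i))).support) ha) _ (by simp)
  change dualAct hS (heckeSigma p a) (φ.1 (heckeDiv hpN a (e i))) = _
  conv_lhs => rw [h1]
  rw [map_sum, map_sum]
  refine Finset.sum_congr rfl fun q _ => ?_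
  rw [map_zsmul, map_zsmul, freeBasis_apply, Symb.apply_gammaDiv φ, ← dualAct_mul]
  rfl

end HeckeOperator

/-! ### Reverse characteristic polynomials as sums of principal minors. -/

section PrincipalMinors

variable {R : Type*} [CommRing R]

/-- The principal minor of an infinite matrix with the rows and columns in `S`. -/
def principalMinor (P : ℕ → ℕ → R) (S : Finset ℕ) : R :=
  (Matrix.of fun i j : S => P i j).det

lemma principalMinor_map_valEmbedding (P : ℕ → ℕ → R) {n : ℕ} (S : Finset (Fin n)) :
    principalMinor P (S.map Fin.valEmbedding) =
      ((Matrix.of fun i j : Fin n => P i j).submatrix (Subtype.val : S → Fin n) Subtype.val).det := by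
  have hb : Function.Bijective fun i : S =>
      (⟨i.1.1, Finset.mem_map_of_mem Fin.valEmbedding i.2⟩ : S.map Fin.valEmbedding) := by
    refine ⟨fun i j h => Subtype.ext (Fin.ext (congrArg Subtype.val h)), fun ⟨j, hj⟩ => ?_⟩
    obtain ⟨i, hi, rfl⟩ := Finset.mem_map.1 hj
    exact ⟨⟨i, hi⟩, rfl⟩
  rw [principalMinor, ← Matrix.det_submatrix_equiv_self (Equiv.ofBijective _ hb)]
  rfl

/-- Writing the coefficients with principal minors makes truncations nested: passing from `n` to `n
+ 1` only adds terms, so the limit in `n` becomes an infinite sum over finite sets. -/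
lemma coeff_charpolyRev (P : ℕ → ℕ → R) (n k : ℕ) :
    (Matrix.of fun i j : Fin n => P i j).charpolyRev.coeff k =
      ∑ S ∈ (Finset.range n).powersetCard k, (-1) ^ k * principalMinor P S := by
  set M : Matrix (Fin n) (Fin n) R := Matrix.of fun i j : Fin n => P i j with hM
  have h1 : M.charpolyRev =
      (1 + (Polynomial.X : Polynomial R) • (-M).map Polynomial.C).det := by
    simp only [Matrix.charpolyRev, sub_eq_add_neg]
    congr 2
    rw [Matrix.map_neg Polynomial.C (map_neg Polynomial.C) M, smul_neg]
  have h2 : Finset.range n = Finset.univ.map (Fin.valEmbedding (n := n)) := by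
    ext i
    simp only [Finset.mem_range, Finset.mem_map, Finset.mem_univ, true_and]
    exact ⟨fun h => ⟨⟨i, h⟩, rfl⟩, by rintro ⟨j, rfl⟩; exact j.2⟩
  rw [h1, Matrix.coeff_det_one_add_X_smul_eq_sum_minors, h2, Finset.powersetCard_map,
    Finset.sum_map]
  refine Finset.sum_congr rfl fun S hS => ?_
  change _ = (-1) ^ k * principalMinor P (S.map Fin.valEmbedding)
  rw [principalMinor_map_valEmbedding]
  simp only [Matrix.submatrix_neg, Pi.neg_apply, Matrix.det_neg, Fintype.card_coe,
    (Finset.mem_powersetCard.1 hS).2]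
  rfl

lemma coeff_charpolyRev_map {R' : Type*} [CommRing R'] (κ : R →+* R') (P : ℕ → ℕ → R) (n k : ℕ) :
    (Matrix.of fun i j : Fin n => κ (P i j)).charpolyRev.coeff k =
      κ ((Matrix.of fun i j : Fin n => P i j).charpolyRev.coeff k) := by
  rw [coeff_charpolyRev (fun i j => κ (P i j)), coeff_charpolyRev, map_sum]
  refine Finset.sum_congr rfl fun S _ => ?_
  rw [map_mul, map_pow, map_neg, map_one, principalMinor, principalMinor, RingHom.map_det]
  rfl

/-- In the term of a permutation `σ` the exponents `u i - v (σ i)` add up to `∑ u - ∑ v`,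
independently of `σ`; truncation of the subtraction can only increase the total. -/
lemma principalMinor_mem {I : Ideal R} {P : ℕ → ℕ → R} {u v : ℕ → ℕ} (huv : ∀ i, v i ≤ u i)
    (h : ∀ i j, P i j ∈ I ^ (u j - v i)) (S : Finset ℕ) :
    principalMinor P S ∈ I ^ (∑ i ∈ S, (u i - v i)) := by
  rw [principalMinor, Matrix.det_apply]
  refine sum_mem fun σ _ => ?_
  rw [Units.smul_def]
  refine zsmul_mem ?_ _
  have h1 : ∏ i, Matrix.of (fun i j : S => P i j) (σ i) i ∈ I ^ (∑ i : S, (u i - v (σ i))) := by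
    rw [← Finset.prod_pow_eq_pow_sum]
    exact Ideal.prod_mem_prod fun i _ => h _ _
  refine Ideal.pow_le_pow_right ?_ h1
  have h2 : ∑ i : S, v (σ i) = ∑ i : S, v i := Equiv.sum_comp σ fun i : S => v i
  have h3 : ∑ i : S, u i ≤ ∑ i : S, (u i - v (σ i)) + ∑ i : S, v (σ i) := by
    rw [← Finset.sum_add_distrib]
    exact Finset.sum_le_sum fun i _ => by omega
  have h4 : ∑ i : S, u i = ∑ i ∈ S, (u i - v i) + ∑ i : S, v i := by
    rw [← Finset.sum_coe_sort S fun i => u i - v i, ← Finset.sum_add_distrib]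
    exact Finset.sum_congr rfl fun i _ => by have := huv i; omega
  omega

end PrincipalMinors

/-! ### The combinatorics of the lower bound `λ`. -/

section WeightFunction

/-- The number `⌊i/d⌋ - ⌊i/(pd)⌋`. -/
def jump (p d i : ℕ) : ℕ := i / d - i / (d * p)

/-- The quantity is `a - ⌊a/p⌋` with `a = ⌊i/d⌋`, and `⌊a/p⌋` increases by at most one when `a`
does. -/
lemma jump_mono {p : ℕ} (hp : 0 < p) (d : ℕ) : Monotone (jump p d) := by
  intro i j hij
  have key : Monotone fun a : ℕ => a - a / p := by
    refine monotone_nat_of_le_succ fun a => ?_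
    have h : (a + 1) / p ≤ a / p + 1 := by
      rw [← Nat.add_div_right _ hp]
      exact Nat.div_le_div_right (by omega)
    omega
  have := key (Nat.div_le_div_right (c := d) hij)
  simp only [Nat.div_div_eq_div_mul] at this
  exact this

/-- A crude bound, by half of `⌊i/d⌋`, enough for convergence. -/
lemma le_jump {p d i j : ℕ} (hp : 2 ≤ p) (hd : 0 < d) (h : 2 * j * d ≤ i) : j ≤ jump p d i := by
  have h1 : 2 * j ≤ i / d := (Nat.le_div_iff_mul_le hd).2 h
  have h2 : i / d / p ≤ i / d / 2 := Nat.div_le_div_left hp two_pos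
  rw [jump, ← Nat.div_div_eq_div_mul]
  omega

lemma lowerBound_succ (p t n : ℕ) :
    lowerBound p t (n + 1) = lowerBound p t n + jump p ((p + 1) * t) n := by
  rw [jump, mul_comm _ p]
  rfl

/-- A set with `n + 1` elements has maximum at least `n`; removing the maximum and using
monotonicity shows that `{0, …, n}` minimizes the sum. -/
lemma lowerBound_le_sum {p : ℕ} (hp : 0 < p) (t : ℕ) {n : ℕ} {S : Finset ℕ} (hS : S.card = n) :
    lowerBound p t n ≤ ∑ i ∈ S, jump p ((p + 1) * t) i := by
  induction n generalizing S with
  | zero => exact Nat.zero_le _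
  | succ n ih =>
    have hne : S.Nonempty := Finset.card_pos.1 (by omega)
    have h1 := Finset.max'_mem S hne
    have h2 : (S.erase (S.max' hne)).card = n := by rw [Finset.card_erase_of_mem h1]; omega
    have h3 : n ≤ S.max' hne := by
      have : S ⊆ Finset.range (S.max' hne + 1) := fun i hi =>
        Finset.mem_range.2 (Nat.lt_succ_of_le (S.le_max' i hi))
      have := Finset.card_le_card this
      rw [Finset.card_range] at this
      omega
    rw [lowerBound_succ, ← Finset.sum_erase_add _ _ h1]
    exact add_le_add (ih h2) (jump_mono hp _ h3)

end WeightFunction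

/-! ### Convergence of the characteristic series and divisibility of its coefficients. -/

section LimitCharSeries

variable {p : ℕ} [Fact p.Prime]

/-- The estimate for the entries of the matrix of `U_p` in the Mahler basis. -/
def IsHaloMatrix (d : ℕ) (P : ℕ → ℕ → Iwasawa p) : Prop :=
  ∀ i j, P i j ∈ maxId p ^ (j / d - i / (d * p))

lemma IsHaloMatrix.principalMinor_mem {d : ℕ} {P : ℕ → ℕ → Iwasawa p} (h : IsHaloMatrix d P)
    (S : Finset ℕ) : principalMinor P S ∈ maxId p ^ (∑ i ∈ S, jump p d i) :=
  Halo.principalMinor_mem (u := fun i => i / d) (v := fun i => i / (d * p))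
    (fun i => by
      rw [← Nat.div_div_eq_div_mul]
      exact Nat.div_le_self _ _) h S

/-- The terms of the series for the `k`-th coefficient of the characteristic power series. -/
def minorTerm (P : ℕ → ℕ → Iwasawa p) (k : ℕ) (S : Finset ℕ) : Iwasawa p :=
  if S.card = k then (-1) ^ k * principalMinor P S else 0

/-- A set containing some `i ≥ 2jd` has its minor in `(p, T)^j`, so up to any precision only the
subsets of a finite range matter. -/
lemma IsHaloMatrix.summable_minorTerm (hp2 : p ≠ 2) {d : ℕ} (hd : 0 < d) {P : ℕ → ℕ → Iwasawa p}
    (h : IsHaloMatrix d P) (k : ℕ) : Summable (minorTerm P k) := by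
  refine summable_iwasawa fun m => ?_
  obtain ⟨j, hj⟩ := exists_maxId_pow_le (p := p) hp2 m
  rw [Filter.eventually_cofinite]
  refine (Finset.range (2 * j * d)).powerset.finite_toSet.subset fun S hS => ?_
  rw [Finset.mem_coe, Finset.mem_powerset]
  intro i hi
  by_contra hij
  refine hS ?_
  rw [minorTerm]
  split_ifs with hk
  · refine Ideal.mul_mem_left _ _ (hj (Ideal.pow_le_pow_right ?_ (h.principalMinor_mem S)))
    refine (le_jump (Fact.out : p.Prime).two_le hd ?_).trans
      (Finset.single_le_sum (f := jump p d) (fun _ _ => Nat.zero_le _) hi)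
    exact not_lt.1 fun h => hij (Finset.mem_range.2 h)
  · exact zero_mem _

lemma sum_minorTerm (P : ℕ → ℕ → Iwasawa p) (k n : ℕ) :
    ∑ S ∈ (Finset.range n).powerset, minorTerm P k S =
      (Matrix.of fun i j : Fin n => P i j).charpolyRev.coeff k := by
  rw [coeff_charpolyRev, Finset.powersetCard_eq_filter, Finset.sum_filter]
  rfl

/-- The characteristic power series of `P`. -/
def charSeries (P : ℕ → ℕ → Iwasawa p) : PowerSeries (Iwasawa p) :=
  PowerSeries.mk fun k => ∑' S, minorTerm P k S

lemma tendsto_powerset_range : Tendsto (fun n => (Finset.range n).powerset) atTop atTop := by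
  refine tendsto_atTop_finset_of_monotone
    (fun m n h => Finset.powerset_mono.2 (Finset.range_mono h)) fun S => ?_
  obtain ⟨n, hn⟩ := S.exists_nat_subset_range
  exact ⟨n, Finset.mem_powerset.2 hn⟩

lemma IsHaloMatrix.isLimitCharSeries (hp2 : p ≠ 2) {d : ℕ} (hd : 0 < d) {P : ℕ → ℕ → Iwasawa p}
    (h : IsHaloMatrix d P) : IsLimitCharSeries P (charSeries P) := by
  intro k
  rw [charSeries, PowerSeries.coeff_mk]
  refine ((h.summable_minorTerm hp2 hd k).hasSum.comp tendsto_powerset_range).congr fun n => ?_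
  exact sum_minorTerm P k n

lemma IsLimitCharSeries.unique {P : ℕ → ℕ → Iwasawa p} {F G : PowerSeries (Iwasawa p)}
    (hF : IsLimitCharSeries P F) (hG : IsLimitCharSeries P G) : F = G :=
  PowerSeries.ext fun k => tendsto_nhds_unique (hF k) (hG k)

/-- Each finite truncation satisfies the bound, and `(p, T)^λ(n)` is closed. -/
lemma IsLimitCharSeries.coeff_mem {t : ℕ} {P : ℕ → ℕ → Iwasawa p} {F : PowerSeries (Iwasawa p)}
    (hF : IsLimitCharSeries P F) (h : IsHaloMatrix ((p + 1) * t) P) (n : ℕ) :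
    PowerSeries.coeff n F ∈ maxId p ^ lowerBound p t n := by
  refine (isClosed_maxId_pow _).mem_of_tendsto (hF n) (Eventually.of_forall fun k => ?_)
  rw [coeff_charpolyRev]
  refine sum_mem fun S hS => Ideal.mul_mem_left _ _ (Ideal.pow_le_pow_right ?_
    (h.principalMinor_mem S))
  exact lowerBound_le_sum (Fact.out : p.Prime).pos t (Finset.mem_powersetCard.1 hS).2

/-- The relation `p = T Y` makes the ideal generated by `p` and `T` principal in `Λ^{>1/p}`. -/
lemma map_toHalo_maxId : (maxId p).map (toHalo p) ≤ Ideal.span {toHalo p (paramT p)} := by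
  rw [maxId, Ideal.map_span, Ideal.span_le]
  rintro _ ⟨x, rfl | rfl, rfl⟩
  · refine Ideal.mem_span_singleton.2 ⟨Ideal.Quotient.mk _ PowerSeries.X, ?_⟩
    have h : Ideal.Quotient.mk (Ideal.span
        {PowerSeries.C (paramT p) * PowerSeries.X - (p : PowerSeries (Iwasawa p))})
        (PowerSeries.C (paramT p) * PowerSeries.X - (p : PowerSeries (Iwasawa p))) = 0 :=
      Ideal.Quotient.eq_zero_iff_mem.2 (Ideal.subset_span rfl)
    rw [map_sub, map_mul, sub_eq_zero, map_natCast] at h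
    rw [map_natCast]
    exact h.symm
  · exact Ideal.subset_span rfl

lemma toHalo_mem {x : Iwasawa p} {k : ℕ} (h : x ∈ maxId p ^ k) :
    toHalo p x ∈ Ideal.span {toHalo p (paramT p) ^ k} := by
  have h1 := Ideal.mem_map_of_mem (toHalo p) h
  rw [Ideal.map_pow] at h1
  rw [← Ideal.span_singleton_pow]
  exact Ideal.pow_right_mono map_toHalo_maxId k h1

end LimitCharSeries

/-! ### Positivity of the rank. -/

section Rank

/-- The points of `Γ₀(N)·∞` other than `∞` are `A/C` in lowest terms with `N ∣ C`. If `A = u C`,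
then `N` divides the determinant `1`. Hence all integers lie in `C`, and `(0) - (1)` is a nonzero
element of `Δ_C⁰`. -/
lemma mapGL_smul_infty_ne {N : ℕ} (hN : 1 < N) {γ : Matrix.SpecialLinearGroup (Fin 2) ℤ}
    (hγ : γ ∈ CongruenceSubgroup.Gamma0 N) {u : ℤ} :
    Matrix.SpecialLinearGroup.mapGL ℚ γ • (OnePoint.infty : OnePoint ℚ) ≠ ((u : ℚ) : OnePoint ℚ) := by
  intro h
  rw [CongruenceSubgroup.Gamma0_mem, ZMod.intCast_zmod_eq_zero_iff_dvd] at hγ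
  have hdet : γ.1 0 0 * γ.1 1 1 - γ.1 0 1 * γ.1 1 0 = 1 := by
    rw [← Matrix.det_fin_two]; exact γ.2
  rw [OnePoint.smul_infty_eq_ite] at h
  have e1 : (Matrix.SpecialLinearGroup.mapGL ℚ γ) 1 0 = (γ.1 1 0 : ℚ) := by simp
  have e0 : (Matrix.SpecialLinearGroup.mapGL ℚ γ) 0 0 = (γ.1 0 0 : ℚ) := by simp
  rw [e1, e0] at h
  split_ifs at h with h0
  · exact OnePoint.infty_ne_coe _ h
  · rw [OnePoint.coe_eq_coe, div_eq_iff h0] at h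
    have h' : γ.1 0 0 = u * γ.1 1 0 := mod_cast h
    have h2 : (N : ℤ) ∣ 1 := by
      rw [← hdet, h']
      exact dvd_sub ((hγ.mul_left _).mul_right _) (hγ.mul_left _)
    have h3 := Int.le_of_dvd one_pos h2
    omega

lemma degZeroDiv_cuspSet_ne_bot {N : ℕ} (hN : 1 < N) : degZeroDiv (cuspSet N) ≠ ⊥ := by
  classical
  intro h
  have hmem : ∀ u : ℤ, ((u : ℚ) : OnePoint ℚ) ∈ cuspSet N := fun u γ hγ =>
    mapGL_smul_infty_ne hN hγ
  set x : OnePoint ℚ := (((0 : ℤ) : ℚ) : OnePoint ℚ) with hx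
  set y : OnePoint ℚ := (((1 : ℤ) : ℚ) : OnePoint ℚ) with hy
  have hxy : x ≠ y := by
    rw [hx, hy, Ne, OnePoint.coe_eq_coe]
    norm_num
  have hD : Finsupp.single x (1 : ℤ) - Finsupp.single y 1 ∈ degZeroDiv (cuspSet N) := by
    refine ⟨fun z hz => ?_, ?_⟩
    · rcases Finset.mem_union.1 (Finsupp.support_sub hz) with h | h
      · rw [Finset.mem_singleton.1 (Finsupp.support_single_subset h)]
        exact hmem 0
      · rw [Finset.mem_singleton.1 (Finsupp.support_single_subset h)]
        exact hmem 1
    · rw [Finsupp.sum_sub_index (by simp)]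
      simp
  rw [h, AddSubgroup.mem_bot] at hD
  have := DFunLike.congr_fun hD x
  simp [hxy.symm] at this

lemma IsFreeBasis.pos {N M d : ℕ} (hN : 1 < N) {e : Fin d → degZeroDiv (cuspSet N)}
    (he : IsFreeBasis (cuspSet N) M e) : 0 < d := by
  rcases Nat.eq_zero_or_pos d with rfl | h
  · refine absurd ?_ (degZeroDiv_cuspSet_ne_bot hN)
    rw [← he.2, Set.range_eq_empty, AddSubgroup.closure_empty]
  · exact h

end Rank

/-! ### The matrix of `U_p` on `Symb(D^int)`: construction, estimate, uniqueness. -/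

section UpMatrix

variable {p : ℕ} [Fact p.Prime]

lemma two_mul_inverse (hp2 : p ≠ 2) : 2 * Ring.inverse (2 : ℤ_[p]) = 1 := by
  refine Ring.mul_inverse_cancel _ (PadicInt.isUnit_iff.2 ?_)
  have h : ¬ (p : ℤ) ∣ 2 := by
    have := (Fact.out : p.Prime).two_le
    intro h
    have := Int.le_of_dvd two_pos h
    omega
  have h2 := PadicInt.norm_int_lt_one_iff_dvd (p := p) 2
  have h3 := PadicInt.norm_le_one (2 : ℤ_[p])
  push_cast at h2
  exact le_antisymm h3 (not_lt.1 fun h4 => h (h2.1 h4))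

variable (p) in
/-- The idempotent `(1 + [-1])/2` of `Λ`. -/
def projPlus : Iwasawa p := algebraMap ℤ_[p] _ (Ring.inverse 2) * (1 + univChar (-1))

lemma univChar_neg_one_mul_projPlus : univChar (-1) * projPlus p = projPlus p := by
  have h : univChar (-1 : ℤ_[p]ˣ) * univChar (-1 : ℤ_[p]ˣ) = 1 := by
    rw [← map_mul, neg_mul_neg, one_mul, map_one]
  rw [projPlus]
  linear_combination (algebraMap ℤ_[p] (Iwasawa p) (Ring.inverse 2)) * h

lemma map_projPlus_smul (hp2 : p ≠ 2) {R M : Type*} [CommRing R] [AddCommGroup M] [Module R M]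
    (κ : Iwasawa p →+* R) {x : M} (h : κ (univChar (-1)) • x = x) : κ (projPlus p) • x = x := by
  have h2 : κ (algebraMap ℤ_[p] (Iwasawa p) (Ring.inverse 2)) * 2 = 1 := by
    have := congrArg (fun z => κ (algebraMap ℤ_[p] (Iwasawa p) z)) (two_mul_inverse hp2)
    rwa [map_mul, map_mul, map_ofNat, map_ofNat, map_one, map_one, mul_comm] at this
  rw [projPlus, map_mul, map_add, map_one, mul_smul, add_smul, h, one_smul, ← two_smul R x,
    smul_smul, h2, one_smul]

lemma projPlus_mul (hp2 : p ≠ 2) {x : Iwasawa p} (h : univChar (-1) * x = x) :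
    projPlus p * x = x :=
  map_projPlus_smul hp2 (RingHom.id _) h

variable {N d : ℕ} {e : Fin d → degZeroDiv (cuspSet N)}

section Entry

variable (he : IsFreeBasis (cuspSet N) (p * N) e) (hpN : p.Coprime N)

/-- The coefficient of `δ_j^[n]` in the `δ_i^[m]`-coordinate of `U_p`. -/
def upEntry (m : ℕ) (i : Fin d) (n : ℕ) (j : Fin d) : Iwasawa p :=
  projPlus p * ∑ k ∈ heckeSupp he hpN i, if k.2.2 = j then heckeCoeff he hpN i k •
    (fwdDiff (1 : ℤ_[p]))^[n] (weightAct univChar (heckeElt k) (mahlerFun m).1) 0 else 0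

lemma upEntry_mem (hp2 : p ≠ 2) (m : ℕ) (i : Fin d) (n : ℕ) (j : Fin d) :
    upEntry he hpN m i n j ∈ maxId p ^ (n - m / p) := by
  refine Ideal.mul_mem_left _ _ (sum_mem fun k _ => ?_)
  split_ifs
  · exact zsmul_mem (fwdDiff_weightAct_mahler_mem hp2 _ (heckeElt_dvd k) m n 0) _
  · exact zero_mem _

lemma upEntry_mul (m : ℕ) (i : Fin d) (n : ℕ) (j : Fin d) {x : Iwasawa p}
    (hx : projPlus p * x = x) : upEntry he hpN m i n j * x =
      ∑ k ∈ heckeSupp he hpN i, if k.2.2 = j then heckeCoeff he hpN i k • (x *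
        (fwdDiff (1 : ℤ_[p]))^[n] (weightAct univChar (heckeElt k) (mahlerFun m).1) 0) else 0 := by
  rw [upEntry, mul_right_comm, hx, Finset.mul_sum]
  refine Finset.sum_congr rfl fun k _ => ?_
  rw [mul_ite, mul_zero, mul_smul_comm]

variable [NeZero d]

/-- The matrix of `U_p` in the Mahler basis. -/
def upMatrix (k k' : ℕ) : Iwasawa p :=
  upEntry he hpN (k / d) (Fin.ofNat d k) (k' / d) (Fin.ofNat d k')

lemma mul_add_div_fin (m : ℕ) (i : Fin d) : (m * d + i) / d = m := by
  rw [mul_comm, Nat.mul_add_div (Nat.pos_of_ne_zero (NeZero.ne d)), Nat.div_eq_of_lt i.2, add_zero]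

lemma ofNat_mul_add_fin (m : ℕ) (i : Fin d) : Fin.ofNat d (m * d + i) = i := by
  refine Fin.ext ?_
  rw [Fin.val_ofNat, add_comm, Nat.add_mul_mod_self_right, Nat.mod_eq_of_lt i.2]

lemma div_mul_add_ofNat (k : ℕ) : k / d * d + Fin.ofNat d k = k := by
  rw [Fin.val_ofNat, Nat.div_add_mod']

lemma upMatrix_mul_add (m : ℕ) (i : Fin d) (n : ℕ) (j : Fin d) :
    upMatrix he hpN (m * d + i) (n * d + j) = upEntry he hpN m i n j := by
  rw [upMatrix, mul_add_div_fin, mul_add_div_fin, ofNat_mul_add_fin, ofNat_mul_add_fin]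

lemma isHaloMatrix_upMatrix (hp2 : p ≠ 2) : IsHaloMatrix d (upMatrix he hpN) := by
  intro i j
  rw [← Nat.div_div_eq_div_mul]
  exact upEntry_mem he hpN hp2 _ _ _ _

end Entry

lemma evalMap_injective (he : IsFreeBasis (cuspSet N) (p * N) e) :
    Function.Injective (evalMap (p := p) e) := fun _ _ h =>
  Symb.ext_of_basis he fun i => congrArg Subtype.val (congrFun h i)

lemma range_evalMap (he : IsFreeBasis (cuspSet N) (p * N) e) :
    Set.range (evalMap (p := p) e) =
      {μ | ∀ i, univChar (-1 : ℤ_[p]ˣ) • (μ i).1 = (μ i).1} := by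
  refine Set.Subset.antisymm ?_ fun μ hμ => ?_
  · rintro _ ⟨φ, rfl⟩ i
    exact Symb.neg_one_smul φ (e i)
  · refine ⟨mkSymb he (fun g μ => dualAct_mem_Dint g) (fun i => (μ i).1) (fun i => (μ i).2) hμ,
      funext fun i => Subtype.ext ?_⟩
    exact mkSymb_apply he _ (fun i => (μ i).1) _ _ i

/-- The symbol whose value at `e_j` is the projection of `δ^[n]` and which is zero at the other
basis elements. -/
def deltaSymb (he : IsFreeBasis (cuspSet N) (p * N) e) (n : ℕ) (j : Fin d) :
    Symb N (isStable_contFun (p := p)) (Dint p) :=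
  mkSymb he (fun g μ => dualAct_mem_Dint g)
    (fun i => if i = j then projPlus p • sumDelta (Pi.single n 1) else 0)
    (fun i => by
      split_ifs
      · exact Submodule.smul_mem _ _ (sumDelta_mem _)
      · exact zero_mem _)
    (fun i => by
      split_ifs
      · rw [smul_smul, univChar_neg_one_mul_projPlus]
      · rw [smul_zero])

lemma deltaSymb_apply (he : IsFreeBasis (cuspSet N) (p * N) e) (n : ℕ) (j : Fin d) (q : ℕ × Fin d) :
    (evalMap e (deltaSymb he n j) q.2).1 (mahlerFun q.1) = if q = (n, j) then projPlus p else 0 := by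
  have h := mkSymb_apply (hS := isStable_contFun (p := p)) he (fun g μ => dualAct_mem_Dint g)
    (fun i => if i = j then projPlus p • sumDelta (Pi.single n 1) else 0)
    (fun i => by
      split_ifs
      · exact Submodule.smul_mem _ _ (sumDelta_mem _)
      · exact zero_mem _)
    (fun i => by
      split_ifs
      · rw [smul_smul, univChar_neg_one_mul_projPlus]
      · rw [smul_zero]) q.2
  change (deltaSymb he n j).1 (e q.2) _ = _
  rw [deltaSymb, h]
  obtain ⟨m, i⟩ := q
  by_cases hi : i = j
  · by_cases hm : m = n
    · simp [hi, hm, sumDelta_mahlerFun]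
    · simp [hi, hm, sumDelta_mahlerFun]
  · simp [hi]

/-- The symbol `deltaSymb he n j` has the single nonzero coordinate `projPlus p`, so it reads off
one column of `P`; this idempotent fixes the entries since `[-1]` does. Uniqueness of the matrix
follows. -/
lemma IsMahlerMatrix.apply_eq (hp2 : p ≠ 2) (he : IsFreeBasis (cuspSet N) (p * N) e)
    {U : Symb N (isStable_contFun (p := p)) (Dint p) →ₗ[Iwasawa p]
      Symb N (isStable_contFun (p := p)) (Dint p)} {P : ℕ → ℕ → Iwasawa p}
    (hP : IsMahlerMatrix e U P) (m : ℕ) (i : Fin d) (n : ℕ) (j : Fin d) :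
    P (m * d + i) (n * d + j) = (evalMap e (U (deltaSymb he n j)) i).1 (mahlerFun m) := by
  have h := hP.1 (deltaSymb he n j) m i
  have h2 := hasSum_ite_eq (n, j) (P (m * d + i) (n * d + j))
  refine HasSum.unique (hasSum_of_forall_eq h2 fun q => ?_) h
  rw [deltaSymb_apply]
  split_ifs with hq
  · subst hq
    rw [mul_comm, projPlus_mul hp2 (hP.2 _ _)]
  · rw [mul_zero]

lemma IsMahlerMatrix.unique [NeZero d] (hp2 : p ≠ 2) (he : IsFreeBasis (cuspSet N) (p * N) e)
    {U : Symb N (isStable_contFun (p := p)) (Dint p) →ₗ[Iwasawa p]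
      Symb N (isStable_contFun (p := p)) (Dint p)} {P Q : ℕ → ℕ → Iwasawa p}
    (hP : IsMahlerMatrix e U P) (hQ : IsMahlerMatrix e U Q) : P = Q := by
  ext k k'
  have h1 := hP.apply_eq hp2 he (k / d) (Fin.ofNat d k) (k' / d) (Fin.ofNat d k')
  have h2 := hQ.apply_eq hp2 he (k / d) (Fin.ofNat d k) (k' / d) (Fin.ofNat d k')
  rw [div_mul_add_ofNat, div_mul_add_ofNat] at h1 h2
  rw [h1, h2]

lemma isMahlerMatrix_upMatrix [NeZero d] (hp2 : p ≠ 2) (he : IsFreeBasis (cuspSet N) (p * N) e)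
    {hpN : p.Coprime N}
    {U : Symb N (isStable_contFun (p := p)) (Dint p) →ₗ[Iwasawa p]
      Symb N (isStable_contFun (p := p)) (Dint p)} (hU : IsUp hpN isStable_contFun (Dint p) U) :
    IsMahlerMatrix e U (upMatrix he hpN) := by
  refine ⟨fun φ m i => ?_, fun k k' => ?_⟩
  · change HasSum _ ((U φ).1 (e i) (mahlerFun m))
    rw [hU.apply_basis he φ i, LinearMap.sum_apply]
    have h : ∀ k ∈ heckeSupp he hpN i, HasSum (fun q : ℕ × Fin d =>
        if k.2.2 = q.2 then heckeCoeff he hpN i k •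
          (φ.1 (e q.2) (mahlerFun q.1) * (fwdDiff (1 : ℤ_[p]))^[q.1]
            (weightAct univChar (heckeElt k) (mahlerFun m).1) 0) else 0)
        ((heckeCoeff he hpN i k • dualAct isStable_contFun (heckeElt k) (φ.1 (e k.2.2)))
          (mahlerFun m)) := by
      intro k _
      have h1 := (dualAct_mahlerFun_hasSum (φ.2.1 (e k.2.2)) (heckeElt k) m).const_smul
        (heckeCoeff he hpN i k)
      have hinj : Function.Injective fun n : ℕ => (n, k.2.2) := fun a b hab =>
        congrArg Prod.fst hab
      refine (hinj.hasSum_iff fun q hq => if_neg fun hk => hq ⟨q.1, by rw [hk]⟩).1 ?_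
      refine hasSum_of_forall_eq h1 fun n => ?_
      simp
    refine hasSum_of_forall_eq (hasSum_sum h) fun q => ?_
    have hx : projPlus p * φ.1 (e q.2) (mahlerFun q.1) = φ.1 (e q.2) (mahlerFun q.1) :=
      projPlus_mul hp2 (LinearMap.congr_fun (Symb.neg_one_smul φ (e q.2)) (mahlerFun q.1))
    rw [upMatrix_mul_add]
    exact upEntry_mul he hpN m i q.1 q.2 hx
  · rw [upMatrix, upEntry, ← mul_assoc, univChar_neg_one_mul_projPlus]

end UpMatrix

/-! ### Taylor series on discs: uniqueness, infinite sums, change of center. -/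

section TaylorSeries

variable {p : ℕ} [Fact p.Prime] {A : Type*} [NormedCommRing A] [NormedAlgebra ℚ_[p] A]

lemma HasTaylor.exists_bound {s : ℝ} {a : ℤ_[p]} {f : ℤ_[p] → A} {c : ℕ → A}
    (h : HasTaylor s a f c) : ∃ K, 0 ≤ K ∧ ∀ n, ‖c n‖ * s ^ n ≤ K := by
  obtain ⟨M, hM⟩ := h.1.bddAbove_range
  exact ⟨max M 0, le_max_right _ _, fun n => (hM ⟨n, rfl⟩).trans (le_max_left _ _)⟩

lemma HasTaylor.apply_center {s : ℝ} (hs : 0 ≤ s) {a : ℤ_[p]} {f : ℤ_[p] → A} {c : ℕ → A}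
    (h : HasTaylor s a f c) : c 0 = f a := by
  have h1 := h.2 a (by simpa using hs)
  have h2 := hasSum_single (f := fun n => (((a - a : ℤ_[p]) : ℚ_[p]) ^ n • c n)) 0
    (fun n hn => by simp [hn])
  simpa using h2.unique h1

lemma HasTaylor.mono {s t : ℝ} (hs : 0 ≤ s) (hst : s ≤ t) {a : ℤ_[p]} {f : ℤ_[p] → A} {c : ℕ → A}
    (h : HasTaylor t a f c) : HasTaylor s a f c :=
  ⟨tendsto_radius_mono hs hst h.1, fun z hz => h.2 z (hz.trans hst)⟩

lemma hasTaylor_of_eventually_zero {s : ℝ} {a : ℤ_[p]} {f : ℤ_[p] → A} {c : ℕ → A} {N : ℕ}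
    (hc : ∀ k, N ≤ k → c k = 0)
    (hf : ∀ z, f z = ∑ k ∈ Finset.range N, ((z - a : ℤ_[p]) : ℚ_[p]) ^ k • c k) :
    HasTaylor s a f c := by
  refine ⟨tendsto_const_nhds.congr' ?_, fun z _ => ?_⟩
  · filter_upwards [eventually_ge_atTop N] with k hk
    rw [hc k hk, norm_zero, zero_mul]
  · rw [hf]
    refine hasSum_sum_of_ne_finset_zero fun k hk => ?_
    rw [hc k (by simpa using hk), smul_zero]

variable [IsUltrametricDist A]

lemma norm_tsum_taylor_le {s : ℝ} (hs : 0 < s) {τ : ℕ → ℕ → A} {K : ℝ}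
    (hτ : ∀ n k, ‖τ n k‖ * s ^ k ≤ K) (k : ℕ) : ‖∑' n, τ n k‖ * s ^ k ≤ K := by
  have hK : 0 ≤ K := le_trans (by positivity) (hτ 0 0)
  rw [← le_div_iff₀ (pow_pos hs k)]
  refine IsUltrametricDist.norm_tsum_le_of_forall_le_of_nonneg (by positivity) fun n => ?_
  rw [le_div_iff₀ (pow_pos hs k)]
  exact hτ n k

lemma HasTaylor.sub {s : ℝ} (hs : 0 ≤ s) {a : ℤ_[p]} {f g : ℤ_[p] → A} {c d : ℕ → A}
    (hf : HasTaylor s a f c) (hg : HasTaylor s a g d) : HasTaylor s a (f - g) (c - d) := by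
  refine ⟨?_, fun z hz => ?_⟩
  · have h := hf.1.add hg.1
    rw [add_zero] at h
    refine squeeze_zero (fun n => by positivity) (fun n => ?_) h
    rw [← add_mul]
    exact mul_le_mul_of_nonneg_right (norm_sub_le _ _) (by positivity)
  · simpa [smul_sub] using (hf.2 z hz).sub (hg.2 z hz)

/-- If the coefficients before `N` vanish, evaluation at `a + p^k` bounds the `N`-th by a constant
times `|p|^k`, because the remaining terms carry an extra factor `p^k`. Then let `k` grow. -/
lemma HasTaylor.eq_zero {s : ℝ} (hs : 0 < s) {a : ℤ_[p]} {c : ℕ → A}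
    (h : HasTaylor s a 0 c) : c = 0 := by
  obtain ⟨M, hM0, hM⟩ := h.exists_bound
  ext N
  induction N using Nat.strong_induction_on with
  | _ N ih =>
    have key : ∀ᶠ k : ℕ in atTop, ‖c N‖ ≤ M / s ^ (N + 1) * ‖(p : ℚ_[p])‖ ^ k := by
      have hp1 : ‖(p : ℚ_[p])‖ < 1 := Padic.norm_p_lt_one
      have hp0 : 0 < ‖(p : ℚ_[p])‖ := norm_pos_iff.2 (mod_cast (Fact.out : p.Prime).ne_zero)
      filter_upwards [(tendsto_pow_atTop_nhds_zero_of_lt_one hp0.le hp1).eventually_le_const hs]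
        with k hk
      set y : ℝ := ‖(p : ℚ_[p])‖ ^ k with hy
      have hy0 : 0 < y := pow_pos hp0 k
      have hys : y / s ≤ 1 := (div_le_one hs).2 hk
      have h1 := h.2 (a + (p : ℤ_[p]) ^ k) (by
        rw [add_sub_cancel_left, norm_pow, ← PadicInt.padic_norm_e_of_padicInt,
          PadicInt.coe_natCast]
        exact hk)
      rw [add_sub_cancel_left] at h1
      have h2 := (hasSum_nat_add_iff' (N + 1)).2 h1
      have h3 : ∑ i ∈ Finset.range (N + 1), (((p : ℤ_[p]) ^ k : ℤ_[p]) : ℚ_[p]) ^ i • c i =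
          (((p : ℤ_[p]) ^ k : ℤ_[p]) : ℚ_[p]) ^ N • c N := by
        rw [Finset.sum_range_succ, Finset.sum_eq_zero, zero_add]
        intro i hi
        rw [ih i (Finset.mem_range.1 hi), Pi.zero_apply, smul_zero]
      rw [h3] at h2
      have h4 : ‖(((p : ℤ_[p]) ^ k : ℤ_[p]) : ℚ_[p])‖ = y := by simp [hy]
      have h5 : ‖(((p : ℤ_[p]) ^ k : ℤ_[p]) : ℚ_[p]) ^ N • c N‖ ≤ M * (y / s) ^ (N + 1) := by
        have h6 := h2.tsum_eq
        rw [Pi.zero_apply, zero_sub] at h6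
        rw [← norm_neg, ← h6]
        refine IsUltrametricDist.norm_tsum_le_of_forall_le_of_nonneg (by positivity) fun n => ?_
        rw [norm_smul, norm_pow, h4]
        calc y ^ (n + (N + 1)) * ‖c (n + (N + 1))‖
            = (‖c (n + (N + 1))‖ * s ^ (n + (N + 1))) * (y / s) ^ (n + (N + 1)) := by
              rw [div_pow]; field_simp
          _ ≤ M * (y / s) ^ (N + 1) := by
              refine mul_le_mul (hM _) ?_ (by positivity) hM0
              exact pow_le_pow_of_le_one (by positivity) hys (by omega)
      rw [norm_smul, norm_pow, h4] at h5
      refine le_of_mul_le_mul_left (h5.trans_eq ?_) (pow_pos hy0 N)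
      rw [div_pow]
      field_simp
      ring
    have hlim : Tendsto (fun k : ℕ => M / s ^ (N + 1) * ‖(p : ℚ_[p])‖ ^ k) atTop (𝓝 0) := by
      simpa using (tendsto_pow_atTop_nhds_zero_of_lt_one (norm_nonneg _)
        (Padic.norm_p_lt_one (p := p))).const_mul (M / s ^ (N + 1))
    exact norm_le_zero_iff.1 (ge_of_tendsto hlim key)

/-- The Taylor coefficients are unique. -/
lemma HasTaylor.unique {s : ℝ} (hs : 0 < s) {a : ℤ_[p]} {f : ℤ_[p] → A} {c d : ℕ → A}
    (hc : HasTaylor s a f c) (hd : HasTaylor s a f d) : c = d := by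
  have h := hc.sub hs.le hd
  rw [sub_self] at h
  exact sub_eq_zero.1 (h.eq_zero hs)

variable [CompleteSpace A]

/-- Taylor series of a sum of functions whose Gauss norms tend to zero. -/
lemma HasTaylor.hasSum {s : ℝ} (hs : 0 < s) {a : ℤ_[p]} {f : ℤ_[p] → A} {F : ℕ → ℤ_[p] → A}
    {τ : ℕ → ℕ → A} {C : ℕ → ℝ} (hF : ∀ n, HasTaylor s a (F n) (τ n))
    (hτ : ∀ n k, ‖τ n k‖ * s ^ k ≤ C n) (hC : Tendsto C atTop (𝓝 0))
    (hf : ∀ z, ‖z - a‖ ≤ s → HasSum (fun n => F n z) (f z)) :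
    HasTaylor s a f (fun k => ∑' n, τ n k) := by
  have hC0 : ∀ n, 0 ≤ C n := fun n => le_trans (by positivity) (hτ n 0)
  refine ⟨?_, fun z hz => ?_⟩
  · rw [Metric.tendsto_atTop]
    intro ε hε
    obtain ⟨N, hN⟩ := eventually_atTop.1 (hC.eventually_lt_const (half_pos hε))
    have h1 : ∀ᶠ k in atTop, ∀ n ∈ Finset.range N, ‖τ n k‖ * s ^ k < ε / 2 :=
      (Finset.eventually_all _).2 fun n _ => (hF n).1.eventually_lt_const (half_pos hε)
    obtain ⟨K, hK⟩ := eventually_atTop.1 h1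
    refine ⟨K, fun k hk => ?_⟩
    rw [Real.dist_0_eq_abs, abs_of_nonneg (by positivity)]
    refine lt_of_le_of_lt ?_ (half_lt_self hε)
    rw [← le_div_iff₀ (pow_pos hs k)]
    refine IsUltrametricDist.norm_tsum_le_of_forall_le_of_nonneg (by positivity) fun n => ?_
    rw [le_div_iff₀ (pow_pos hs k)]
    rcases lt_or_ge n N with h | h
    · exact (hK k hk n (Finset.mem_range.2 h)).le
    · exact (hτ n k).trans (hN n h).le
  · let G : ℕ × ℕ → A := fun q => ((z - a : ℤ_[p]) : ℚ_[p]) ^ q.2 • τ q.1 q.2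
    have hGle : ∀ n k, ‖G (n, k)‖ ≤ ‖τ n k‖ * s ^ k := fun n k => by
      simp only [G]
      rw [norm_smul, norm_pow, mul_comm]
      exact mul_le_mul_of_nonneg_left (pow_le_pow_left₀ (norm_nonneg _) hz _) (norm_nonneg _)
    have hG : Summable G := by
      apply NonarchimedeanAddGroup.summable_of_tendsto_cofinite_zero
      rw [Metric.tendsto_nhds]
      intro ε hε
      obtain ⟨N, hN⟩ := eventually_atTop.1 (hC.eventually_lt_const hε)
      have h1 : ∀ᶠ k in atTop, ∀ n ∈ Finset.range N, ‖τ n k‖ * s ^ k < ε :=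
        (Finset.eventually_all _).2 fun n _ => (hF n).1.eventually_lt_const hε
      obtain ⟨K, hK⟩ := eventually_atTop.1 h1
      rw [Filter.eventually_cofinite]
      refine ((Finset.range N ×ˢ Finset.range K).finite_toSet).subset ?_
      rintro ⟨n, k⟩ hq
      rw [Finset.mem_coe, Finset.mem_product, Finset.mem_range, Finset.mem_range]
      rw [Set.mem_ofPred_eq, dist_zero_right] at hq
      have hn : n < N := by
        by_contra hn
        exact hq (((hGle n k).trans (hτ n k)).trans_lt (hN n (not_lt.1 hn)))
      refine ⟨hn, ?_⟩
      by_contra hk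
      exact hq ((hGle n k).trans_lt (hK k (not_lt.1 hk) n (Finset.mem_range.2 hn)))
    have hsum : HasSum G (f z) := by
      have h2 := hG.hasSum.prod_fiberwise fun n => (hF n).2 z hz
      rw [← h2.unique (hf z hz)]
      exact hG.hasSum
    refine ((Equiv.prodComm ℕ ℕ).hasSum_iff.2 hsum).prod_fiberwise fun k => ?_
    have h3 : Summable fun n => τ n k := by
      apply NonarchimedeanAddGroup.summable_of_tendsto_cofinite_zero
      rw [Nat.cofinite_eq_atTop]
      refine squeeze_zero_norm (a := fun n => C n / s ^ k) (fun n => ?_) ?_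
      · rw [le_div_iff₀ (pow_pos hs k)]
        exact hτ n k
      · simpa using hC.div_const (s ^ k)
    exact h3.hasSum.const_smul (((z - a : ℤ_[p]) : ℚ_[p]) ^ k)

/-- A Taylor series can be recentered in its disc of convergence. -/
lemma HasTaylor.recenter {s : ℝ} (hs : 0 < s) {a b : ℤ_[p]} (hab : ‖b - a‖ ≤ s)
    {f : ℤ_[p] → A} {c : ℕ → A} (h : HasTaylor s a f c) :
    ∃ c', HasTaylor s b f c' ∧
      ∀ K, (∀ n, ‖c n‖ * s ^ n ≤ K) → ∀ k, ‖c' k‖ * s ^ k ≤ K := by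
  -- Coefficients of the binomial expansion of `((z - b) + (b - a))^n`. Binomial coefficients have
  -- norm at most one and `|b - a| ≤ s`, so recentering does not enlarge the Gauss norm.
  set τ : ℕ → ℕ → A := fun n k =>
    (((b - a : ℤ_[p]) : ℚ_[p]) ^ (n - k) * (n.choose k : ℚ_[p])) • c n with hτdef
  have hτ : ∀ n k, ‖τ n k‖ * s ^ k ≤ ‖c n‖ * s ^ n := by
    intro n k
    rcases lt_or_ge n k with hnk | hnk
    · simp only [hτdef, Nat.choose_eq_zero_of_lt hnk]
      simp only [Nat.cast_zero, mul_zero, zero_smul, norm_zero, zero_mul]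
      positivity
    · simp only [hτdef]
      rw [norm_smul, norm_mul, norm_pow]
      have h1 : ‖(n.choose k : ℚ_[p])‖ ≤ 1 := by
        have := PadicInt.norm_le_one (n.choose k : ℤ_[p])
        rwa [← PadicInt.padic_norm_e_of_padicInt, PadicInt.coe_natCast] at this
      have h2 : ‖((b - a : ℤ_[p]) : ℚ_[p])‖ ^ (n - k) ≤ s ^ (n - k) :=
        pow_le_pow_left₀ (norm_nonneg _) hab _
      calc _ ≤ s ^ (n - k) * 1 * ‖c n‖ * s ^ k := by gcongr
        _ = ‖c n‖ * s ^ n := by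
          rw [mul_one, mul_right_comm, ← pow_add, Nat.sub_add_cancel hnk, mul_comm]
  have hF : ∀ n, HasTaylor s b (fun z => ((z - a : ℤ_[p]) : ℚ_[p]) ^ n • c n) (τ n) := by
    intro n
    refine hasTaylor_of_eventually_zero (N := n + 1) (fun k hk => ?_) fun z => ?_
    · simp only [hτdef, Nat.choose_eq_zero_of_lt (show n < k by omega)]
      simp
    · have h1 : ((z - a : ℤ_[p]) : ℚ_[p]) =
          ((z - b : ℤ_[p]) : ℚ_[p]) + ((b - a : ℤ_[p]) : ℚ_[p]) := by
        push_cast; ring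
      rw [h1, add_pow, Finset.sum_smul]
      refine Finset.sum_congr rfl fun k _ => ?_
      simp only [hτdef]
      rw [smul_smul, mul_assoc]
  exact ⟨_, HasTaylor.hasSum hs hF hτ h.1 fun z hz => h.2 z (by
    have e : z - a = (z - b) + (b - a) := by ring
    rw [e]
    exact (IsUltrametricDist.norm_add_le_max _ _).trans (max_le hz hab)),
    fun K hK k => norm_tsum_taylor_le hs (fun n k => (hτ n k).trans (hK n)) k⟩

end TaylorSeries

/-! ### Gauss norms and operator norms. -/

section Norms

variable {p : ℕ} [Fact p.Prime] {A : Type*} [NormedCommRing A] [NormedAlgebra ℚ_[p] A]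

lemma taylorNorm_le {s : ℝ} {f : ℤ_[p] → A} {K : ℝ} (hK : 0 ≤ K)
    (h : ∀ a, ∃ c, HasTaylor s a f c ∧ ∀ n, ‖c n‖ * s ^ n ≤ K) : taylorNorm s f ≤ K :=
  csInf_le ⟨0, fun _ h => h.1⟩ ⟨hK, h⟩

lemma distNorm_nonneg (s : ℝ) (Ψ : locAn p A s →ₗ[A] A) : 0 ≤ distNorm s Ψ :=
  Real.sInf_nonneg fun _ hK => hK.1

lemma distNorm_le {s : ℝ} {Ψ : locAn p A s →ₗ[A] A} {K : ℝ} (hK : 0 ≤ K)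
    (h : ∀ f, ‖Ψ f‖ ≤ K * taylorNorm s f.1) : distNorm s Ψ ≤ K :=
  csInf_le ⟨0, fun _ h => h.1⟩ ⟨hK, h⟩

/-- The infimum defining `distNorm` is attained. If `f` has norm zero there is nothing to divide by,
but then boundedness already gives `Ψ f = 0`. -/
lemma IsBdd.norm_le {s : ℝ} {Ψ : locAn p A s →ₗ[A] A} (h : IsBdd s Ψ) (f : locAn p A s) :
    ‖Ψ f‖ ≤ distNorm s Ψ * taylorNorm s f.1 := by
  obtain ⟨K, hK, hb⟩ := h
  rcases eq_or_lt_of_le (taylorNorm_nonneg s f.1) with h0 | h0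
  · have := hb f
    rwa [← h0, mul_zero] at this ⊢
  · rw [← div_le_iff₀ h0]
    refine le_csInf ⟨K, hK, hb⟩ fun L hL => ?_
    rw [div_le_iff₀ h0]
    exact hL.2 f

lemma exists_finset_centers {s : ℝ} (hs : 0 < s) :
    ∃ T : Finset ℤ_[p], ∀ z : ℤ_[p], ∃ a ∈ T, ‖z - a‖ ≤ s := by
  obtain ⟨T, hT⟩ := (isCompact_univ (X := ℤ_[p])).elim_nhds_subcover
    (fun a => Metric.ball a s) fun a _ => Metric.ball_mem_nhds a hs
  refine ⟨T, fun z => ?_⟩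
  obtain ⟨a, ha, hz⟩ := Set.mem_iUnion₂.1 (hT.2 (Set.mem_univ z))
  exact ⟨a, ha, (mem_ball_iff_norm.1 hz).le⟩

variable [IsUltrametricDist A] [CompleteSpace A]

/-- The Taylor series of a locally analytic function are uniformly bounded. -/
lemma exists_taylor_bound {s : ℝ} (hs : 0 < s) {f : ℤ_[p] → A} (hf : f ∈ locAn p A s) :
    ∃ K, 0 ≤ K ∧ ∀ a, ∃ c, HasTaylor s a f c ∧ ∀ n, ‖c n‖ * s ^ n ≤ K := by
  obtain ⟨T, hT⟩ := exists_finset_centers (p := p) hs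
  choose c hc using hf
  choose K hK0 hK using fun a => (hc a).exists_bound
  refine ⟨∑ a ∈ T, K a, Finset.sum_nonneg fun a _ => hK0 a, fun b => ?_⟩
  obtain ⟨a, ha, hab⟩ := hT b
  obtain ⟨c', h1, h2⟩ := (hc a).recenter hs hab
  refine ⟨c', h1, h2 _ fun n => (hK a n).trans ?_⟩
  exact Finset.single_le_sum (f := K) (fun a _ => hK0 a) ha

/-- By uniqueness of Taylor coefficients, each bound admitted in the infimum applies to this series;
the uniform bound on all discs keeps the set of such bounds nonempty. -/
lemma HasTaylor.le_taylorNorm {s : ℝ} (hs : 0 < s) {f : ℤ_[p] → A} (hf : f ∈ locAn p A s)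
    {a : ℤ_[p]} {c : ℕ → A} (hc : HasTaylor s a f c) (n : ℕ) : ‖c n‖ * s ^ n ≤ taylorNorm s f := by
  obtain ⟨K, hK⟩ := exists_taylor_bound hs hf
  refine le_csInf ⟨K, hK⟩ fun L hL => ?_
  obtain ⟨c', h1, h2⟩ := hL.2 a
  rw [hc.unique hs h1]
  exact h2 n

lemma norm_apply_le_taylorNorm {s : ℝ} (hs : 0 < s) {f : ℤ_[p] → A} (hf : f ∈ locAn p A s)
    (z : ℤ_[p]) : ‖f z‖ ≤ taylorNorm s f := by
  obtain ⟨c, hc⟩ := hf z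
  have := hc.le_taylorNorm hs hf 0
  rwa [hc.apply_center hs.le, pow_zero, mul_one] at this

/-- It suffices to bound the Taylor series at one center in each disc. -/
lemma taylorNorm_le_of_centers {s : ℝ} (hs : 0 < s) {f : ℤ_[p] → A} {K : ℝ} (hK : 0 ≤ K)
    (h : ∀ b, ∃ a c, ‖b - a‖ ≤ s ∧ HasTaylor s a f c ∧ ∀ n, ‖c n‖ * s ^ n ≤ K) :
    f ∈ locAn p A s ∧ taylorNorm s f ≤ K := by
  have key : ∀ b, ∃ c, HasTaylor s b f c ∧ ∀ n, ‖c n‖ * s ^ n ≤ K := fun b => by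
    obtain ⟨a, c, hab, hc, hcK⟩ := h b
    obtain ⟨c', h1, h2⟩ := hc.recenter hs hab
    exact ⟨c', h1, h2 K hcK⟩
  exact ⟨fun b => ⟨_, (key b).choose_spec.1⟩, taylorNorm_le hK key⟩

lemma taylorNorm_mono {s t : ℝ} (hs : 0 < s) (hst : s ≤ t) {f : ℤ_[p] → A}
    (hf : f ∈ locAn p A t) : taylorNorm s f ≤ taylorNorm t f := by
  refine taylorNorm_le (taylorNorm_nonneg _ _) fun a => ?_
  obtain ⟨c, hc⟩ := hf a
  refine ⟨c, hc.mono hs.le hst, fun n => ?_⟩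
  exact (mul_le_mul_of_nonneg_left (pow_le_pow_left₀ hs.le hst n) (norm_nonneg _)).trans
    (hc.le_taylorNorm (hs.trans_le hst) hf n)

end Norms

/-! ### Discs of radius `s` as residue classes. -/

section Discs

variable {p : ℕ} [Fact p.Prime]

/-- A radius `s < 1` is squeezed between successive powers of `1/p`. -/
lemma exists_level {s : ℝ} (hs : 0 < s) (hs1 : s < 1) :
    ∃ h : ℕ, ((p : ℝ)⁻¹) ^ (h + 1) ≤ s ∧ s < ((p : ℝ)⁻¹) ^ h := by
  classical
  have h1 : (1 : ℝ) < p := mod_cast (Fact.out : p.Prime).one_lt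
  have hex : ∃ n : ℕ, ((p : ℝ)⁻¹) ^ n ≤ s :=
    ((tendsto_pow_atTop_nhds_zero_of_lt_one (by positivity)
      (inv_lt_one_of_one_lt₀ h1)).eventually_le_const hs).exists
  have hne : Nat.find hex ≠ 0 := by
    intro h0
    have := Nat.find_spec hex
    rw [h0, pow_zero] at this
    linarith
  obtain ⟨h, hh⟩ := Nat.exists_eq_succ_of_ne_zero hne
  refine ⟨h, by rw [← Nat.succ_eq_add_one, ← hh]; exact Nat.find_spec hex, ?_⟩
  exact not_le.1 (Nat.find_min hex (by omega))

/-- Norms on `ℤ_p` are powers of `1/p` or zero, so only the position of `s` between two of these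
powers matters. -/
lemma norm_le_radius_iff {s : ℝ} {h : ℕ} (h1 : ((p : ℝ)⁻¹) ^ (h + 1) ≤ s)
    (h2 : s < ((p : ℝ)⁻¹) ^ h) (z : ℤ_[p]) : ‖z‖ ≤ s ↔ (p : ℤ_[p]) ^ (h + 1) ∣ z := by
  rw [padic_dvd_pow_iff]
  have e : (p : ℝ) ^ (-((h + 1 : ℕ) : ℤ)) = ((p : ℝ)⁻¹) ^ (h + 1) := by
    rw [zpow_neg, zpow_natCast, inv_pow]
  refine ⟨fun hz => ?_, fun hz => hz.trans (e.trans_le h1)⟩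
  rw [PadicInt.norm_le_pow_iff_norm_lt_pow_add_one]
  have e' : (p : ℝ) ^ (-((h + 1 : ℕ) : ℤ) + 1) = ((p : ℝ)⁻¹) ^ h := by
    rw [Nat.cast_add, Nat.cast_one, neg_add, neg_add_cancel_right, zpow_neg, zpow_natCast, inv_pow]
  rw [e']
  exact hz.trans_lt h2

lemma norm_sub_le_radius_iff {s : ℝ} {h : ℕ} (h1 : ((p : ℝ)⁻¹) ^ (h + 1) ≤ s)
    (h2 : s < ((p : ℝ)⁻¹) ^ h) (z w : ℤ_[p]) :
    ‖z - w‖ ≤ s ↔ PadicInt.toZModPow (h + 1) z = PadicInt.toZModPow (h + 1) w := by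
  rw [norm_le_radius_iff h1 h2, padic_toZModPow_eq_iff]

/-- The center of the disc of a residue class. -/
def discCenter (h : ℕ) (i : ZMod (p ^ h)) : ℤ_[p] := (i.val : ℤ_[p])

lemma toZModPow_discCenter (h : ℕ) (i : ZMod (p ^ h)) :
    PadicInt.toZModPow h (discCenter h i) = i := by
  have : NeZero (p ^ h) := ⟨pow_ne_zero _ (Fact.out : p.Prime).ne_zero⟩
  rw [discCenter, map_natCast, ZMod.natCast_zmod_val]

end Discs

/-! ### Taylor coefficients as bounded linear functionals. -/

section TaylorCoefficients

variable {p : ℕ} [Fact p.Prime] {A : Type*} [NormedCommRing A] [NormedAlgebra ℚ_[p] A]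

lemma HasTaylor.congr {s : ℝ} {a : ℤ_[p]} {f g : ℤ_[p] → A} {c : ℕ → A} (h : HasTaylor s a f c)
    (hfg : ∀ z, ‖z - a‖ ≤ s → f z = g z) : HasTaylor s a g c :=
  ⟨h.1, fun z hz => hfg z hz ▸ h.2 z hz⟩

lemma HasTaylor.add {s : ℝ} (hs : 0 ≤ s) {a : ℤ_[p]} {f g : ℤ_[p] → A} {c d : ℕ → A}
    (hf : HasTaylor s a f c) (hg : HasTaylor s a g d) : HasTaylor s a (f + g) (c + d) := by
  refine ⟨?_, fun z hz => ?_⟩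
  · have h := hf.1.add hg.1
    rw [add_zero] at h
    refine squeeze_zero (fun n => by positivity) (fun n => ?_) h
    rw [← add_mul]
    exact mul_le_mul_of_nonneg_right (norm_add_le _ _) (by positivity)
  · simpa [smul_add] using (hf.2 z hz).add (hg.2 z hz)

lemma HasTaylor.const_mul {s : ℝ} (hs : 0 ≤ s) {a : ℤ_[p]} {f : ℤ_[p] → A} {c : ℕ → A} (r : A)
    (hf : HasTaylor s a f c) : HasTaylor s a (r • f) (r • c) := by
  refine ⟨?_, fun z hz => ?_⟩
  · have h := hf.1.const_mul ‖r‖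
    rw [mul_zero] at h
    refine squeeze_zero (fun n => by positivity) (fun n => ?_) h
    rw [← mul_assoc]
    exact mul_le_mul_of_nonneg_right (norm_mul_le _ _) (by positivity)
  · have h := (hf.2 z hz).mul_left r
    simpa [mul_smul_comm] using h

lemma HasTaylor.baseChange {s : ℝ} {a : ℤ_[p]} {f : ℤ_[p] → ℚ_[p]} {c : ℕ → ℚ_[p]}
    (h : HasTaylor s a f c) :
    HasTaylor s a (fun z => algebraMap ℚ_[p] A (f z)) (fun n => algebraMap ℚ_[p] A (c n)) := by
  refine ⟨?_, fun z hz => ?_⟩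
  · have h := h.1.mul_const ‖(1 : A)‖
    rw [zero_mul] at h
    refine h.congr fun n => ?_
    rw [norm_algebraMap]
    ring
  · have h := (h.2 z hz).map (algebraMap ℚ_[p] A) (algebraMapCLM ℚ_[p] A).continuous
    refine hasSum_of_forall_eq h fun n => ?_
    simp [Algebra.smul_def]

variable [IsUltrametricDist A]

/-- The `n`-th Taylor coefficient at `a` of a locally analytic function. -/
def taylorCoeff {s : ℝ} (hs : 0 < s) (a : ℤ_[p]) (n : ℕ) : locAn p A s →ₗ[A] A where
  toFun f := (f.2 a).choose n
  map_add' f g := congrFun ((((f + g).2 a).choose_spec).unique hs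
    ((f.2 a).choose_spec.add hs.le (g.2 a).choose_spec)) n
  map_smul' r f := congrFun ((((r • f).2 a).choose_spec).unique hs
    ((f.2 a).choose_spec.const_mul hs.le r)) n

lemma hasTaylor_taylorCoeff {s : ℝ} (hs : 0 < s) (a : ℤ_[p]) (f : locAn p A s) :
    HasTaylor s a f.1 (fun n => taylorCoeff hs a n f) := (f.2 a).choose_spec

variable [CompleteSpace A]

lemma isBdd_taylorCoeff {s : ℝ} (hs : 0 < s) (a : ℤ_[p]) (n : ℕ) :
    IsBdd s (taylorCoeff (A := A) hs a n) := by
  refine ⟨(s ^ n)⁻¹, by positivity, fun f => ?_⟩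
  rw [← div_eq_inv_mul, le_div_iff₀ (pow_pos hs n)]
  exact (hasTaylor_taylorCoeff hs a f).le_taylorNorm hs f.2 n

lemma mem_locAn_of_centers {s : ℝ} (hs : 0 < s) {f : ℤ_[p] → A}
    (h : ∀ b, ∃ a c, ‖b - a‖ ≤ s ∧ HasTaylor s a f c) : f ∈ locAn p A s := fun b => by
  obtain ⟨a, c, hab, hc⟩ := h b
  obtain ⟨c', h1, -⟩ := hc.recenter hs hab
  exact ⟨c', h1⟩

end TaylorCoefficients

/-! ### Taylor polynomials approximate in smaller radius; membership in `𝒟_r^†(A)`. -/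

section Approximation

variable {p : ℕ} [Fact p.Prime] {A : Type*} [NormedCommRing A] [NormedAlgebra ℚ_[p] A]

variable (A) in
/-- The function which is `(z - a_i)^n` on the disc of the residue class `i` modulo `p^h` with
center `a_i`, and zero elsewhere. -/
def discMonomial (h : ℕ) (i : ZMod (p ^ h)) (n : ℕ) (z : ℤ_[p]) : A :=
  if PadicInt.toZModPow h z = i then ((z - discCenter h i : ℤ_[p]) : ℚ_[p]) ^ n • 1 else 0

variable [IsUltrametricDist A] [CompleteSpace A]

lemma discMonomial_mem {s : ℝ} (hs : 0 < s) {h : ℕ} (h1 : ((p : ℝ)⁻¹) ^ (h + 1) ≤ s)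
    (h2 : s < ((p : ℝ)⁻¹) ^ h) (i : ZMod (p ^ (h + 1))) (n : ℕ) :
    discMonomial A (h + 1) i n ∈ locAn p A s := by
  refine mem_locAn_of_centers hs fun b => ?_
  set j := PadicInt.toZModPow (h + 1) b with hj
  have hz : ∀ z, ‖z - discCenter (h + 1) j‖ ≤ s → PadicInt.toZModPow (h + 1) z = j := fun z hz => by
    rw [norm_sub_le_radius_iff h1 h2, toZModPow_discCenter] at hz
    exact hz
  refine ⟨discCenter (h + 1) j, if j = i then Pi.single n 1 else 0, ?_, ?_⟩
  · rw [norm_sub_le_radius_iff h1 h2, toZModPow_discCenter]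
  · split_ifs with hji
    · refine (hasTaylor_of_eventually_zero (N := n + 1)
        (f := fun z => ((z - discCenter (h + 1) j : ℤ_[p]) : ℚ_[p]) ^ n • (1 : A))
        (fun k hk => ?_) fun z => ?_).congr fun z hzj => ?_
      · rw [Pi.single_eq_of_ne (by omega)]
      · rw [Finset.sum_eq_single n (fun k _ hk => by rw [Pi.single_eq_of_ne hk, smul_zero])
          (fun h => absurd (Finset.self_mem_range_succ n) h), Pi.single_eq_same]
      · rw [discMonomial, if_pos ((hz z hzj).trans hji), hji]
    · refine (hasTaylor_of_eventually_zero (N := 0) (f := fun _ => (0 : A))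
        (fun k _ => rfl) fun z => by simp).congr fun z hzj => ?_
      rw [discMonomial, if_neg (by rw [hz z hzj]; exact hji)]

/-- Approximation of a function in `A_s(ℚ_p)` by its Taylor polynomials, in `A_{s'}(A)`. -/
lemma taylorNorm_sub_taylorPolynomial_le {s s' : ℝ} (hs' : 0 < s') (hss : s' ≤ s) {h : ℕ}
    (h1 : ((p : ℝ)⁻¹) ^ (h + 1) ≤ s') (h2 : s' < ((p : ℝ)⁻¹) ^ h) (M : ℕ)
    (f : locAn p ℚ_[p] s) :
    taylorNorm s' ((baseChange A s f).1 - ∑ q : ZMod (p ^ (h + 1)) × Fin M,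
      taylorCoeff (hs'.trans_le hss) (discCenter (h + 1) q.1) q.2 f •
        discMonomial A (h + 1) q.1 q.2) ≤ ‖(1 : A)‖ * (s' / s) ^ M * taylorNorm s f.1 := by
  have hs := hs'.trans_le hss
  have hnn := taylorNorm_nonneg s f.1
  refine (taylorNorm_le_of_centers hs' (by positivity) fun b => ?_).2
  set j := PadicInt.toZModPow (h + 1) b with hj
  set a := discCenter (h + 1) j with ha
  have hz : ∀ z, ‖z - a‖ ≤ s' → PadicInt.toZModPow (h + 1) z = j := fun z hz => by
    rw [norm_sub_le_radius_iff h1 h2, toZModPow_discCenter] at hz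
    exact hz
  have hf := hasTaylor_taylorCoeff hs a f
  set c := fun n => taylorCoeff hs a n f with hc
  have hpol : HasTaylor s' a (fun z => ∑ k ∈ Finset.range M, ((z - a : ℤ_[p]) : ℚ_[p]) ^ k •
      if k < M then algebraMap ℚ_[p] A (c k) else 0)
      (fun k => if k < M then algebraMap ℚ_[p] A (c k) else 0) :=
    hasTaylor_of_eventually_zero (N := M) (fun k hk => if_neg (by omega)) fun z => rfl
  refine ⟨a, _, ?_, (((hf.mono hs'.le hss).baseChange (A := A)).sub hs'.le hpol).congr
    fun z hzj => ?_, fun n => ?_⟩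
  · rw [norm_sub_le_radius_iff h1 h2, toZModPow_discCenter]
  · rw [Pi.sub_apply, Pi.sub_apply, Finset.sum_apply]
    congr 1
    rw [Fintype.sum_prod_type, Finset.sum_eq_single j, ← Fin.sum_univ_eq_sum_range
      (fun k => ((z - a : ℤ_[p]) : ℚ_[p]) ^ k • if k < M then algebraMap ℚ_[p] A (c k) else 0)]
    · refine Finset.sum_congr rfl fun k _ => ?_
      rw [if_pos k.2, Pi.smul_apply, discMonomial, if_pos (hz z hzj), ← ha,
        Algebra.algebraMap_eq_smul_one, smul_comm]
    · intro i _ hi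
      refine Finset.sum_eq_zero fun k _ => ?_
      rw [Pi.smul_apply, discMonomial, if_neg (by rw [hz z hzj]; exact Ne.symm hi), smul_zero]
    · exact fun h => absurd (Finset.mem_univ j) h
  · rw [Pi.sub_apply]
    split_ifs with hn
    · rw [sub_self, norm_zero, zero_mul]
      positivity
    · rw [sub_zero, norm_algebraMap]
      have h3 := hf.le_taylorNorm hs f.2 n
      -- Only the tail `n ≥ M` survives, and shrinking the radius gains at least `(s'/s)^M` on it.
      have h4 : (s' / s) ^ n ≤ (s' / s) ^ M :=
        pow_le_pow_of_le_one (by positivity) ((div_le_one hs).2 hss) (not_lt.1 hn)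
      calc ‖c n‖ * ‖(1 : A)‖ * s' ^ n = ‖(1 : A)‖ * (s' / s) ^ n * (‖c n‖ * s ^ n) := by
            rw [div_pow]; field_simp
        _ ≤ _ := by gcongr

lemma mem_distMod_of_fintype {s : ℝ} {Ψ : locAn p A s →ₗ[A] A} (hb : IsBdd s Ψ)
    (h : ∀ ε > 0, ∃ (ι : Type) (_ : Fintype ι) (μ : ι → locAn p ℚ_[p] s →ₗ[ℚ_[p]] ℚ_[p])
      (a : ι → A), (∀ i, IsBdd s (μ i)) ∧
        ∀ f, ‖Ψ (baseChange A s f) - ∑ i, μ i f • a i‖ ≤ ε * taylorNorm s f.1) :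
    Ψ ∈ distMod p A s := by
  refine ⟨hb, fun ε hε => ?_⟩
  obtain ⟨ι, _, μ, a, hμ, h⟩ := h ε hε
  let E := (Fintype.equivFin ι).symm
  refine ⟨_, fun i => μ (E i), fun i => a (E i), fun i => hμ _, fun f => ?_⟩
  rw [E.sum_comp fun i => μ i f • a i]
  exact h f

/-- A functional on `𝒜_r^†(A)` is in `𝒟_r^†(A)` as soon as it is bounded on each `A_s(A)`. -/
lemma mem_daggerDist_of_isBdd {r : ℝ} (hr : 0 < r) (hr1 : r < 1) {Φ : daggerFun p A r →ₗ[A] A}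
    (hΦ : ∀ s (hs : 0 < s) (hrs : r < s), s < 1 → IsBdd s (restrictDist hs hrs Φ)) :
    Φ ∈ daggerDist p A r := by
  intro s hs hrs
  -- A radius strictly between `r` and `s` leaves room to approximate on `A_s(ℚ_p)`: there the
  -- functional is, up to small operator norm, a finite combination of Taylor coefficients weighted
  -- by its values on disc monomials of radius `s'`.
  obtain ⟨s', hrs', hs'⟩ := exists_between (lt_min hrs hr1)
  have hs'0 : 0 < s' := hr.trans hrs'
  have hss : s' < s := hs'.trans_le (min_le_left _ _)
  have hs'1 : s' < 1 := hs'.trans_le (min_le_right _ _)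
  obtain ⟨K, hK, hb⟩ := hΦ s' hs'0 hrs' hs'1
  refine mem_distMod_of_fintype ⟨K, hK, fun f => ?_⟩ fun ε hε => ?_
  · exact (hb ⟨f.1, locAn_mono hs'0.le hss.le f.2⟩).trans
      (mul_le_mul_of_nonneg_left (taylorNorm_mono hs'0 hss.le f.2) hK)
  · obtain ⟨h, h1, h2⟩ := exists_level (p := p) hs'0 hs'1
    have hlim : Tendsto (fun M => K * (‖(1 : A)‖ * (s' / s) ^ M)) atTop (𝓝 0) := by
      simpa using ((tendsto_pow_atTop_nhds_zero_of_lt_one (div_nonneg hs'0.le hs.le)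
        ((div_lt_one hs).2 hss)).const_mul ‖(1 : A)‖).const_mul K
    obtain ⟨M, hM⟩ := (hlim.eventually_le_const hε).exists
    have : NeZero (p ^ (h + 1)) := ⟨pow_ne_zero _ (Fact.out : p.Prime).ne_zero⟩
    refine ⟨ZMod (p ^ (h + 1)) × Fin M, inferInstance,
      fun q => taylorCoeff hs (discCenter (h + 1) q.1) q.2,
      fun q => Φ ⟨_, locAn_le_daggerFun hs'0 hrs' (discMonomial_mem hs'0 h1 h2 q.1 q.2)⟩,
      fun q => isBdd_taylorCoeff hs _ _, fun f => ?_⟩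
    set g : locAn p A s' := ⟨(baseChange A s f).1, locAn_mono hs'0.le hss.le (baseChange A s f).2⟩ -
      ∑ q : ZMod (p ^ (h + 1)) × Fin M,
        algebraMap ℚ_[p] A (taylorCoeff hs (discCenter (h + 1) q.1) q.2 f) •
          ⟨discMonomial A (h + 1) q.1 q.2, discMonomial_mem hs'0 h1 h2 q.1 q.2⟩ with hg
    have e1 : restrictDist hs hrs Φ (baseChange A s f) -
        ∑ q : ZMod (p ^ (h + 1)) × Fin M, taylorCoeff hs (discCenter (h + 1) q.1) q.2 f •
          Φ ⟨_, locAn_le_daggerFun hs'0 hrs' (discMonomial_mem hs'0 h1 h2 q.1 q.2)⟩ =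
        restrictDist hs'0 hrs' Φ g := by
      rw [hg, map_sub, map_sum]
      congr 1
      refine Finset.sum_congr rfl fun q _ => ?_
      rw [map_smul, smul_eq_mul, ← Algebra.smul_def]
      rfl
    rw [e1]
    refine (hb g).trans ?_
    have e2 : g.1 = (baseChange A s f).1 - ∑ q : ZMod (p ^ (h + 1)) × Fin M,
        taylorCoeff hs (discCenter (h + 1) q.1) q.2 f • discMonomial A (h + 1) q.1 q.2 := by
      rw [hg, Submodule.coe_sub, Submodule.coe_sum]
      congr 1
      refine Finset.sum_congr rfl fun q _ => ?_
      rw [Submodule.coe_smul, algebraMap_smul]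
    rw [e2]
    refine (mul_le_mul_of_nonneg_left
      (taylorNorm_sub_taylorPolynomial_le hs'0 hss.le h1 h2 M f) hK).trans ?_
    rw [← mul_assoc]
    exact mul_le_mul_of_nonneg_right hM (taylorNorm_nonneg _ _)

end Approximation

/-! ### Composition with contracting power series. -/

section Composition

variable {p : ℕ} [Fact p.Prime] {A : Type*} [NormedCommRing A] [NormedAlgebra ℚ_[p] A]

lemma norm_coeff_pow_le {H : PowerSeries ℤ_[p]} {μ : ℝ} (hμ : 0 ≤ μ)
    (hH : ∀ k, ‖PowerSeries.coeff k H‖ ≤ μ ^ k) (n k : ℕ) :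
    ‖PowerSeries.coeff k (H ^ n)‖ ≤ μ ^ k := by
  induction n generalizing k with
  | zero =>
    rw [pow_zero, PowerSeries.coeff_one]
    split_ifs with hk
    · simp [hk]
    · rw [norm_zero]; positivity
  | succ n ih =>
    rw [pow_succ, PowerSeries.coeff_mul]
    refine IsUltrametricDist.norm_sum_le_of_forall_le_of_nonneg (by positivity) fun q hq => ?_
    rw [norm_mul, ← Finset.HasAntidiagonal.mem_antidiagonal.1 hq, pow_add]
    exact mul_le_mul (ih _) (hH _) (norm_nonneg _) (by positivity)

variable [IsUltrametricDist A] [CompleteSpace A]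

/-- Composition of a Taylor series of radius `s = μR` with a power series whose `k`-th coefficient
is bounded by `μ^k`. -/
lemma HasTaylor.comp_of_norm_coeff_le {μ R s : ℝ} (hR : 0 < R) (hμ : 0 < μ) (hs : s = μ * R)
    (hs1 : s < 1) {a b : ℤ_[p]} {f : ℤ_[p] → A} {c : ℕ → A} (hf : HasTaylor s b f c)
    {u : ℤ_[p] → ℤ_[p]} {H : PowerSeries ℤ_[p]} (hH0 : PowerSeries.constantCoeff H = 0)
    (hHμ : ∀ k, ‖PowerSeries.coeff k H‖ ≤ μ ^ k)
    (hu : ∀ z, ‖z - a‖ ≤ R → ‖u z - b‖ ≤ s)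
    (hH : ∀ z, ‖z - a‖ ≤ R →
      HasSum (fun k => PowerSeries.coeff k H * (z - a) ^ k) (u z - b)) :
    ∃ d, HasTaylor R a (f ∘ u) d ∧
      ∀ K, (∀ n, ‖c n‖ * s ^ n ≤ K) → ∀ k, ‖d k‖ * R ^ k ≤ K := by
  have hs0 : 0 < s := hs ▸ mul_pos hμ hR
  set τ : ℕ → ℕ → A := fun n k => ((PowerSeries.coeff k (H ^ n) : ℤ_[p]) : ℚ_[p]) • c n with hτdef
  have hle : ∀ n k, ‖τ n k‖ * R ^ k ≤ ‖c n‖ * s ^ k := by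
    intro n k
    simp only [hτdef]
    rw [norm_smul, PadicInt.padic_norm_e_of_padicInt, hs, mul_pow]
    calc _ ≤ μ ^ k * ‖c n‖ * R ^ k := by
          gcongr
          exact norm_coeff_pow_le hμ.le hHμ n k
      _ = _ := by ring
  -- `H^n` starts in degree `n`, and for `k ≥ n` the assumption `s < 1` gives `s^k ≤ s^n`.
  have hτ : ∀ n k, ‖τ n k‖ * R ^ k ≤ ‖c n‖ * s ^ n := by
    intro n k
    rcases lt_or_ge k n with hkn | hkn
    · simp only [hτdef]
      rw [PowerSeries.coeff_of_lt_order _ (lt_of_lt_of_le (mod_cast hkn)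
        (PowerSeries.le_order_pow_of_constantCoeff_eq_zero n hH0)), PadicInt.coe_zero, zero_smul,
        norm_zero, zero_mul]
      positivity
    · exact (hle n k).trans (mul_le_mul_of_nonneg_left
        (pow_le_pow_of_le_one hs0.le hs1.le hkn) (norm_nonneg _))
  have hF : ∀ n, HasTaylor R a (fun z => ((u z - b : ℤ_[p]) : ℚ_[p]) ^ n • c n) (τ n) := by
    intro n
    refine ⟨squeeze_zero (fun k => by positivity) (hle n) ?_, fun z hz => ?_⟩
    · simpa using (tendsto_pow_atTop_nhds_zero_of_lt_one hs0.le hs1).const_mul ‖c n‖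
    · have h1 := (hasSum_pow_coeff (hH z hz) n).map (PadicInt.Coe.ringHom (p := p))
        continuous_subtype_val
      have h2 := h1.smul_const (c n)
      rw [map_pow] at h2
      refine hasSum_of_forall_eq h2 fun k => ?_
      simp only [hτdef, Function.comp_apply, map_mul, map_pow]
      rw [smul_smul, mul_comm]
      rfl
  exact ⟨_, HasTaylor.hasSum hR hF hτ hf.1 fun z hz => hf.2 _ (hu z hz),
    fun K hK k => norm_tsum_taylor_le hR (fun n k => (hτ n k).trans (hK n)) k⟩

end Composition

/-! ### Gauss norm estimates for the weight action. -/

section WeightAction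

variable {p : ℕ} [Fact p.Prime]

lemma norm_inv_units (u : ℤ_[p]ˣ) : ‖((u⁻¹ : ℤ_[p]ˣ) : ℤ_[p])‖ = 1 := PadicInt.norm_units _

lemma norm_lowerLeft_lt_one (g : Sigma0 p) : ‖g.1 1 0‖ < 1 :=
  (PadicInt.norm_lt_one_iff_dvd _).2 g.2.2.1

/-- The Taylor expansion of `z ↦ (b + dz)/(a + cz)`, with an estimate of its coefficients. -/
lemma exists_fracLin_series_norm_le (g : Sigma0 p) (a : ℤ_[p]) {μ : ℝ} (hμ : 0 < μ)
    (hdet : ‖g.1.det‖ ≤ μ) (hc : ‖g.1 1 0‖ ≤ μ) :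
    ∃ H : PowerSeries ℤ_[p], PowerSeries.constantCoeff H = 0 ∧
      (∀ k, ‖PowerSeries.coeff k H‖ ≤ μ ^ k) ∧
      ∀ z, HasSum (fun k => PowerSeries.coeff k H * (z - a) ^ k) (fracLin g z - fracLin g a) := by
  set u := autUnit g a with hu
  set v : ℤ_[p] := -(g.1 1 0 * ((u⁻¹ : ℤ_[p]ˣ) : ℤ_[p])) with hv
  have hvn : ‖v‖ = ‖g.1 1 0‖ := by rw [hv, norm_neg, norm_mul, norm_inv_units, mul_one]
  -- The difference is `det g · u⁻² y / (1 - v y)` with `y = z - a`; in degree `k + 1` the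
  -- determinant contributes one factor `μ` and `v^k`, with `|v| = |c|`, the other `k`.
  refine ⟨PowerSeries.C (g.1.det * ((u⁻¹ : ℤ_[p]ˣ) : ℤ_[p]) ^ 2) *
    (PowerSeries.X * PowerSeries.mk fun k => v ^ k), by simp, fun k => ?_, fun z => ?_⟩
  · cases k with
    | zero => simp
    | succ k =>
      rw [PowerSeries.coeff_C_mul, PowerSeries.coeff_succ_X_mul, PowerSeries.coeff_mk, norm_mul,
        norm_mul, norm_pow, norm_pow, norm_inv_units, one_pow, mul_one, hvn, pow_succ']
      exact mul_le_mul hdet (pow_le_pow_left₀ (norm_nonneg _) hc k) (by positivity) hμ.le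
  · set y := z - a with hy
    have hvy : ‖v * y‖ < 1 := by
      rw [norm_mul, hvn]
      exact mul_lt_one_of_nonneg_of_lt_one_left (norm_nonneg _) (norm_lowerLeft_lt_one g)
        (PadicInt.norm_le_one _)
    have hgeo : HasSum (fun k => (v * y) ^ k) (Ring.inverse (1 - v * y)) :=
      hasSum_geom_series_inverse (v * y) hvy
    have h1 : (u : ℤ_[p]) * ((u⁻¹ : ℤ_[p]ˣ) : ℤ_[p]) = 1 := u.mul_inv
    have hval : fracLin g z - fracLin g a =
        g.1.det * ((u⁻¹ : ℤ_[p]ˣ) : ℤ_[p]) ^ 2 * (y * Ring.inverse (1 - v * y)) := by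
      have hw : ((autUnit g z * u⁻¹ : ℤ_[p]ˣ) : ℤ_[p]) = 1 - v * y := by
        have h1 := h1
        rw [Units.val_mul, coe_autUnit, hv, hy]
        rw [hu, coe_autUnit] at h1
        rw [hu]
        linear_combination h1
      rw [← hw, Ring.inverse_unit, fracLin_sub, ← hu, mul_inv_rev, inv_inv, Units.val_mul, hy]
      linear_combination (-(g.1.det * ((u⁻¹ : ℤ_[p]ˣ) : ℤ_[p]) *
        (((autUnit g z)⁻¹ : ℤ_[p]ˣ) : ℤ_[p]) * (z - a))) * h1
    rw [hval, ← hasSum_nat_add_iff' 1]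
    simp only [Finset.range_one, Finset.sum_singleton, PowerSeries.coeff_C_mul,
      PowerSeries.coeff_zero_X_mul, PowerSeries.coeff_succ_X_mul, PowerSeries.coeff_mk, mul_zero,
      zero_mul, sub_zero]
    refine hasSum_of_forall_eq
      ((hgeo.mul_left y).mul_left (g.1.det * ((u⁻¹ : ℤ_[p]ˣ) : ℤ_[p]) ^ 2)) fun k => ?_
    rw [mul_pow, pow_succ]
    ring

lemma norm_fracLin_sub_le_mul (g : Sigma0 p) {μ : ℝ} (hdet : ‖g.1.det‖ ≤ μ) (z a : ℤ_[p]) :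
    ‖fracLin g z - fracLin g a‖ ≤ μ * ‖z - a‖ := by
  rw [fracLin_sub, norm_mul, norm_mul, norm_mul, norm_inv_units, norm_inv_units, mul_one, mul_one]
  exact mul_le_mul_of_nonneg_right hdet (norm_nonneg _)

variable {A : Type*} [NormedCommRing A] [NormedAlgebra ℚ_[p] A]

/-- With `W` the value of the automorphy factor at the center, `χ(autUnit g z) = χ(W) χ(1 + w(z -
a))` and `|w| = |c| ≤ μ`. So the single expansion of `χ` at `1`, of radius `s`, gives expansions of
radius `R = s/μ` with a bound independent of the center. -/
lemma exists_hasTaylor_char {μ R s : ℝ} (hR : 0 < R) (hs : s = μ * R)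
    {χ : ℤ_[p]ˣ →* A} (hχ : IsLocAnChar s χ) {B : ℝ} (hB : ∀ u, ‖χ u‖ ≤ B) (g : Sigma0 p)
    (hc : ‖g.1 1 0‖ ≤ μ) :
    ∃ K, 0 ≤ K ∧ ∀ a, ∃ b, HasTaylor R a (fun z => χ (autUnit g z)) b ∧
      ∀ n, ‖b n‖ * R ^ n ≤ K := by
  obtain ⟨β, hβ, hβ'⟩ := hχ 1
  obtain ⟨M, hM⟩ := hβ.bddAbove_range
  have hB0 : 0 ≤ B := (norm_nonneg _).trans (hB 1)
  have hM0 : 0 ≤ M := le_trans (by positivity) (hM ⟨0, rfl⟩)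
  have hcR : ‖g.1 1 0‖ * R ≤ s := hs ▸ mul_le_mul_of_nonneg_right hc hR.le
  have hs0 : 0 ≤ s := le_trans (by positivity) hcR
  refine ⟨B * M, by positivity, fun a => ?_⟩
  set W := autUnit g a with hW
  set w : ℤ_[p] := ((W⁻¹ : ℤ_[p]ˣ) : ℤ_[p]) * g.1 1 0 with hw
  have hwn : ‖(w : ℚ_[p])‖ = ‖g.1 1 0‖ := by
    rw [PadicInt.padic_norm_e_of_padicInt, hw, norm_mul, norm_inv_units, one_mul]
  have hle : ∀ n, ‖(w : ℚ_[p]) ^ n • (χ W * β n)‖ * R ^ n ≤ B * (‖β n‖ * s ^ n) := fun n => by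
    rw [norm_smul, norm_pow, hwn]
    calc ‖g.1 1 0‖ ^ n * ‖χ W * β n‖ * R ^ n = (‖g.1 1 0‖ * R) ^ n * ‖χ W * β n‖ := by
          rw [mul_pow]; ring
      _ ≤ s ^ n * (B * ‖β n‖) := by
          gcongr
          · exact (norm_mul_le _ _).trans (mul_le_mul_of_nonneg_right (hB _) (norm_nonneg _))
      _ = _ := by ring
  refine ⟨fun n => (w : ℚ_[p]) ^ n • (χ W * β n), ⟨?_, fun z hz => ?_⟩, fun n => ?_⟩
  · refine squeeze_zero (fun n => by positivity) hle ?_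
    simpa using hβ.const_mul B
  · have e1 : ((W⁻¹ * autUnit g z : ℤ_[p]ˣ) : ℤ_[p]) - (1 : ℤ_[p]ˣ) = w * (z - a) := by
      have h1 : ((W⁻¹ : ℤ_[p]ˣ) : ℤ_[p]) * (W : ℤ_[p]) = 1 := W.inv_mul
      rw [hW, coe_autUnit] at h1
      rw [Units.val_mul, coe_autUnit, Units.val_one, hw]
      linear_combination h1
    have h2 := (hβ' (W⁻¹ * autUnit g z) (by
      rw [e1, norm_mul, ← PadicInt.padic_norm_e_of_padicInt w, hwn]
      exact (mul_le_mul_of_nonneg_left hz (norm_nonneg _)).trans hcR)).mul_left (χ W)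
    rw [← map_mul, mul_inv_cancel_left] at h2
    refine hasSum_of_forall_eq h2 fun n => ?_
    rw [e1, PadicInt.coe_mul w, mul_pow, mul_smul_comm, smul_smul, mul_comm]
  · exact (hle n).trans (mul_le_mul_of_nonneg_left (hM ⟨n, rfl⟩) hB0)

variable [IsUltrametricDist A] [CompleteSpace A]

/-- Estimate of the Taylor series of `g · f`. -/
lemma exists_hasTaylor_weightAct_le {μ R s : ℝ} (hR : 0 < R) (hμ : 0 < μ) (hs : s = μ * R)
    (hs1 : s < 1) {χ : ℤ_[p]ˣ →* A} (hχ : IsLocAnChar s χ) {B : ℝ} (hB : ∀ u, ‖χ u‖ ≤ B)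
    (g : Sigma0 p) (hdet : ‖g.1.det‖ ≤ μ) (hc : ‖g.1 1 0‖ ≤ μ) :
    ∃ K, 0 ≤ K ∧ ∀ f ∈ locAn p A s, ∀ a, ∃ c, HasTaylor R a (weightAct χ g f) c ∧
      ∀ n, ‖c n‖ * R ^ n ≤ K * taylorNorm s f := by
  have hs0 : 0 < s := hs ▸ mul_pos hμ hR
  obtain ⟨K, hK, hχK⟩ := exists_hasTaylor_char hR hs hχ hB g hc
  refine ⟨K, hK, fun f hf a => ?_⟩
  obtain ⟨b, hb, hbK⟩ := hχK a
  obtain ⟨c, hc'⟩ := hf (fracLin g a)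
  obtain ⟨H, hH0, hHμ, hH⟩ := exists_fracLin_series_norm_le g a hμ hdet hc
  obtain ⟨d, hd, hdK⟩ := hc'.comp_of_norm_coeff_le hR hμ hs hs1 (u := fracLin g) hH0 hHμ
    (fun z hz => (norm_fracLin_sub_le_mul g hdet z a).trans
      ((mul_le_mul_of_nonneg_left hz hμ.le).trans_eq hs.symm)) (fun z _ => hH z)
  refine ⟨_, hb.mul hR.le hd, fun n => ?_⟩
  rw [← le_div_iff₀ (pow_pos hR n)]
  have h0 := taylorNorm_nonneg s f
  refine IsUltrametricDist.norm_sum_le_of_forall_le_of_nonneg (by positivity) fun q hq => ?_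
  rw [le_div_iff₀ (pow_pos hR n)]
  calc ‖b q.1 * d q.2‖ * R ^ n ≤ ‖b q.1‖ * ‖d q.2‖ * R ^ n :=
        mul_le_mul_of_nonneg_right (norm_mul_le _ _) (by positivity)
    _ = (‖b q.1‖ * R ^ q.1) * (‖d q.2‖ * R ^ q.2) := by
        rw [← Finset.HasAntidiagonal.mem_antidiagonal.1 hq, pow_add]; ring
    _ ≤ K * taylorNorm s f := by
        exact mul_le_mul (hbK _) (hdK _ (hc'.le_taylorNorm hs0 hf) _) (by positivity) hK

lemma exists_taylorNorm_weightAct_le {s : ℝ} (hs : 0 < s) (hs1 : s < 1) {χ : ℤ_[p]ˣ →* A}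
    (hχ : IsLocAnChar s χ) {B : ℝ} (hB : ∀ u, ‖χ u‖ ≤ B) (g : Sigma0 p) :
    ∃ K, 0 ≤ K ∧ ∀ f ∈ locAn p A s,
      weightAct χ g f ∈ locAn p A s ∧ taylorNorm s (weightAct χ g f) ≤ K * taylorNorm s f := by
  obtain ⟨K, hK, h⟩ := exists_hasTaylor_weightAct_le hs one_pos (one_mul s).symm hs1 hχ hB g
    (PadicInt.norm_le_one _) (PadicInt.norm_le_one _)
  refine ⟨K, hK, fun f hf => ⟨fun a => ?_, ?_⟩⟩
  · obtain ⟨c, hc, -⟩ := h f hf a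
    exact ⟨c, hc⟩
  · exact taylorNorm_le (mul_nonneg hK (taylorNorm_nonneg _ _)) (h f hf)

/-- `𝒟_r^†(A)` is stable under the action of `Σ₀(p)`. -/
lemma dualAct_mem_daggerDist {r : ℝ} (hr : 0 < r) (hr1 : r < 1) {χ : ℤ_[p]ˣ →* A}
    (hχ : ∃ s, 0 < s ∧ r < s ∧ IsLocAnChar s χ) {B : ℝ} (hB : ∀ u, ‖χ u‖ ≤ B)
    (hS : IsStable χ (daggerFun p A r)) (g : Sigma0 p) {Ψ : daggerFun p A r →ₗ[A] A}
    (hΨ : Ψ ∈ daggerDist p A r) : dualAct hS g Ψ ∈ daggerDist p A r := by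
  obtain ⟨t, ht, hrt, hχ⟩ := hχ
  refine mem_daggerDist_of_isBdd hr hr1 fun s hs hrs hs1 => ?_
  -- `χ` is only known to be analytic of radius `t`, so the action is estimated on a radius below
  -- both.
  have hm : 0 < min s t := lt_min hs ht
  have hrm : r < min s t := lt_min hrs hrt
  obtain ⟨K, hK, h⟩ := exists_taylorNorm_weightAct_le hm ((min_le_left _ _).trans_lt hs1)
    (hχ.mono hm.le (min_le_right _ _)) hB g
  obtain ⟨L, hL, hb⟩ := (hΨ _ hm hrm).1
  refine ⟨L * K, by positivity, fun f => ?_⟩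
  have hf := locAn_mono hm.le (min_le_left s t) f.2
  refine (hb ⟨weightAct χ g f.1, (h f.1 hf).1⟩).trans ?_
  rw [mul_assoc]
  refine mul_le_mul_of_nonneg_left ((h f.1 hf).2.trans ?_) hL
  exact mul_le_mul_of_nonneg_left (taylorNorm_mono hm (min_le_left _ _) f.2) hK

end WeightAction

/-! ### Differences of powers of integers. -/

section PowerDifferences

lemma fwdDiff_iter_id_mul (g : ℤ → ℤ) (m : ℕ) (y : ℤ) :
    (fwdDiff (1 : ℤ))^[m] (fun x => x * g x) y =
      y * (fwdDiff (1 : ℤ))^[m] g y + m * (fwdDiff (1 : ℤ))^[m - 1] g (y + 1) := by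
  induction m generalizing g with
  | zero => simp
  | succ m ih =>
    have h1 : fwdDiff (1 : ℤ) (fun x => x * g x) =
        (fun x => x * fwdDiff 1 g x) + fun x => g (x + 1) := by
      ext x
      simp only [fwdDiff, Pi.add_apply]
      ring
    rw [Function.iterate_succ_apply, h1, fwdDiff_iter_add, Pi.add_apply, ih,
      fwdDiff_iter_comp_add, ← Function.iterate_succ_apply, Nat.add_sub_cancel]
    cases m with
    | zero => simp
    | succ m =>
      rw [Nat.add_sub_cancel, ← Function.iterate_succ_apply]
      push_cast
      ring

/-- Writing `x^(k+1) = x · x^k`, the Leibniz formula yields the `m`-th difference of `x^k`, already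
divisible by `m!`, and `m` times an `(m-1)`-st difference, divisible by `m · (m-1)!`. -/
lemma factorial_dvd_fwdDiff_pow (m k : ℕ) (y : ℤ) :
    (m.factorial : ℤ) ∣ (fwdDiff (1 : ℤ))^[m] (fun x => x ^ k) y := by
  induction k generalizing m y with
  | zero =>
    cases m with
    | zero => simp
    | succ m =>
      rw [fwdDiff_iter_pow_eq_zero_of_lt (Nat.succ_pos m)]
      exact dvd_zero _
  | succ k ih =>
    simp_rw [pow_succ']
    rw [fwdDiff_iter_id_mul]
    refine dvd_add ((ih m y).mul_left _) ?_
    cases m with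
    | zero => simp
    | succ m =>
      rw [Nat.factorial_succ, Nat.add_sub_cancel, Nat.cast_mul]
      exact mul_dvd_mul_left _ (ih m _)

end PowerDifferences

/-! ### Amice's bound on the differences of locally analytic functions. -/

section AnalyticDifferences

variable {p : ℕ} [Fact p.Prime] {A : Type*} [NormedCommRing A] [NormedAlgebra ℚ_[p] A]

lemma norm_zsmul_eq (c : ℤ) (x : A) : ‖c • x‖ = ‖(c : ℚ_[p])‖ * ‖x‖ := by
  rw [← Int.cast_smul_eq_zsmul ℚ_[p], norm_smul]

variable [IsUltrametricDist A]

/-- Differences with step `q` of a function which is analytic on discs of radius `|q|`. -/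
lemma HasTaylor.norm_fwdDiff_le {q : ℕ} {R : ℝ} (hR : R = ‖(q : ℚ_[p])‖) {F : ℤ_[p] → A}
    {a : ℤ_[p]} {c : ℕ → A} (hF : HasTaylor R a F c) {K : ℝ} (hK : ∀ n, ‖c n‖ * R ^ n ≤ K) (m : ℕ) :
    ‖(fwdDiff (q : ℤ_[p]))^[m] F a‖ ≤ ‖(m.factorial : ℚ_[p])‖ * K := by
  have hK0 : 0 ≤ K := le_trans (by positivity) (hK 0)
  have h1 : ∀ j : ℕ, HasSum (fun k => ((j : ℚ_[p]) * q) ^ k • c k) (F (a + j • (q : ℤ_[p]))) := by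
    intro j
    have h := hF.2 (a + j • (q : ℤ_[p])) (by
      rw [add_sub_cancel_left, nsmul_eq_mul, norm_mul, hR, ← PadicInt.coe_natCast q,
        PadicInt.padic_norm_e_of_padicInt]
      exact mul_le_of_le_one_left (norm_nonneg _) (PadicInt.norm_le_one _))
    refine hasSum_of_forall_eq h fun k => ?_
    rw [add_sub_cancel_left, nsmul_eq_mul]
    push_cast
    rfl
  have h2 := hasSum_sum (s := Finset.range (m + 1)) fun j _ =>
    (h1 j).const_smul ((-1 : ℤ) ^ (m - j) * m.choose j)
  rw [← fwdDiff_iter_eq_sum_shift] at h2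
  rw [← h2.tsum_eq]
  refine IsUltrametricDist.norm_tsum_le_of_forall_le_of_nonneg (by positivity) fun k => ?_
  -- The `k`-th Taylor term contributes `q^k Δ^m(x^k)(0) c_k`: the power of `q` supplies the radius
  -- and the difference of `x^k` the factorial.
  obtain ⟨w, hw⟩ := factorial_dvd_fwdDiff_pow m k 0
  have h3 : ∑ j ∈ Finset.range (m + 1), ((-1 : ℤ) ^ (m - j) * m.choose j) •
      (((j : ℚ_[p]) * q) ^ k • c k) =
      ((q : ℚ_[p]) ^ k * (((m.factorial : ℤ) * w : ℤ) : ℚ_[p])) • c k := by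
    rw [← hw, fwdDiff_iter_eq_sum_shift, Int.cast_sum, Finset.mul_sum, Finset.sum_smul]
    refine Finset.sum_congr rfl fun j _ => ?_
    rw [← Int.cast_smul_eq_zsmul ℚ_[p], smul_smul]
    congr 1
    simp only [zero_add, nsmul_eq_mul, mul_one, smul_eq_mul]
    push_cast
    ring
  rw [h3, norm_smul, norm_mul, norm_pow, ← hR, Int.cast_mul, norm_mul, Int.cast_natCast]
  calc R ^ k * (‖(m.factorial : ℚ_[p])‖ * ‖(w : ℚ_[p])‖) * ‖c k‖
      = ‖(m.factorial : ℚ_[p])‖ * ‖(w : ℚ_[p])‖ * (‖c k‖ * R ^ k) := by ring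
    _ ≤ ‖(m.factorial : ℚ_[p])‖ * 1 * K := by
        have hR0 : 0 ≤ R := hR ▸ norm_nonneg _
        gcongr
        · exact Padic.norm_int_le_one w
        · exact hK k
    _ = _ := by rw [mul_one]

open fwdDiff_aux in
lemma norm_aeval_shift_le (Q : Polynomial ℤ) {G : ℤ_[p] → A} {K : ℝ} (hK : ∀ z, ‖G z‖ ≤ K)
    (y : ℤ_[p]) : ‖Polynomial.aeval (shiftₗ ℤ_[p] A 1) Q G y‖ ≤ K := by
  rw [Polynomial.aeval_eq_sum_range, LinearMap.sum_apply, Finset.sum_apply]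
  refine IsUltrametricDist.norm_sum_le_of_forall_le_of_nonneg ((norm_nonneg _).trans (hK 0))
    fun i _ => ?_
  rw [LinearMap.smul_apply, Pi.smul_apply, shiftₗ_pow_apply]
  rw [norm_zsmul_eq (p := p)]
  exact (mul_le_of_le_one_left (norm_nonneg _) (Padic.norm_int_le_one _)).trans (hK _)

open fwdDiff_aux in
-- Difference operators of all integral steps are polynomials in the unit shift, so relations among
-- them can be proved in `ℤ[X]`.
lemma aeval_shift_pow_sub_one_pow (q j : ℕ) (G : ℤ_[p] → A) :
    Polynomial.aeval (shiftₗ ℤ_[p] A 1) ((Polynomial.X ^ q - 1 : Polynomial ℤ) ^ j) G =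
      (fwdDiff (q : ℤ_[p]))^[j] G := by
  rw [← coe_fwdDiffₗ_pow, map_pow, map_sub, map_pow, Polynomial.aeval_X, map_one]
  congr 2
  ext f y
  rw [LinearMap.sub_apply, Pi.sub_apply, shiftₗ_pow_apply, nsmul_one]
  rfl

/-- The valuation of `n!` is at most `n`. -/
lemma norm_prime_pow_le_factorial (hp2 : p ≠ 2) (n : ℕ) :
    ‖(p : ℚ_[p]) ^ n‖ ≤ ‖(n.factorial : ℚ_[p])‖ := by
  rcases eq_or_ne n 0 with rfl | hn
  · simp
  have h := norm_pow_div_factorial_le (p := p) n hp2 hn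
  have h1 : (1 : ℝ) ≤ p := mod_cast (Fact.out : p.Prime).one_le
  have h2 : (p : ℝ) ^ (-(((n + 1) / 2 : ℕ) : ℤ)) ≤ 1 :=
    zpow_le_one_of_nonpos₀ h1 (by omega)
  have h3 : 0 < ‖(n.factorial : ℚ_[p])‖ := norm_pos_iff.2 (mod_cast n.factorial_ne_zero)
  rw [norm_mul, norm_inv, inv_mul_le_iff₀ h3] at h
  exact h.trans (mul_le_of_le_one_right h3.le h2)

lemma norm_choose_mul_pow_mul_factorial_le (hp2 : p ≠ 2) {m j : ℕ} (hj : j ≤ m) :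
    ‖((m.choose j * p ^ (m - j) : ℤ) : ℚ_[p])‖ * ‖(j.factorial : ℚ_[p])‖ ≤
      ‖(m.factorial : ℚ_[p])‖ := by
  rw [← Nat.choose_mul_factorial_mul_factorial hj]
  push_cast
  rw [norm_mul, norm_mul, norm_mul]
  have := norm_prime_pow_le_factorial (p := p) hp2 (m - j)
  calc _ = ‖(m.choose j : ℚ_[p])‖ * ‖(j.factorial : ℚ_[p])‖ * ‖(p : ℚ_[p]) ^ (m - j)‖ := by ring
    _ ≤ _ := by gcongr

/-- Amice's estimate: the differences of a function which is analytic on discs of radius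
`|p^h|`. -/
lemma norm_fwdDiff_le_factorial (hp2 : p ≠ 2) {h : ℕ} {F : ℤ_[p] → A} {K : ℝ}
    (hF : ∀ a, ∃ c, HasTaylor (((p : ℝ)⁻¹) ^ h) a F c ∧ ∀ n, ‖c n‖ * (((p : ℝ)⁻¹) ^ h) ^ n ≤ K)
    (n : ℕ) (y : ℤ_[p]) :
    ‖(fwdDiff (1 : ℤ_[p]))^[n] F y‖ ≤ ‖((n / p ^ h).factorial : ℚ_[p])‖ * K := by
  have hR : ((p : ℝ)⁻¹) ^ h = ‖((p ^ h : ℕ) : ℚ_[p])‖ := by simp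
  have hK0 : 0 ≤ K := by
    obtain ⟨c, -, hc⟩ := hF 0
    exact le_trans (by positivity) (hc 0)
  set q := p ^ h with hq
  set m := n / q with hm
  -- With `q = p^h`, the operator `Δ^q` is the difference of step `q` up to a multiple of `p`.
  obtain ⟨W, hW⟩ := exists_add_pow_prime_pow_eq (R := Polynomial ℤ) (Fact.out : p.Prime)
    Polynomial.X (-1) h
  have hodd : (-1 : Polynomial ℤ) ^ p ^ h = -1 :=
    Odd.neg_one_pow (((Fact.out : p.Prime).odd_of_ne_two hp2).pow)
  -- Here `m = ⌊n/q⌋`. The `j`-th term has `j` differences of step `q`, worth `j!`, and `m - j`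
  -- factors `p`; since `(m-j)!` divides `p^(m-j)` in `ℤ_p`, the coefficient times `j!` is a
  -- multiple of `m!`.
  have h1 : (Polynomial.X - 1 : Polynomial ℤ) ^ n = ∑ j ∈ Finset.range (m + 1),
      ((m.choose j * p ^ (m - j) : ℤ)) • (((Polynomial.X - 1) ^ (n % q) *
        (-Polynomial.X * W) ^ (m - j)) * (Polynomial.X ^ q - 1) ^ j) := by
    have e1 : (Polynomial.X - 1 : Polynomial ℤ) ^ q =
        (Polynomial.X ^ q - 1) + (p : Polynomial ℤ) * (-Polynomial.X * W) := by
      rw [sub_eq_add_neg, hq, hW, hodd]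
      ring
    have e2 : (Polynomial.X - 1 : Polynomial ℤ) ^ n =
        ((Polynomial.X - 1) ^ q) ^ m * (Polynomial.X - 1) ^ (n % q) := by
      rw [← pow_mul, ← pow_add, hm, Nat.div_add_mod]
    rw [e2, e1, add_pow, Finset.sum_mul]
    refine Finset.sum_congr rfl fun j _ => ?_
    rw [zsmul_eq_mul, mul_pow]
    push_cast
    ring
  have h2 : (fwdDiff (1 : ℤ_[p]))^[n] F =
      Polynomial.aeval (fwdDiff_aux.shiftₗ ℤ_[p] A 1) ((Polynomial.X - 1 : Polynomial ℤ) ^ n) F := by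
    have h3 := aeval_shift_pow_sub_one_pow 1 n F
    rw [pow_one, Nat.cast_one] at h3
    exact h3.symm
  rw [h2, h1, map_sum, LinearMap.sum_apply, Finset.sum_apply]
  refine IsUltrametricDist.norm_sum_le_of_forall_le_of_nonneg (by positivity) fun j hj => ?_
  rw [map_zsmul, LinearMap.smul_apply, Pi.smul_apply, norm_zsmul_eq (p := p), map_mul,
    Module.End.mul_apply, aeval_shift_pow_sub_one_pow]
  refine le_trans (mul_le_mul_of_nonneg_left (norm_aeval_shift_le _
    (K := ‖(j.factorial : ℚ_[p])‖ * K) (fun z => ?_) y) (norm_nonneg _)) ?_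
  · obtain ⟨c, hc, hcK⟩ := hF z
    exact hc.norm_fwdDiff_le hR hcK j
  · rw [← mul_assoc]
    exact mul_le_mul_of_nonneg_right (norm_choose_mul_pow_mul_factorial_le hp2
      (Nat.lt_succ_iff.1 (Finset.mem_range.1 hj))) hK0

end AnalyticDifferences

/-! ### Calculus of Gauss norm bounds on a fixed disc. -/

section TaylorBound

variable {p : ℕ} [Fact p.Prime] {A : Type*} [NormedCommRing A] [NormedAlgebra ℚ_[p] A]

/-- On the disc `‖z - a‖ ≤ s`, the function `f` is analytic with Gauss norm `≤ K`. -/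
def HasTaylorLE (s : ℝ) (a : ℤ_[p]) (f : ℤ_[p] → A) (K : ℝ) : Prop :=
  ∃ c, HasTaylor s a f c ∧ ∀ n, ‖c n‖ * s ^ n ≤ K

lemma HasTaylorLE.mono {s : ℝ} {a : ℤ_[p]} {f : ℤ_[p] → A} {K L : ℝ} (h : HasTaylorLE s a f K)
    (hKL : K ≤ L) : HasTaylorLE s a f L := by
  obtain ⟨c, h1, h2⟩ := h
  exact ⟨c, h1, fun n => (h2 n).trans hKL⟩

lemma HasTaylorLE.congr {s : ℝ} {a : ℤ_[p]} {f g : ℤ_[p] → A} {K : ℝ} (h : HasTaylorLE s a f K)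
    (hfg : ∀ z, ‖z - a‖ ≤ s → f z = g z) : HasTaylorLE s a g K := by
  obtain ⟨c, h1, h2⟩ := h
  exact ⟨c, h1.congr hfg, h2⟩

lemma HasTaylorLE.const_smul {s : ℝ} {a : ℤ_[p]} {f : ℤ_[p] → A} {K : ℝ}
    (h : HasTaylorLE s a f K) (r : ℚ_[p]) : HasTaylorLE s a (r • f) (‖r‖ * K) := by
  obtain ⟨c, h1, h2⟩ := h
  refine ⟨r • c, ⟨?_, fun z hz => ?_⟩, fun n => ?_⟩
  · refine ((mul_zero ‖r‖) ▸ h1.1.const_mul ‖r‖).congr fun n => ?_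
    rw [Pi.smul_apply, norm_smul, mul_assoc]
  · refine hasSum_of_forall_eq ((h1.2 z hz).const_smul r) fun n => ?_
    rw [Pi.smul_apply, smul_comm]
  · rw [Pi.smul_apply, norm_smul, mul_assoc]
    exact mul_le_mul_of_nonneg_left (h2 n) (norm_nonneg _)

lemma HasTaylorLE.zero {s : ℝ} {a : ℤ_[p]} {K : ℝ} (hK : 0 ≤ K) :
    HasTaylorLE s a (0 : ℤ_[p] → A) K :=
  ⟨0, ⟨by simp, fun z _ => by simp⟩, fun n => by simpa using hK⟩

lemma HasTaylorLE.translate {s : ℝ} {a : ℤ_[p]} {f : ℤ_[p] → A} {K : ℝ}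
    (h : HasTaylorLE s 0 f K) : HasTaylorLE s a (fun z => f (z - a)) K := by
  obtain ⟨c, h1, h2⟩ := h
  exact ⟨c, ⟨h1.1, fun z hz => by simpa using h1.2 (z - a) (by simpa using hz)⟩, h2⟩

lemma HasTaylorLE.smul_const {s : ℝ} {a : ℤ_[p]} {f : ℤ_[p] → ℚ_[p]} {K : ℝ}
    (h : HasTaylorLE s a f K) (x : A) : HasTaylorLE s a (fun z => f z • x) (K * ‖x‖) := by
  obtain ⟨c, h1, h2⟩ := h
  refine ⟨fun n => c n • x, ⟨?_, fun z hz => ?_⟩, fun n => ?_⟩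
  · refine ((zero_mul ‖x‖) ▸ h1.1.mul_const ‖x‖).congr fun n => ?_
    rw [norm_smul]
    ring
  · refine hasSum_of_forall_eq ((h1.2 z hz).smul_const x) fun n => ?_
    rw [smul_assoc]
  · rw [norm_smul, mul_right_comm]
    exact mul_le_mul_of_nonneg_right (h2 n) (norm_nonneg _)

variable [IsUltrametricDist A]

lemma HasTaylorLE.add {s : ℝ} (hs : 0 < s) {a : ℤ_[p]} {f g : ℤ_[p] → A} {K : ℝ}
    (hf : HasTaylorLE s a f K) (hg : HasTaylorLE s a g K) : HasTaylorLE s a (f + g) K := by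
  obtain ⟨c, h1, h2⟩ := hf
  obtain ⟨d, h3, h4⟩ := hg
  refine ⟨c + d, h1.add hs.le h3, fun n => ?_⟩
  rw [← le_div_iff₀ (pow_pos hs n)]
  exact (IsUltrametricDist.norm_add_le_max _ _).trans (max_le
    ((le_div_iff₀ (pow_pos hs n)).2 (h2 n)) ((le_div_iff₀ (pow_pos hs n)).2 (h4 n)))

lemma HasTaylorLE.sum {s : ℝ} (hs : 0 < s) {a : ℤ_[p]} {ι : Type*} {f : ι → ℤ_[p] → A} {K : ℝ}
    (hK : 0 ≤ K) (T : Finset ι) (h : ∀ i ∈ T, HasTaylorLE s a (f i) K) :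
    HasTaylorLE s a (∑ i ∈ T, f i) K := by
  classical
  induction T using Finset.induction_on with
  | empty => exact HasTaylorLE.zero hK
  | insert i T hi ih =>
    rw [Finset.sum_insert hi]
    exact (h i (Finset.mem_insert_self _ _)).add hs
      (ih fun j hj => h j (Finset.mem_insert_of_mem hj))

lemma HasTaylorLE.mul {s : ℝ} (hs : 0 < s) {a : ℤ_[p]} {f g : ℤ_[p] → A} {K L : ℝ}
    (hf : HasTaylorLE s a f K) (hg : HasTaylorLE s a g L) : HasTaylorLE s a (f * g) (K * L) := by
  obtain ⟨c, h1, h2⟩ := hf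
  obtain ⟨d, h3, h4⟩ := hg
  have hK : 0 ≤ K := le_trans (by positivity) (h2 0)
  have hL : 0 ≤ L := le_trans (by positivity) (h4 0)
  refine ⟨_, h1.mul hs.le h3, fun n => ?_⟩
  rw [← le_div_iff₀ (pow_pos hs n)]
  refine IsUltrametricDist.norm_sum_le_of_forall_le_of_nonneg (by positivity) fun q hq => ?_
  rw [le_div_iff₀ (pow_pos hs n)]
  calc ‖c q.1 * d q.2‖ * s ^ n ≤ ‖c q.1‖ * ‖d q.2‖ * s ^ n :=
        mul_le_mul_of_nonneg_right (norm_mul_le _ _) (by positivity)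
    _ = (‖c q.1‖ * s ^ q.1) * (‖d q.2‖ * s ^ q.2) := by
        rw [← Finset.HasAntidiagonal.mem_antidiagonal.1 hq, pow_add]; ring
    _ ≤ K * L := mul_le_mul (h2 _) (h4 _) (by positivity) hK

lemma HasTaylor.continuousAt {s : ℝ} (hs : 0 < s) {a : ℤ_[p]} {f : ℤ_[p] → A} {c : ℕ → A}
    (h : HasTaylor s a f c) : ContinuousAt f a := by
  obtain ⟨M, hM0, hM⟩ := h.exists_bound
  rw [ContinuousAt, tendsto_iff_norm_sub_tendsto_zero]
  have hlim : Tendsto (fun z => M / s * ‖z - a‖) (𝓝 a) (𝓝 0) := by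
    have : Tendsto (fun z => ‖z - a‖) (𝓝 a) (𝓝 0) :=
      tendsto_iff_norm_sub_tendsto_zero.1 tendsto_id
    simpa using this.const_mul (M / s)
  refine squeeze_zero' (Eventually.of_forall fun z => norm_nonneg _) ?_ hlim
  filter_upwards [Metric.closedBall_mem_nhds a hs] with z hz
  rw [mem_closedBall_iff_norm] at hz
  have h2 := (hasSum_nat_add_iff' 1).2 (h.2 z hz)
  rw [Finset.sum_range_one, pow_zero, one_smul, h.apply_center hs.le] at h2
  rw [← h2.tsum_eq]
  refine IsUltrametricDist.norm_tsum_le_of_forall_le_of_nonneg (by positivity) fun n => ?_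
  rw [norm_smul, norm_pow, PadicInt.padic_norm_e_of_padicInt, pow_succ]
  calc ‖z - a‖ ^ n * ‖z - a‖ * ‖c (n + 1)‖ ≤ s ^ n * ‖z - a‖ * ‖c (n + 1)‖ := by gcongr
    _ = (‖c (n + 1)‖ * s ^ (n + 1)) / s * ‖z - a‖ := by field_simp; ring
    _ ≤ M / s * ‖z - a‖ := by gcongr; exact hM _

end TaylorBound

/-! ### Gauss norms of the binomial functions. -/

section MahlerTaylor

variable {p : ℕ} [Fact p.Prime]

lemma succ_mul_mahler_succ (j : ℕ) (z : ℤ_[p]) :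
    ((j : ℤ_[p]) + 1) * mahler (j + 1) z = (z - j) * mahler j z := by
  have h : (fun z : ℤ_[p] => ((j : ℤ_[p]) + 1) * mahler (j + 1) z) =
      fun z : ℤ_[p] => (z - j) * mahler j z :=
    PadicInt.denseRange_natCast.equalizer (by fun_prop) (by fun_prop) (by
    ext1 n
    simp only [Function.comp_apply, mahler_natCast_eq]
    rcases le_or_gt j n with hj | hj
    · have := Nat.choose_succ_right_eq n j
      rw [← Nat.cast_sub hj]
      norm_cast
      rw [mul_comm, this, mul_comm]
    · rw [Nat.choose_eq_zero_of_lt hj, Nat.choose_eq_zero_of_lt (by omega)]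
      simp)
  exact congrFun h z

/-- The bound `∏_{i=1}^n max(1, s/|i|)` for the Gauss norm of `binom(z, n)` on discs of
radius `s`. -/
def mahlerGauss (p : ℕ) [Fact p.Prime] (s : ℝ) (n : ℕ) : ℝ :=
  ∏ i ∈ Finset.range n, max 1 (s / ‖((i + 1 : ℕ) : ℚ_[p])‖)

lemma one_le_mahlerGauss (s : ℝ) (n : ℕ) : 1 ≤ mahlerGauss p s n := by
    induction n with
    | zero => simp [mahlerGauss]
    | succ n ih =>
      rw [mahlerGauss, Finset.prod_range_succ]
      exact one_le_mul_of_one_le_of_one_le ih (le_max_left _ _)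

lemma mahlerGauss_mono (s : ℝ) : Monotone (mahlerGauss p s) :=
  monotone_nat_of_le_succ fun n => by
    rw [mahlerGauss, mahlerGauss, Finset.prod_range_succ]
    exact le_mul_of_one_le_right (zero_le_one.trans (one_le_mahlerGauss s n)) (le_max_left _ _)

lemma norm_natCast_succ_pos (n : ℕ) : 0 < ‖((n + 1 : ℕ) : ℚ_[p])‖ :=
  norm_pos_iff.2 (Nat.cast_ne_zero.2 n.succ_ne_zero)

lemma norm_natCast_le_one (n : ℕ) : ‖(n : ℚ_[p])‖ ≤ 1 := by
  simpa using Padic.norm_int_le_one (p := p) n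

/-- Passing from `binom(z, j)` to `binom(z, j+1)` multiplies by `(z - j)/(j + 1)`, of Gauss norm
`max(|j|, s)/|j+1|`. The bound `K ≤ mahlerGauss p s j` alone is not preserved when `|j| > s`; the
first inequality, which anticipates the next factor `z - j`, is. -/
lemma hasTaylorLE_mahler_zero_aux {s : ℝ} (hs : 0 < s) (j : ℕ) :
    ∃ K : ℝ, K * max ‖(j : ℚ_[p])‖ s ≤ s * mahlerGauss p s j ∧ K ≤ mahlerGauss p s j ∧
      HasTaylorLE s (0 : ℤ_[p]) (fun z => ((mahler j z : ℤ_[p]) : ℚ_[p])) K := by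
  induction j with
  | zero =>
    refine ⟨1, ?_, le_rfl, Pi.single 0 1, ?_, fun n => ?_⟩
    · simp [mahlerGauss, hs.le]
    · refine hasTaylor_of_eventually_zero (N := 1)
        (fun k hk => Pi.single_eq_of_ne (by omega) _) fun z => ?_
      simp [mahler_apply]
    · cases n <;> simp
  | succ j ih =>
    obtain ⟨K, h1, -, h3⟩ := ih
    have hj := norm_natCast_succ_pos (p := p) j
    have hlin : HasTaylorLE s (0 : ℤ_[p]) (fun z : ℤ_[p] => (z : ℚ_[p]) - j) (max ‖(j : ℚ_[p])‖ s) := by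
      refine ⟨fun n => if n = 0 then -(j : ℚ_[p]) else if n = 1 then 1 else 0, ?_, fun n => ?_⟩
      · refine hasTaylor_of_eventually_zero (N := 2) (fun k hk => ?_) fun z => ?_
        · rw [if_neg (by omega), if_neg (by omega)]
        · simp [Finset.sum_range_succ]
          ring
      · rcases n with _ | _ | n
        · simp
        · simp
        · simp [hs.le]
    have h4 := (h3.mul hs hlin).const_smul ((j + 1 : ℕ) : ℚ_[p])⁻¹
    have hG : mahlerGauss p s (j + 1) =
        mahlerGauss p s j * max 1 (s / ‖((j + 1 : ℕ) : ℚ_[p])‖) := Finset.prod_range_succ _ _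
    have hG0 : 0 ≤ mahlerGauss p s j := zero_le_one.trans (one_le_mahlerGauss s j)
    refine ⟨_, ?_, ?_, h4.congr fun z _ => ?_⟩
    · rw [hG, norm_inv]
      have e : max ‖((j + 1 : ℕ) : ℚ_[p])‖ s =
          ‖((j + 1 : ℕ) : ℚ_[p])‖ * max 1 (s / ‖((j + 1 : ℕ) : ℚ_[p])‖) := by
        rw [mul_max_of_nonneg _ _ hj.le, mul_one, mul_div_cancel₀ _ hj.ne']
      rw [e]
      calc _ = K * max ‖(j : ℚ_[p])‖ s * max 1 (s / ‖((j + 1 : ℕ) : ℚ_[p])‖) := by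
            field_simp
        _ ≤ s * mahlerGauss p s j * max 1 (s / ‖((j + 1 : ℕ) : ℚ_[p])‖) := by gcongr
        _ = _ := by ring
    · rw [hG, norm_inv]
      calc _ ≤ ‖((j + 1 : ℕ) : ℚ_[p])‖⁻¹ * (s * mahlerGauss p s j) := by gcongr
        _ = mahlerGauss p s j * (s / ‖((j + 1 : ℕ) : ℚ_[p])‖) := by field_simp
        _ ≤ _ := by gcongr; exact le_max_right _ _
    · have h5 := congrArg (fun x : ℤ_[p] => (x : ℚ_[p])) (succ_mul_mahler_succ j z)
      have hne : ((j + 1 : ℕ) : ℚ_[p]) ≠ 0 := norm_pos_iff.1 hj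
      push_cast at h5 hne
      simp only [Pi.smul_apply, Pi.mul_apply, smul_eq_mul]
      push_cast
      rw [inv_mul_eq_iff_eq_mul₀ hne, h5]
      ring

/-- The Gauss norms of the Mahler functions on discs of radius `s`. -/
lemma hasTaylorLE_mahler {s : ℝ} (hs : 0 < s) (a : ℤ_[p]) (n : ℕ) :
    HasTaylorLE s a (fun z => ((mahler n z : ℤ_[p]) : ℚ_[p])) (mahlerGauss p s n) := by
  have hG0 : 0 ≤ mahlerGauss p s n := zero_le_one.trans (one_le_mahlerGauss s n)
  have h : ∀ q ∈ Finset.HasAntidiagonal.antidiagonal n, HasTaylorLE s a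
      (((mahler q.2 a : ℤ_[p]) : ℚ_[p]) • fun z => ((mahler q.1 (z - a) : ℤ_[p]) : ℚ_[p]))
      (mahlerGauss p s n) := by
    intro q hq
    obtain ⟨K, -, hK, h⟩ := hasTaylorLE_mahler_zero_aux (p := p) hs q.1
    have hle : mahlerGauss p s q.1 ≤ mahlerGauss p s n := mahlerGauss_mono s (by
      have := Finset.HasAntidiagonal.mem_antidiagonal.1 hq
      omega)
    refine ((h.translate (a := a)).mono (hK.trans hle) |>.const_smul _).mono ?_
    exact mul_le_of_le_one_left hG0 (by
      rw [PadicInt.padic_norm_e_of_padicInt]; exact PadicInt.norm_le_one _)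
  refine (HasTaylorLE.sum hs hG0 _ h).congr fun z _ => ?_
  -- Vandermonde's identity moves the center from `0` to `a`, with coefficients `binom(a, j)` in
  -- `ℤ_p`.
  have h2 := Ring.add_choose_eq (r := z - a) (s := a) n (Commute.all _ _)
  rw [sub_add_cancel] at h2
  have h3 := congrArg (fun x : ℤ_[p] => (x : ℚ_[p])) h2
  simp only [PadicInt.coe_sum] at h3
  rw [mahler_apply, h3, Finset.sum_apply]
  refine Finset.sum_congr rfl fun q _ => ?_
  simp only [Pi.smul_apply, smul_eq_mul, mahler_apply]
  push_cast
  ring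

end MahlerTaylor

/-! ### Factorials against Gauss norms of binomials. -/

section Decay

variable {p : ℕ} [Fact p.Prime]

/-- A factor exceeds `1` only if `|i| < s < p^(-h)`, which forces `p^h ∣ i`. So only the multiples
of `p^h` up to `n` remain. -/
lemma mahlerGauss_le {s : ℝ} {h : ℕ} (hs : s < ((p : ℝ)⁻¹) ^ h) (n : ℕ) :
    mahlerGauss p s n ≤ ∏ i ∈ Finset.range (n / p ^ h),
      max 1 (s / (((p : ℝ)⁻¹) ^ h * ‖((i + 1 : ℕ) : ℚ_[p])‖)) := by
  have hp := (Fact.out : p.Prime)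
  induction n with
  | zero => simp [mahlerGauss]
  | succ n ih =>
    rw [mahlerGauss, Finset.prod_range_succ, ← mahlerGauss, Nat.succ_div]
    split_ifs with hd
    · rw [Finset.prod_range_succ]
      have e : n + 1 = p ^ h * (n / p ^ h + 1) := by
        have := Nat.succ_div (a := n) (b := p ^ h)
        rw [if_pos hd] at this
        rw [← this]
        exact (Nat.mul_div_cancel' hd).symm
      have e2 : ‖((n + 1 : ℕ) : ℚ_[p])‖ =
          ((p : ℝ)⁻¹) ^ h * ‖((n / p ^ h + 1 : ℕ) : ℚ_[p])‖ := by
        conv_lhs => rw [e, Nat.cast_mul, norm_mul, Nat.cast_pow, norm_pow, Padic.norm_p]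
      rw [e2]
      gcongr
    · rw [add_zero]
      refine le_trans (le_of_eq ?_) ih
      have h1 : s / ‖((n + 1 : ℕ) : ℚ_[p])‖ ≤ 1 := by
        rw [div_le_one (norm_natCast_succ_pos n)]
        refine le_of_not_gt fun hlt => hd ?_
        have h3 : ‖((n + 1 : ℕ) : ℤ_[p])‖ ≤ (p : ℝ) ^ (-(h : ℤ)) := by
          rw [← PadicInt.padic_norm_e_of_padicInt, PadicInt.coe_natCast, zpow_neg, zpow_natCast,
            ← inv_pow]
          exact (hlt.trans hs).le
        have h4 := padic_dvd_pow_iff.2 h3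
        have h5 : ((p ^ h : ℕ) : ℤ) ∣ ((n + 1 : ℕ) : ℤ) := by
          rw [Nat.cast_pow, ← PadicInt.pow_p_dvd_int_iff]
          exact_mod_cast h4
        exact_mod_cast h5
      rw [max_eq_left h1, mul_one]

/-- All factors are at most one, and every `p`-th of them is at most `max(1/p, θ) < 1`. -/
lemma tendsto_prod_max {θ : ℝ} (hθ0 : 0 ≤ θ) (hθ : θ < 1) :
    Tendsto (fun m => ∏ i ∈ Finset.range m, max ‖((i + 1 : ℕ) : ℚ_[p])‖ θ) atTop (𝓝 0) := by
  have hp := (Fact.out : p.Prime)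
  set E : ℕ → ℝ := fun m => ∏ i ∈ Finset.range m, max ‖((i + 1 : ℕ) : ℚ_[p])‖ θ with hE
  have hsucc : ∀ m, E (m + 1) = E m * max ‖((m + 1 : ℕ) : ℚ_[p])‖ θ := fun m =>
    Finset.prod_range_succ _ _
  have hE0 : ∀ m, 0 ≤ E m := fun m =>
    Finset.prod_nonneg fun i _ => (norm_nonneg _).trans (le_max_left _ _)
  have hanti : Antitone E := antitone_nat_of_succ_le fun m => by
    rw [hsucc]
    exact mul_le_of_le_one_right (hE0 m) (max_le (norm_natCast_le_one _) hθ.le)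
  set η := max ((p : ℝ)⁻¹) θ with hη
  have hη0 : 0 ≤ η := hθ0.trans (le_max_right _ _)
  have hη1 : η < 1 := max_lt (inv_lt_one_of_one_lt₀ (mod_cast hp.one_lt)) hθ
  have hpow : ∀ j, E (p * j) ≤ η ^ j := by
    intro j
    induction j with
    | zero => simp [hE]
    | succ j ih =>
      obtain ⟨k, hk⟩ := Nat.exists_eq_succ_of_ne_zero (hp.ne_zero)
      have e : p * (j + 1) = (p * j + k) + 1 := by rw [mul_add]; omega
      rw [e, hsucc, pow_succ]
      refine mul_le_mul ((hanti (by omega)).trans ih) ?_ (by positivity) (by positivity)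
      rw [← e, Nat.cast_mul, norm_mul, Padic.norm_p]
      refine max_le_max ?_ le_rfl
      exact mul_le_of_le_one_right (by positivity) (norm_natCast_le_one _)
  have hdiv : Tendsto (fun m => m / p) atTop atTop := Nat.tendsto_div_const_atTop hp.ne_zero
  refine squeeze_zero hE0 (fun m => ?_) ((tendsto_pow_atTop_nhds_zero_of_lt_one hη0 hη1).comp hdiv)
  exact (hanti (Nat.mul_div_le m p)).trans (hpow _)

/-- The factors of the factorial cancel the denominators `|i|`, leaving the product of `max(|i|, θ)`
with `θ = s p^h < 1`. -/
lemma tendsto_factorial_mul_mahlerGauss {s : ℝ} {h : ℕ} (hs0 : 0 < s) (hs : s < ((p : ℝ)⁻¹) ^ h) :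
    Tendsto (fun n => mahlerGauss p s n * ‖((n / p ^ h).factorial : ℚ_[p])‖) atTop (𝓝 0) := by
  have hp := (Fact.out : p.Prime)
  have hq : (0 : ℝ) < ((p : ℝ)⁻¹) ^ h := hs0.trans hs
  have hdiv : Tendsto (fun n => n / p ^ h) atTop atTop :=
    Nat.tendsto_div_const_atTop (pow_ne_zero _ hp.ne_zero)
  refine squeeze_zero (fun n => mul_nonneg (zero_le_one.trans (one_le_mahlerGauss s n))
    (norm_nonneg _)) (fun n => ?_)
    ((tendsto_prod_max (p := p) (div_nonneg hs0.le hq.le) ((div_lt_one hq).2 hs)).comp hdiv)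
  refine (mul_le_mul_of_nonneg_right (mahlerGauss_le hs n) (norm_nonneg _)).trans_eq ?_
  rw [← Finset.prod_range_add_one_eq_factorial, Nat.cast_prod, norm_prod, Function.comp_apply,
    ← Finset.prod_mul_distrib]
  refine Finset.prod_congr rfl fun i _ => ?_
  have hi := norm_natCast_succ_pos (p := p) i
  rw [max_mul_of_nonneg _ _ hi.le, one_mul, div_mul_eq_mul_div, mul_div_mul_right _ _ hi.ne']

end Decay

/-! ### Uniform convergence of Mahler series. -/

section MahlerSeries

variable {p : ℕ} [Fact p.Prime] {A : Type*} [NormedCommRing A] [NormedAlgebra ℚ_[p] A]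
  [IsUltrametricDist A] [CompleteSpace A]

/-- Mahler's theorem for functions with values in a Banach algebra over `ℚ_p`. -/
lemma hasSum_mahler_smul {F : ℤ_[p] → A} (hF : Continuous F) (z : ℤ_[p]) :
    HasSum (fun n => ((mahler n z : ℤ_[p]) : ℚ_[p]) • (fwdDiff (1 : ℤ_[p]))^[n] F 0) (F z) := by
  let _ : Module ℤ_[p] A := Module.compHom A (algebraMap ℤ_[p] ℚ_[p])
  have hsmul : ∀ (x : ℤ_[p]) (y : A), x • y = (x : ℚ_[p]) • y := fun _ _ => rfl
  have : IsBoundedSMul ℤ_[p] A := IsBoundedSMul.of_norm_smul_le fun x y => by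
    rw [hsmul, ← PadicInt.padic_norm_e_of_padicInt]
    exact norm_smul_le _ _
  have h := PadicInt.hasSum_mahler (⟨F, hF⟩ : C(ℤ_[p], A))
  refine hasSum_of_forall_eq (ContinuousMap.hasSum_apply h z) fun n => ?_
  rw [← hsmul, PadicInt.mahlerTerm_apply]
  rfl

/-- The remainder of the Mahler series of a function which is analytic on discs of radius `|p^h|`
tends to zero in Gauss norm on the smaller discs of radius `s`. -/
lemma eventually_hasTaylorLE_sub_mahler (hp2 : p ≠ 2) {s : ℝ} {h : ℕ} (hs0 : 0 < s)
    (hs : s < ((p : ℝ)⁻¹) ^ h) {ε : ℝ} (hε : 0 < ε) :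
    ∀ᶠ k in atTop, ∀ (F : ℤ_[p] → A) (K : ℝ),
      (∀ a, HasTaylorLE (((p : ℝ)⁻¹) ^ h) a F K) → ∀ a,
        HasTaylorLE s a (fun z => F z - ∑ n ∈ Finset.range k,
          ((mahler n z : ℤ_[p]) : ℚ_[p]) • (fwdDiff (1 : ℤ_[p]))^[n] F 0) (ε * K) := by
  -- Amice's bound has a factorial with `⌊n/p^h⌋` and the binomials have Gauss norm at most
  -- `mahlerGauss p s n`; the product tends to zero independently of `F`.
  have hlim := tendsto_factorial_mul_mahlerGauss (p := p) hs0 hs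
  obtain ⟨k₀, hk₀⟩ := eventually_atTop.1 (hlim.eventually_le_const hε)
  filter_upwards [eventually_ge_atTop k₀] with k hk F K hF a
  have hcont : Continuous F := continuous_iff_continuousAt.2 fun b => by
    obtain ⟨c, hc, -⟩ := hF b
    exact hc.continuousAt (hs0.trans hs)
  have hK : 0 ≤ K := by
    obtain ⟨c, -, hc⟩ := hF 0
    exact le_trans (by have := hs0.trans hs; positivity) (hc 0)
  have hd := norm_fwdDiff_le_factorial (A := A) hp2 (F := F) (K := K) hF
  have hterm : ∀ n, HasTaylorLE s a (fun z => ((mahler (n + k) z : ℤ_[p]) : ℚ_[p]) •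
      (fwdDiff (1 : ℤ_[p]))^[n + k] F 0)
      (mahlerGauss p s (n + k) * ‖(((n + k) / p ^ h).factorial : ℚ_[p])‖ * K) := fun n => by
    refine ((hasTaylorLE_mahler hs0 a (n + k)).smul_const _).mono ?_
    rw [mul_assoc]
    exact mul_le_mul_of_nonneg_left (hd _ _) (zero_le_one.trans (one_le_mahlerGauss s _))
  choose τ hτ hτK using hterm
  refine ⟨_, HasTaylor.hasSum hs0 hτ hτK ?_ fun z _ => ?_, fun n => norm_tsum_taylor_le hs0
    (fun m j => (hτK m j).trans (mul_le_mul_of_nonneg_right (hk₀ _ (by omega)) hK)) n⟩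
  · have := ((tendsto_add_atTop_iff_nat k).2 hlim).mul_const K
    rwa [zero_mul] at this
  · exact (hasSum_nat_add_iff' k).2 (hasSum_mahler_smul hcont z)

/-- The Mahler series of `g · f` converges uniformly for `f` in the unit ball of `A_s(A)`, if the
lower right entry of `g` is divisible by `p`. -/
lemma eventually_taylorNorm_weightAct_sub_mahler_le (hp2 : p ≠ 2) {s : ℝ} (hs0 : 0 < s)
    (hs1 : s < 1) {χ : ℤ_[p]ˣ →* A} (hχ : IsLocAnChar s χ) {B : ℝ} (hB : ∀ u, ‖χ u‖ ≤ B)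
    (g : Sigma0 p) (hg : (p : ℤ_[p]) ∣ g.1 1 1) {ε : ℝ} (hε : 0 < ε) :
    ∀ᶠ k in atTop, ∀ f ∈ locAn p A s,
      (fun z => weightAct χ g f z - ∑ n ∈ Finset.range k, ((mahler n z : ℤ_[p]) : ℚ_[p]) •
        (fwdDiff (1 : ℤ_[p]))^[n] (weightAct χ g f) 0) ∈ locAn p A s ∧
      taylorNorm s (fun z => weightAct χ g f z - ∑ n ∈ Finset.range k,
        ((mahler n z : ℤ_[p]) : ℚ_[p]) • (fwdDiff (1 : ℤ_[p]))^[n] (weightAct χ g f) 0) ≤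
          ε * taylorNorm s f := by
  have hp := (Fact.out : p.Prime)
  have hp0 : (0 : ℝ) < (p : ℝ)⁻¹ := inv_pos.2 (mod_cast hp.pos)
  obtain ⟨h, h1, h2⟩ := exists_level (p := p) hs0 hs1
  have hs' : (0 : ℝ) < (p : ℝ)⁻¹ ^ (h + 1) := pow_pos hp0 _
  have hdvd : ∀ {x : ℤ_[p]}, (p : ℤ_[p]) ∣ x → ‖x‖ ≤ (p : ℝ)⁻¹ := fun {x} ⟨y, hy⟩ => by
    rw [hy, norm_mul, PadicInt.norm_p]
    exact mul_le_of_le_one_right hp0.le (PadicInt.norm_le_one _)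
  -- The gain behind compactness, with `μ = 1/p`: from `f` analytic of radius `p^(-h-1) ≤ s` one
  -- gets `g · f` analytic of radius `p^(-h) > s`. Both the determinant and the lower left entry of
  -- `g` are divisible by `p`.
  obtain ⟨K, hK, hKf⟩ := exists_hasTaylor_weightAct_le (A := A) (pow_pos hp0 h) hp0 (pow_succ' _ _)
    (h1.trans_lt hs1) (hχ.mono hs'.le h1) hB g
    (hdvd (by rw [Matrix.det_fin_two]; exact dvd_sub (hg.mul_left _) (g.2.2.1.mul_left _)))
    (hdvd g.2.2.1)
  filter_upwards [eventually_hasTaylorLE_sub_mahler (A := A) hp2 hs0 h2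
    (show 0 < ε / (K + 1) by positivity)] with k hk f hf
  have h3 := hk (weightAct χ g f) _ fun a => hKf f (locAn_mono hs'.le h1 hf) a
  have h0 := taylorNorm_nonneg s f
  have h4 : ε / (K + 1) * (K * taylorNorm ((p : ℝ)⁻¹ ^ (h + 1)) f) ≤ ε * taylorNorm s f := by
    calc _ ≤ ε / (K + 1) * ((K + 1) * taylorNorm s f) := by
          refine mul_le_mul_of_nonneg_left ?_ (by positivity)
          exact mul_le_mul (by linarith) (taylorNorm_mono hs' h1 hf) (taylorNorm_nonneg _ _)
            (by linarith)
      _ = ε * taylorNorm s f := by field_simp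
  refine ⟨fun a => ?_, taylorNorm_le (by positivity) fun a => (h3 a).mono h4⟩
  obtain ⟨c, hc, -⟩ := h3 a
  exact ⟨c, hc⟩

end MahlerSeries

/-! ### Compatibility of the integral and analytic pictures under `κ`. -/

section Specialization

variable {p : ℕ} [Fact p.Prime]

lemma fwdDiff_comp_ringHom {R R' : Type*} [CommRing R] [CommRing R'] (κ : R →+* R')
    (f : ℤ_[p] → R) (n : ℕ) (z : ℤ_[p]) :
    (fwdDiff (1 : ℤ_[p]))^[n] (fun z => κ (f z)) z = κ ((fwdDiff (1 : ℤ_[p]))^[n] f z) := by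
  rw [fwdDiff_iter_eq_sum_shift, fwdDiff_iter_eq_sum_shift, map_sum]
  exact Finset.sum_congr rfl fun k _ => (map_zsmul κ _ _).symm

lemma weightAct_tautChar {R : Type*} [CommRing R] (κ : Iwasawa p →+* R) (g : Sigma0 p)
    (f : ℤ_[p] → Iwasawa p) :
    weightAct (tautChar κ) g (fun z => κ (f z)) = fun z => κ (weightAct univChar g f z) :=
  funext fun _ => (map_mul κ _ _).symm

variable {A : Type*} [NormedCommRing A] [NormedAlgebra ℚ_[p] A] {κ : Iwasawa p →+* A}

lemma exists_norm_tautChar_le (hκ : Continuous κ) : ∃ B, ∀ u, ‖tautChar κ u‖ ≤ B := by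
  obtain ⟨B, hB⟩ := isCompact_univ.exists_bound_of_continuousOn hκ.continuousOn
  exact ⟨B, fun u => hB _ (Set.mem_univ _)⟩

/-- Both sides are continuous and agree on the dense subset of natural numbers; hence `κ` carries
Mahler functions to Mahler functions. -/
lemma map_algebraMap_eq_smul_one (hκ : Continuous κ) (z : ℤ_[p]) :
    κ (algebraMap ℤ_[p] (Iwasawa p) z) = (z : ℚ_[p]) • (1 : A) := by
  have h : (fun z : ℤ_[p] => κ (algebraMap ℤ_[p] (Iwasawa p) z)) =
      fun z : ℤ_[p] => (z : ℚ_[p]) • (1 : A) :=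
    PadicInt.denseRange_natCast.equalizer (hκ.comp continuous_algebraMap_iwasawa)
      (continuous_subtype_val.smul continuous_const) (funext fun n => by
        simp [Nat.cast_smul_eq_nsmul])
  exact congrFun h z

variable [IsUltrametricDist A]

lemma norm_fwdDiff_le_of_forall_le {f : ℤ_[p] → A} {K : ℝ} (hf : ∀ z, ‖f z‖ ≤ K) (n : ℕ)
    (z : ℤ_[p]) : ‖(fwdDiff (1 : ℤ_[p]))^[n] f z‖ ≤ K := by
  rw [fwdDiff_iter_eq_sum_shift]
  refine IsUltrametricDist.norm_sum_le_of_forall_le_of_nonneg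
    ((norm_nonneg _).trans (hf z)) fun k _ => ?_
  rw [norm_zsmul_eq (p := p)]
  exact (mul_le_of_le_one_left (norm_nonneg _) (Padic.norm_int_le_one _)).trans (hf _)

variable (A) in
/-- The Mahler function `binom(z, n)` in `𝒜_r^†(A)`. -/
def mahlerDagger {r : ℝ} (hr1 : r < 1) (n : ℕ) : daggerFun p A r :=
  ⟨fun z => ((mahler n z : ℤ_[p]) : ℚ_[p]) • (1 : A), 1, one_pos, hr1, fun a => by
    obtain ⟨c, hc, -⟩ := (hasTaylorLE_mahler one_pos a n).smul_const (1 : A)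
    exact ⟨c, hc⟩⟩

lemma mahlerDagger_mem_locAn {r : ℝ} (hr1 : r < 1) {s : ℝ} (hs : 0 < s) (n : ℕ) :
    (mahlerDagger (p := p) A hr1 n).1 ∈ locAn p A s := fun a => by
  obtain ⟨c, hc, -⟩ := (hasTaylorLE_mahler hs a n).smul_const (1 : A)
  exact ⟨c, hc⟩

variable (p A) in
/-- The functional on `𝒜_r^†(A)` given by the `n`-th Mahler coefficient. -/
def deltaDagger (r : ℝ) (n : ℕ) : daggerFun p A r →ₗ[A] A where
  toFun f := (fwdDiff (1 : ℤ_[p]))^[n] f.1 0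
  map_add' f g := by
    rw [Submodule.coe_add, fwdDiff_iter_add]
    rfl
  map_smul' a f := by
    rw [Submodule.coe_smul, fwdDiff_iter_const_smul]
    rfl

lemma deltaDagger_mem [CompleteSpace A] {r : ℝ} (hr : 0 < r) (hr1 : r < 1) (n : ℕ) :
    deltaDagger p A r n ∈ daggerDist p A r :=
  mem_daggerDist_of_isBdd hr hr1 fun s hs hrs _ => ⟨1, zero_le_one, fun f => by
    rw [one_mul]
    exact norm_fwdDiff_le_of_forall_le (norm_apply_le_taylorNorm hs f.2) n 0⟩

end Specialization

/-! ### Mahler truncations of analytic symbols, and the matrix of `U_p` on them. -/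

section AnalyticUp

variable {p : ℕ} [Fact p.Prime] {A : Type*} [NormedCommRing A] [NormedAlgebra ℚ_[p] A]
  [IsUltrametricDist A] [CompleteSpace A] {κ : Iwasawa p →+* A} {r : ℝ}
  {hS : IsStable (tautChar κ) (daggerFun p A r)} {N d : ℕ} {e : Fin d → degZeroDiv (cuspSet N)}
  (he : IsFreeBasis (cuspSet N) (p * N) e)

/-- The symbol with values in `𝒟_r^†(A)` whose value at `e_i` is the `n`-th Mahler coefficient,
projected to the part where `[-1] = 1`, if `i = j`, and zero otherwise. -/
def deltaSymbDagger (hr : 0 < r) (hr1 : r < 1)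
    (hD : ∀ g, ∀ μ ∈ daggerDist p A r, dualAct hS g μ ∈ daggerDist p A r) (n : ℕ) (j : Fin d) :
    Symb N hS (daggerDist p A r) :=
  mkSymb he hD (fun i => if i = j then κ (projPlus p) • deltaDagger p A r n else 0)
    (fun i => by
      split_ifs
      · exact Submodule.smul_mem _ _ (deltaDagger_mem hr hr1 n)
      · exact zero_mem _)
    (fun i => by
      split_ifs
      · rw [smul_smul]
        exact congrArg (· • deltaDagger p A r n) ((map_mul κ _ _).symm.trans
          (congrArg κ univChar_neg_one_mul_projPlus))
      · rw [smul_zero])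

variable (hr : 0 < r) (hr1 : r < 1)
  (hD : ∀ g, ∀ μ ∈ daggerDist p A r, dualAct hS g μ ∈ daggerDist p A r)

lemma deltaSymbDagger_apply (n : ℕ) (j i : Fin d) (f : daggerFun p A r) :
    (deltaSymbDagger he hr hr1 hD n j).1 (e i) f =
      if i = j then κ (projPlus p) * (fwdDiff (1 : ℤ_[p]))^[n] f.1 0 else 0 := by
  rw [deltaSymbDagger, mkSymb_apply]
  split_ifs <;> rfl

lemma sum_fin_mul_eq [NeZero d] {M : Type*} [AddCommMonoid M] (k : ℕ) (G : ℕ → Fin d → M) :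
    ∑ i : Fin (k * d), G (i / d) (Fin.ofNat d i) = ∑ n ∈ Finset.range k, ∑ j, G n j := by
  rw [← finProdFinEquiv.sum_comp, Fintype.sum_prod_type, ← Fin.sum_univ_eq_sum_range
    (fun n => ∑ j, G n j)]
  refine Finset.sum_congr rfl fun n _ => Finset.sum_congr rfl fun j _ => ?_
  have h : ((finProdFinEquiv (n, j) : Fin (k * d)) : ℕ) = n * d + j := by
    rw [finProdFinEquiv_apply_val, add_comm, mul_comm]
  rw [h, mul_add_div_fin, ofNat_mul_add_fin]

/-- The difference of a symbol and the truncation of its Mahler expansion. -/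
lemma sub_sum_deltaSymbDagger_apply [NeZero d] (hp2 : p ≠ 2) (φ : Symb N hS (daggerDist p A r))
    (k : ℕ) (j : Fin d) (f : daggerFun p A r) :
    (φ - ∑ i : Fin (k * d), φ.1 (e (Fin.ofNat d i)) (mahlerDagger A hr1 (i / d)) •
      deltaSymbDagger he hr hr1 hD (i / d) (Fin.ofNat d i)).1 (e j) f =
    φ.1 (e j) (f - ∑ n ∈ Finset.range k,
      (fwdDiff (1 : ℤ_[p]))^[n] f.1 0 • mahlerDagger A hr1 n) := by
  rw [sum_fin_mul_eq k fun n j => φ.1 (e j) (mahlerDagger A hr1 n) •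
    deltaSymbDagger he hr hr1 hD n j, map_sub, map_sum]
  simp only [Submodule.coe_sub, Submodule.coe_sum, Submodule.coe_smul, LinearMap.sub_apply,
    LinearMap.sum_apply, LinearMap.smul_apply, deltaSymbDagger_apply, map_smul, smul_eq_mul,
    mul_ite, mul_zero, Finset.sum_ite_eq, Finset.mem_univ, if_true]
  congr 1
  refine Finset.sum_congr rfl fun n _ => ?_
  -- The projection built into the delta symbols does not alter the coordinates of an actual symbol.
  have hx : κ (projPlus p) * φ.1 (e j) (mahlerDagger A hr1 n) =
      φ.1 (e j) (mahlerDagger A hr1 n) :=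
    map_projPlus_smul hp2 κ (LinearMap.congr_fun (Symb.neg_one_smul φ (e j)) _)
  conv_rhs => rw [← hx]
  ring

/-- The matrix of `U_p` on `Symb(𝒟_r^†(A))` is the image of its matrix on `Symb(D^int)`. -/
lemma IsUp.apply_deltaSymbDagger [NeZero d] (hκ : Continuous κ) {hpN : p.Coprime N}
    {V : Symb N hS (daggerDist p A r) →ₗ[A] Symb N hS (daggerDist p A r)}
    (hV : IsUp hpN hS (daggerDist p A r) V) (i j : ℕ) :
    (V (deltaSymbDagger he hr hr1 hD (j / d) (Fin.ofNat d j))).1 (e (Fin.ofNat d i))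
      (mahlerDagger A hr1 (i / d)) = κ (upMatrix he hpN i j) := by
  have hm : ∀ g, (fwdDiff (1 : ℤ_[p]))^[j / d]
      (weightAct (tautChar κ) g (mahlerDagger A hr1 (i / d)).1) 0 =
        κ ((fwdDiff (1 : ℤ_[p]))^[j / d] (weightAct univChar g (mahlerFun (i / d)).1) 0) :=
    fun g => by
      rw [← fwdDiff_comp_ringHom, ← weightAct_tautChar]
      exact congrArg (fun F => (fwdDiff (1 : ℤ_[p]))^[j / d] (weightAct (tautChar κ) g F) 0)
        (funext fun z => (map_algebraMap_eq_smul_one hκ _).symm)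
  rw [hV.apply_basis he, upMatrix, upEntry, map_mul, map_sum, Finset.mul_sum, LinearMap.sum_apply]
  refine Finset.sum_congr rfl fun k _ => ?_
  rw [LinearMap.smul_apply, dualAct_apply, deltaSymbDagger_apply]
  split_ifs
  · rw [map_zsmul, mul_smul_comm, ← hm]
  · rw [map_zero, mul_zero, smul_zero]

end AnalyticUp

/-! ### Compactness of `U_p` and its Fredholm determinant. -/

section Compactness

variable {p : ℕ} [Fact p.Prime] {A : Type*} [NormedCommRing A] [NormedAlgebra ℚ_[p] A]

section

variable {χ : ℤ_[p]ˣ →* A} {r : ℝ} {N d : ℕ} {hS : IsStable χ (daggerFun p A r)}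

lemma norm_apply_le_symbNorm (e : Fin d → degZeroDiv (cuspSet N)) {s : ℝ} (hs : 0 < s)
    (hrs : r < s) (φ : Symb N hS (daggerDist p A r)) (j : Fin d) (f : locAn p A s) :
    ‖φ.1 (e j) ⟨f.1, locAn_le_daggerFun hs hrs f.2⟩‖ ≤
      symbNorm e hs hrs φ * taylorNorm s f.1 := by
  refine (IsBdd.norm_le (φ.2.1 (e j) s hs hrs).1 f).trans ?_
  refine mul_le_mul_of_nonneg_right ?_ (taylorNorm_nonneg _ _)
  exact le_ciSup (f := fun i => distNorm s (restrictDist hs hrs (φ.1 (e i))))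
    (Set.finite_range _).bddAbove j

lemma symbNorm_nonneg (e : Fin d → degZeroDiv (cuspSet N)) {s : ℝ} (hs : 0 < s)
    (hrs : r < s) (φ : Symb N hS (daggerDist p A r)) : 0 ≤ symbNorm e hs hrs φ :=
  Real.iSup_nonneg fun _ => distNorm_nonneg _ _

lemma symbNorm_le {e : Fin d → degZeroDiv (cuspSet N)} {s : ℝ} {hs : 0 < s}
    {hrs : r < s} {φ : Symb N hS (daggerDist p A r)} {K : ℝ} (hK : 0 ≤ K)
    (h : ∀ j (f : locAn p A s),
      ‖φ.1 (e j) ⟨f.1, locAn_le_daggerFun hs hrs f.2⟩‖ ≤ K * taylorNorm s f.1) :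
    symbNorm e hs hrs φ ≤ K :=
  Real.iSup_le (fun j => distNorm_le hK (h j)) hK

/-- The functional `φ ↦ φ(x)(f)` on symbols. -/
def symbEval (x : degZeroDiv (cuspSet N)) (f : daggerFun p A r) :
    Symb N hS (daggerDist p A r) →ₗ[A] A where
  toFun φ := φ.1 x f
  map_add' _ _ := rfl
  map_smul' _ _ := rfl

lemma exists_norm_symbEval_le (e : Fin d → degZeroDiv (cuspSet N)) {s : ℝ} (hs : 0 < s)
    (hrs : r < s) (j : Fin d) {f : daggerFun p A r} (hf : f.1 ∈ locAn p A s) :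
    ∃ K, ∀ φ : Symb N hS (daggerDist p A r), ‖symbEval (e j) f φ‖ ≤ K * symbNorm e hs hrs φ :=
  ⟨taylorNorm s f.1, fun φ =>
    (norm_apply_le_symbNorm e hs hrs φ j ⟨f.1, hf⟩).trans_eq (mul_comm _ _)⟩

end

variable [IsUltrametricDist A] [CompleteSpace A] {κ : Iwasawa p →+* A} {r : ℝ}
  {hS : IsStable (tautChar κ) (daggerFun p A r)} {N d : ℕ} {e : Fin d → degZeroDiv (cuspSet N)}

/-- `U_p` is the limit of its truncated Mahler expansions. -/
lemma IsUp.eventually_symbNorm_sub_le [NeZero d] (hp2 : p ≠ 2) (hκ : Continuous κ)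
    (he : IsFreeBasis (cuspSet N) (p * N) e) (hr : 0 < r) (hr1 : r < 1)
    (hD : ∀ g, ∀ μ ∈ daggerDist p A r, dualAct hS g μ ∈ daggerDist p A r) {hpN : p.Coprime N}
    {V : Symb N hS (daggerDist p A r) →ₗ[A] Symb N hS (daggerDist p A r)}
    (hV : IsUp hpN hS (daggerDist p A r) V) {s : ℝ} (hs : 0 < s) (hrs : r < s) (hs1 : s < 1)
    (hχ : IsLocAnChar s (tautChar κ)) {ε : ℝ} (hε : 0 < ε) :
    ∀ᶠ k in atTop, ∀ φ, symbNorm e hs hrs (V φ - ∑ i : Fin (k * d),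
      φ.1 (e (Fin.ofNat d i)) (mahlerDagger A hr1 (i / d)) •
        V (deltaSymbDagger he hr hr1 hD (i / d) (Fin.ofNat d i))) ≤
          ε * symbNorm e hs hrs φ := by
  obtain ⟨B, hB⟩ := exists_norm_tautChar_le hκ
  have hev : ∀ᶠ k in atTop, ∀ i : Fin d, ∀ q ∈ heckeSupp he hpN i, ∀ f ∈ locAn p A s,
      (fun z => weightAct (tautChar κ) (heckeElt q) f z - ∑ n ∈ Finset.range k,
        ((mahler n z : ℤ_[p]) : ℚ_[p]) •
          (fwdDiff (1 : ℤ_[p]))^[n] (weightAct (tautChar κ) (heckeElt q) f) 0) ∈ locAn p A s ∧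
      taylorNorm s (fun z => weightAct (tautChar κ) (heckeElt q) f z - ∑ n ∈ Finset.range k,
        ((mahler n z : ℤ_[p]) : ℚ_[p]) •
          (fwdDiff (1 : ℤ_[p]))^[n] (weightAct (tautChar κ) (heckeElt q) f) 0) ≤
            ε * taylorNorm s f := by
    refine eventually_all.2 fun i => (eventually_all_finset _).2 fun q _ => ?_
    exact eventually_taylorNorm_weightAct_sub_mahler_le hp2 hs hs1 hχ hB _ (heckeElt_dvd q) hε
  filter_upwards [hev] with k hk φ
  -- The error of the truncated operator is `V ψ`, and its value at `f` is a combination of values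
  -- of `φ` on the Mahler remainders of the functions `g · f`, which are uniformly small.
  set ψ := φ - ∑ i : Fin (k * d), φ.1 (e (Fin.ofNat d i)) (mahlerDagger A hr1 (i / d)) •
      deltaSymbDagger he hr hr1 hD (i / d) (Fin.ofNat d i) with hψ
  have hVψ : V φ - ∑ i : Fin (k * d), φ.1 (e (Fin.ofNat d i)) (mahlerDagger A hr1 (i / d)) •
      V (deltaSymbDagger he hr hr1 hD (i / d) (Fin.ofNat d i)) = V ψ := by
    rw [hψ, map_sub, map_sum]
    simp only [map_smul]
  have h0 := symbNorm_nonneg e hs hrs φ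
  rw [hVψ]
  refine symbNorm_le (by positivity) fun j f => ?_
  have hf0 := taylorNorm_nonneg s f.1
  rw [hV.apply_basis he, LinearMap.sum_apply]
  refine IsUltrametricDist.norm_sum_le_of_forall_le_of_nonneg (by positivity) fun q hq => ?_
  rw [LinearMap.smul_apply, dualAct_apply, norm_zsmul_eq (p := p)]
  refine (mul_le_of_le_one_left (norm_nonneg _) (Padic.norm_int_le_one _)).trans ?_
  rw [hψ, sub_sum_deltaSymbDagger_apply he hr hr1 hD hp2]
  obtain ⟨h1, h2⟩ := hk j q hq f.1 f.2
  have h3 := norm_apply_le_symbNorm e hs hrs φ q.2.2 ⟨_, h1⟩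
  refine le_trans (le_of_eq ?_) (h3.trans ((mul_le_mul_of_nonneg_left h2 h0).trans_eq (by ring)))
  congr 2
  refine Subtype.ext (funext fun z => ?_)
  simp only [Submodule.coe_sub, Submodule.coe_sum, Submodule.coe_smul, Pi.sub_apply,
    Finset.sum_apply, Pi.smul_apply, mahlerDagger, smul_eq_mul, mul_smul_comm, mul_one]

/-- The characteristic power series of `U_p` on `Symb(𝒟_r^†(A))`. -/
theorem IsUp.isCharSeriesDagger [NeZero d] (hp2 : p ≠ 2) (hκ : Continuous κ)
    (he : IsFreeBasis (cuspSet N) (p * N) e) (hr : 0 < r) (hr1 : r < 1)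
    (hD : ∀ g, ∀ μ ∈ daggerDist p A r, dualAct hS g μ ∈ daggerDist p A r) {hpN : p.Coprime N}
    {V : Symb N hS (daggerDist p A r) →ₗ[A] Symb N hS (daggerDist p A r)}
    (hV : IsUp hpN hS (daggerDist p A r) V) {F : PowerSeries (Iwasawa p)}
    (hF : IsLimitCharSeries (upMatrix he hpN) F) : IsCharSeriesDagger e V (F.map κ) := by
  intro s hs hrs hs1 hχ
  -- The functionals are the first `k d` Mahler coordinates and the vectors the images of the delta
  -- symbols, so the Gram matrix is the image under `κ` of the leading `k d` by `k d` block of `P`.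
  refine ⟨fun k => k * d,
    fun k i => symbEval (e (Fin.ofNat d i)) (mahlerDagger A hr1 (i / d)),
    fun k i => V (deltaSymbDagger he hr hr1 hD (i / d) (Fin.ofNat d i)),
    fun k i => exists_norm_symbEval_le e hs hrs _ (mahlerDagger_mem_locAn hr1 hs _),
    fun ε hε => hV.eventually_symbNorm_sub_le hp2 hκ he hr hr1 hD hs hrs hs1 hχ hε, fun n => ?_⟩
  have hmul : Tendsto (fun k : ℕ => k * d) atTop atTop :=
    tendsto_id.atTop_mul_const' (Nat.pos_of_ne_zero (NeZero.ne d))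
  rw [PowerSeries.coeff_map]
  refine ((hκ.tendsto _).comp ((hF n).comp hmul)).congr fun k => ?_
  simp only [Function.comp_apply]
  rw [← coeff_charpolyRev_map]
  congr 3
  ext i j
  exact (hV.apply_deltaSymbDagger he hr hr1 hD hκ i j).symm

end Compactness

end Halo

end

theorem proposition4p3 (p : ℕ) [Fact p.Prime] (hp2 : p ≠ 2) (l : ℕ) (hl : l.Prime)
    (hl12 : l % 12 = 11) (hpN : p.Coprime (l ^ 2)) (t : ℕ)
    (e : Fin ((p + 1) * t) → degZeroDiv (cuspSet (l ^ 2)))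
    (he : IsFreeBasis (cuspSet (l ^ 2)) (p * l ^ 2) e) :
    (Function.Injective (evalMap (p := p) e) ∧
      Set.range (evalMap (p := p) e) = 
        {μ | ∀ i, univChar (-1 : ℤ_[p]ˣ) • (μ i).1 = (μ i).1}) ∧
    ∃ U : Symb (l ^ 2) (isStable_contFun (p := p)) (Dint p) →ₗ[Iwasawa p]
        Symb (l ^ 2) (isStable_contFun (p := p)) (Dint p),
      IsUp hpN isStable_contFun (Dint p) U ∧
      ∃ P : ℕ → ℕ → Iwasawa p, IsMahlerMatrix e U P ∧
        (∀ Q, IsMahlerMatrix e U Q → Q = P) ∧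
        ∃ F : PowerSeries (Iwasawa p),
          (IsLimitCharSeries P F ∧ ∀ G, IsLimitCharSeries P G → G = F) ∧
          (∀ (A : Type*) [NormedCommRing A] [NormedAlgebra ℚ_[p] A] [IsUltrametricDist A]
            [CompleteSpace A] (κ : Iwasawa p →+* A), Continuous κ →
            ∀ (r : ℝ), 0 < r → ∀ (hr1 : r < 1)
              (hχ : ∃ s, 0 < s ∧ r < s ∧ IsLocAnChar s (tautChar κ)),
              ∃ V : Symb (l ^ 2) (isStable_daggerFun hr1 hχ) (daggerDist p A r) →ₗ[A]
                  Symb (l ^ 2) (isStable_daggerFun hr1 hχ) (daggerDist p A r),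
                IsUp hpN (isStable_daggerFun hr1 hχ) (daggerDist p A r) V ∧
                IsCharSeriesDagger e V (F.map κ)) ∧
          ∀ n, toHalo p (PowerSeries.coeff n F) ∈
            Ideal.span {toHalo p (paramT p) ^ lowerBound p t n} := by
  have hN : 1 < l ^ 2 := Nat.one_lt_pow two_ne_zero hl.one_lt
  -- `Δ_C⁰` is nonzero, so the basis is nonempty; without this the matrix index `m d + i` could not
  -- be decoded.
  have : NeZero ((p + 1) * t) := ⟨(he.pos hN).ne'⟩
  have hU := isUp_heckeU (hS := isStable_contFun (p := p)) hpN fun g μ hμ =>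
    dualAct_mem_Dint g hμ
  have hP := isMahlerMatrix_upMatrix hp2 he hU
  have hhalo := isHaloMatrix_upMatrix he hpN hp2
  have hF := hhalo.isLimitCharSeries hp2 (he.pos hN)
  refine ⟨⟨evalMap_injective he, range_evalMap he⟩, _, hU, upMatrix he hpN, hP,
    fun Q hQ => IsMahlerMatrix.unique hp2 he hQ hP, charSeries (upMatrix he hpN),
    ⟨hF, fun G hG => hG.unique hF⟩, ?_, fun n => toHalo_mem (hF.coeff_mem hhalo n)⟩
  intro A _ _ _ _ κ hκ r hr hr1 hχ
  obtain ⟨B, hB⟩ := exists_norm_tautChar_le hκ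
  have hD : ∀ g, ∀ μ ∈ daggerDist p A r,
      dualAct (isStable_daggerFun hr1 hχ) g μ ∈ daggerDist p A r := fun g μ hμ =>
    dualAct_mem_daggerDist hr hr1 hχ hB _ g hμ
  have hV := isUp_heckeU hpN hD
  exact ⟨_, hV, hV.isCharSeriesDagger hp2 hκ he hr hr1 hD hF⟩
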